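/- **Setting.** Let $G$ be a countable discrete group with unit $e$ and let $\mathcal A=\bigoplus_{g\in G}\mathcal A_g$ be a unital complex $*$-algebra graded by $G$: the $\mathcal A_g$ are linear subspaces with $\mathcal A_g\mathcal A_h\subseteq\mathcal A_{gh}$ and $(\mathcal A_g)^*\subseteq\mathcal A_{g^{-1}}$. For a subgroup $K\subseteq G$ let $\mathcal A_K=\bigoplus_{g\in K}\mathcal A_g$, and let $p_K:\mathcal A\to\mathcal A_K$, $\sum_g a_g\mapsto\sum_{g\in K}a_g$. Let $\mathcal B=\mathcal A_e$, and let $\widehat{\mathcal B}^+$ be the set of unital $*$-homomorphisms $\chi:\mathcal B\to\mathbb C$ with $\chi(b)\ge 0$ for every $b\in\mathcal B$ that is a finite sum of elements $a^*a$, $a\in\mathcal A$, with the topology of pointwise convergence on $\mathcal B$. Assume that $\mathcal B$ is commutative and countably generated as a $*$-algebra, that $\widehat{\mathcal B}^+$ is locally compact, and that $$\chi(c^*d)\,\chi(d^*c)=\chi(c^*c)\,\chi(d^*d)\qquad(\chi\in\widehat{\mathcal B}^+,\ g\in G,\ c,d\in\mathcal A_g).$$ *Partial action.* For $\chi\in\widehat{\mathcal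 B}^+$ and $g\in G$, $\chi^g$ is defined if $\chi(a^*a)\ne0$ for some $a\in\mathcal A_g$, and then $\chi^g(b)=\chi(a^*ba)/\chi(a^*a)$ for $b\in\mathcal B$; this is an element of $\widehat{\mathcal B}^+$ that does not depend on $a$. Let $\operatorname{Orb}\chi=\{\chi^g: \chi^g \text{ is defined}\}$, let $\operatorname{St}\chi=\{g:\chi^g\text{ is defined and }\chi^g=\chi\}$ (a subgroup of $G$), and for $\Delta\subseteq\widehat{\mathcal B}^+$ let $\Delta^g=\{\chi^g:\chi\in\Delta,\ \chi^g\text{ is defined}\}$. *Representations.* A $*$-representation $\pi$ of a $*$-algebra $\mathcal C$ is an algebra homomorphism of $\mathcal C$ into the linear operators on a dense subspace $\mathcal D(\pi)$ of a Hilbert space $\mathcal H_\pi$ with $\langle\pi(c)\varphi,\psi\rangle=\langle\varphi,\pi(c^*)\psi\rangle$ for $\varphi,\psi\in\mathcal D(\pi)$. Its graph topology is given by the norms $\|\varphi\|+\|\pi(c)\varphi\|$, $c\in\mathcal C$, on $\mathcal D(\pi)$; $\pi$ is closed if $\mathcal D(\pi)$ is complete in it, and the closure of $\pi$ is the extension of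 $\pi$ by continuity to the completion. $\pi$ is bounded if all operators $\pi(c)$ are bounded. Two $*$-representations $\pi_1,\pi_2$ are unitarily equivalent if an isometric linear map of $\mathcal D(\pi_1)$ onto $\mathcal D(\pi_2)$ intertwines them. $\pi$ is irreducible if $\pi=\pi_1\oplus\pi_2$ is only possible with $\mathcal D(\pi_1)=0$ or $\mathcal D(\pi_2)=0$. The commutant $\pi(\mathcal C)'$ is the set of bounded operators $T$ on $\mathcal H_\pi$ with $T\mathcal D(\pi)\subseteq\mathcal D(\pi)$ and $\pi(c)T\varphi=T\pi(c)\varphi$ for $c\in\mathcal C$, $\varphi\in\mathcal D(\pi)$. If $\mathcal C$ is commutative, $\pi$ is integrable if it is closed and $\overline{\pi(c^*)}=\pi(c)^*$ for all $c\in\mathcal C$. *Induction.* A $*$-representation $\rho$ of $\mathcal A_K$ is inducible if the sesquilinear form on $\mathcal A\otimes\mathcal D(\rho)$ with $\langle a\otimes\varphi,b\otimes\psi\rangle_0=\langle\rho(p_K(b^*a))\varphi,\psi\rangle$ satisfies $\langle\xi,\xi\rangle_0\ge0$ for all $\xi$. In this case $\operatorname{Ind}_{\mathcal A_K\uparrow\mathcal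 A}\rho$ is the closure of the $*$-representation $a[x\otimes\varphi]=[ax\otimes\varphi]$ of $\mathcal A$ on the quotient of $\mathcal A\otimes\mathcal D(\rho)$ by the null space of the form, in the Hilbert space completion of that quotient. *Well-behaved representations.* A $*$-representation $\pi$ of $\mathcal A$ is well-behaved if its restriction to $\mathcal B$ is integrable and there is a spectral measure $E_\pi$ on the Borel sets of $\widehat{\mathcal B}^+$ with $\overline{\pi(b)}=\int\chi(b)\,dE_\pi(\chi)$ for $b\in\mathcal B$ and $E_\pi(\Delta^g)\pi(a)\subseteq\pi(a)E_\pi(\Delta)$ for $g\in G$, $a\in\mathcal A_g$ and Borel sets $\Delta\subseteq\widehat{\mathcal B}^+$. It is associated with $\operatorname{Orb}\chi$ if moreover $E_\pi(\widehat{\mathcal B}^+\setminus\operatorname{Orb}\chi)=0$. **Theorem.** Let $\chi\in\widehat{\mathcal B}^+$ and $H=\operatorname{St}\chi$. Consider $*$-representations $\rho$ of $\mathcal A_H$ whose restriction to $\mathcal B$ is a multiple of $\chi$, that is, $\rho(b)\varphi=\chi(b)\varphi$ for all $b\in\mathcal B$ and $\varphi\in\mathcal D(\rho)$. 1. Every such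 $\rho$ is bounded and inducible, and $\mathcal D(\rho)=\mathcal H_\rho$ if $\rho$ is closed. 2. The map $\rho\mapsto\operatorname{Ind}_{\mathcal A_H\uparrow\mathcal A}\rho$ is well defined on unitary equivalence classes. It is a bijection from the set of unitary equivalence classes of closed inducible $*$-representations $\rho$ of $\mathcal A_H$ whose restriction to $\mathcal B$ is a multiple of $\chi$ onto the set of unitary equivalence classes of well-behaved $*$-representations of $\mathcal A$ associated with $\operatorname{Orb}\chi$. 3. If $\rho$ is such a closed $*$-representation and $\pi=\operatorname{Ind}_{\mathcal A_H\uparrow\mathcal A}\rho$, then $\rho(\mathcal A_H)'$ and $\pi(\mathcal A)'$ are von Neumann algebras, and they are $*$-isomorphic. Moreover, $\pi$ is irreducible if and only if $\rho$ is irreducible. -/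

import Mathlib

universe u v w

noncomputable section

open scoped ComplexOrder TensorProduct

namespace GradedStar

/-- A `*`-representation of `A` on a dense linear subspace `dom` of the Hilbert space `H`. It is an
algebra homomorphism into the linear operators on `dom`; it is not required to preserve the unit. -/
structure StarRep (A : Type*) [Ring A] [StarRing A] [Algebra ℂ A]
    (H : Type*) [NormedAddCommGroup H] [InnerProductSpace ℂ H] where
  dom : Submodule ℂ H
  dense_dom : Dense (dom : Set H)
  act : A →ₙₐ[ℂ] Module.End ℂ dom
  inner_act : ∀ (a : A) (φ ψ : dom),
    inner ℂ (act a φ : H) (ψ : H) = inner ℂ (φ : H) (act (star a) ψ : H)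

namespace StarRep

theorem continuous_eval {A H : Type*} [TopologicalSpace H] (a : A) :
    Continuous fun p : H × (A → H) => p.2 a :=
  (continuous_apply a).comp continuous_snd

variable {A : Type*} [Ring A] [StarRing A] [Algebra ℂ A]
  {H : Type*} [NormedAddCommGroup H] [InnerProductSpace ℂ H]
  {H' : Type*} [NormedAddCommGroup H'] [InnerProductSpace ℂ H']
  {H'' : Type*} [NormedAddCommGroup H''] [InnerProductSpace ℂ H'']

/-- `π(a)` as an unbounded operator on `H` with domain `D(π)`. -/
def opr (π : StarRep A H) (a : A) : H →ₗ.[ℂ] H :=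
  ⟨π.dom, π.dom.subtype ∘ₗ π.act a⟩

/-- `φ ↦ (φ, (π(a) φ)ₐ)`. The graph topology of `π`, given by the norms `‖φ‖ + ‖π(a) φ‖`, is the
topology that this injective map induces from the product topology on `H × (A → H)`. -/
def graphMap (π : StarRep A H) : π.dom →ₗ[ℂ] H × (A → H) where
  toFun φ := (φ, fun a => π.act a φ)
  map_add' φ ψ := by ext <;> simp
  map_smul' c φ := by ext <;> simp

/-- `π` is closed: `D(π)` is complete in the graph topology. As `H × (A → H)` is complete, this says
that the range of `graphMap` is closed. -/
def IsClosedRep (π : StarRep A H) : Prop := IsClosed (Set.range π.graphMap)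

/-- The completion of `D(π)` in the graph topology: the closure of the range of `graphMap`. -/
def graphClosure (π : StarRep A H) : Submodule ℂ (H × (A → H)) :=
  (LinearMap.range π.graphMap).topologicalClosure

theorem graphClosure_induction (π : StarRep A H) {P : H × (A → H) → Prop}
    (hP : IsClosed {p | P p}) (h : ∀ φ : π.dom, P (π.graphMap φ))
    {p : H × (A → H)} (hp : p ∈ π.graphClosure) : P p := by
  have h1 : closure (Set.range π.graphMap) ⊆ {p | P p} :=
    closure_minimal (by rintro _ ⟨φ, rfl⟩; exact h φ) hP
  apply h1
  have := hp
  rw [graphClosure, ← SetLike.mem_coe, Submodule.topologicalClosure_coe, LinearMap.coe_range] at this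
  exact this

theorem graphMap_mem (π : StarRep A H) (φ : π.dom) : π.graphMap φ ∈ π.graphClosure :=
  Submodule.le_topologicalClosure _ ⟨φ, rfl⟩

theorem graphClosure_add (π : StarRep A H) {p : H × (A → H)} (hp : p ∈ π.graphClosure) (a b : A) :
    p.2 (a + b) = p.2 a + p.2 b :=
  π.graphClosure_induction (P := fun p => p.2 (a + b) = p.2 a + p.2 b)
    (isClosed_eq (continuous_eval _) ((continuous_eval _).add (continuous_eval _)))
    (fun φ => by simp [graphMap]) hp

theorem graphClosure_smul (π : StarRep A H) {p : H × (A → H)} (hp : p ∈ π.graphClosure)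
    (c : ℂ) (a : A) : p.2 (c • a) = c • p.2 a :=
  π.graphClosure_induction (P := fun p => p.2 (c • a) = c • p.2 a)
    (isClosed_eq (continuous_eval _) ((continuous_eval _).const_smul c))
    (fun φ => by simp [graphMap]) hp

theorem graphClosure_inner (π : StarRep A H) {p q : H × (A → H)} (hp : p ∈ π.graphClosure)
    (hq : q ∈ π.graphClosure) (a : A) :
    inner ℂ (p.2 a) q.1 = inner ℂ p.1 (q.2 (star a)) := by
  refine π.graphClosure_induction (P := fun p => inner ℂ (p.2 a) q.1 = inner ℂ p.1 (q.2 (star a)))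
    (isClosed_eq ((continuous_eval _).inner continuous_const)
      (continuous_fst.inner continuous_const)) (fun φ => ?_) hp
  refine π.graphClosure_induction (P := fun q => inner ℂ ((π.graphMap φ).2 a) q.1 =
      inner ℂ (π.graphMap φ).1 (q.2 (star a)))
    (isClosed_eq (continuous_const.inner continuous_fst)
      (continuous_const.inner (continuous_eval _))) (fun ψ => ?_) hq
  exact π.inner_act a φ ψ

theorem graphClosure_fst_injective (π : StarRep A H) :
    Function.Injective (LinearMap.fst ℂ H (A → H) ∘ₗ π.graphClosure.subtype) := by
  rw [injective_iff_map_eq_zero]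
  rintro ⟨p, hp⟩ (h0 : p.1 = 0)
  have h2 : p.2 = 0 := by
    funext a
    refine π.dense_dom.eq_zero_of_inner_left (𝕜 := ℂ) fun ψ hψ => ?_
    have := π.graphClosure_inner hp (π.graphMap_mem ⟨ψ, hψ⟩) a
    rw [h0, inner_zero_left] at this
    exact this
  exact Subtype.ext (Prod.ext h0 h2)

/-- The first coordinate identifies the completion of `D(π)` with a subspace of `H`. -/
def closureEquiv (π : StarRep A H) : π.graphClosure ≃ₗ[ℂ]
    LinearMap.range (LinearMap.fst ℂ H (A → H) ∘ₗ π.graphClosure.subtype) :=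
  LinearEquiv.ofInjective _ π.graphClosure_fst_injective

/-- On the range of `graphMap` this is `φ ↦ π(a) φ`. -/
def shift (a : A) : H × (A → H) →ₗ[ℂ] H × (A → H) where
  toFun p := (p.2 a, fun b => p.2 (b * a))
  map_add' _ _ := rfl
  map_smul' _ _ := rfl

theorem shift_mem (π : StarRep A H) (a : A) {p : H × (A → H)} (hp : p ∈ π.graphClosure) :
    shift a p ∈ π.graphClosure := by
  refine π.graphClosure_induction (P := fun p => shift a p ∈ π.graphClosure)
    (IsClosed.preimage (f := shift a) ?_ (Submodule.isClosed_topologicalClosure _))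
    (fun φ => ?_) hp
  · exact (continuous_eval a).prodMk (continuous_pi fun b => continuous_eval (b * a))
  · convert π.graphMap_mem (π.act a φ) using 1
    simp [shift, graphMap]

def shiftHom (π : StarRep A H) : A →ₙₐ[ℂ] Module.End ℂ π.graphClosure where
  toFun a := (shift a).restrict fun _ hp => π.shift_mem a hp
  map_smul' c a := by
    ext p : 1
    refine Subtype.ext (Prod.ext (π.graphClosure_smul p.2 c a) (funext fun b => ?_))
    exact (congrArg p.1.2 (mul_smul_comm c b a)).trans (π.graphClosure_smul p.2 c (b * a))
  map_zero' := by
    have h (p : π.graphClosure) : p.1.2 0 = 0 := by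
      simpa using π.graphClosure_smul p.2 0 0
    ext p : 1
    refine Subtype.ext (Prod.ext (h p) (funext fun b => ?_))
    exact (congrArg p.1.2 (mul_zero b)).trans (h p)
  map_add' a a' := by
    ext p : 1
    refine Subtype.ext (Prod.ext (π.graphClosure_add p.2 a a') (funext fun b => ?_))
    exact (congrArg p.1.2 (mul_add b a a')).trans (π.graphClosure_add p.2 (b * a) (b * a'))
  map_mul' a a' := by
    ext p : 1
    refine Subtype.ext (Prod.ext rfl (funext fun b => ?_))
    exact congrArg p.1.2 (mul_assoc b a a').symm

/-- The closure of `π`: its domain is the completion of `D(π)` in the graph topology, as a subspace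
of `H`, and `π(a)` is extended by continuity. -/
def closure (π : StarRep A H) : StarRep A H where
  dom := LinearMap.range (LinearMap.fst ℂ H (A → H) ∘ₗ π.graphClosure.subtype)
  dense_dom := π.dense_dom.mono fun φ hφ => ⟨⟨_, π.graphMap_mem ⟨φ, hφ⟩⟩, rfl⟩
  act := (π.closureEquiv.conjAlgEquiv ℂ : _ →ₙₐ[ℂ] _).comp π.shiftHom
  inner_act a φ ψ := by
    obtain ⟨p, rfl⟩ := π.closureEquiv.surjective φ
    obtain ⟨q, rfl⟩ := π.closureEquiv.surjective ψ
    have h (a : A) (p) : (π.closureEquiv.conjAlgEquiv ℂ (π.shiftHom a)) (π.closureEquiv p)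
        = π.closureEquiv (π.shiftHom a p) := by
      simp [LinearEquiv.conjAlgEquiv_apply]
    change inner ℂ ((π.closureEquiv.conjAlgEquiv ℂ (π.shiftHom a)) (π.closureEquiv p) : H) _ =
      inner ℂ _ ((π.closureEquiv.conjAlgEquiv ℂ (π.shiftHom (star a))) (π.closureEquiv q) : H)
    rw [h, h]
    exact π.graphClosure_inner p.2 q.2 a

end StarRep

open Classical in
/-- A grading of the unital `*`-algebra `A` by the discrete group `G`: `A = ⨁ A_g` with
`A_g A_h ⊆ A_{gh}` and `(A_g)^* ⊆ A_{g⁻¹}`. -/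
structure StarGrading (G : Type*) [Group G] (A : Type*) [Ring A] [StarRing A] [Algebra ℂ A] where
  piece : G → Submodule ℂ A
  isInternal : DirectSum.IsInternal piece
  mul_mem : ∀ {g h : G} {a b : A}, a ∈ piece g → b ∈ piece h → a * b ∈ piece (g * h)
  star_mem : ∀ {g : G} {a : A}, a ∈ piece g → star a ∈ piece g⁻¹

namespace StarGrading

variable {G : Type*} [Group G] {A : Type*} [Ring A] [StarRing A] [Algebra ℂ A]

section Components

variable (𝒢 : StarGrading G A)

open Classical in
/-- `a ↦ (a_g)_g`, the decomposition into homogeneous components. -/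
def decomp : A ≃ₗ[ℂ] DirectSum G fun g => 𝒢.piece g :=
  (LinearEquiv.ofBijective (DirectSum.coeLinearMap 𝒢.piece) 𝒢.isInternal).symm

open Classical in
/-- `∑_g a_g ↦ ∑_{g ∈ X} a_g`. -/
def restrictTo (X : Set G) : A →ₗ[ℂ] A :=
  DirectSum.coeLinearMap 𝒢.piece ∘ₗ
    DFinsupp.filterLinearMap ℂ (fun g => 𝒢.piece g) (· ∈ X) ∘ₗ 𝒢.decomp.toLinearMap

/-- `A_X = ∑_{g ∈ X} A_g`. -/
def span (X : Set G) : Submodule ℂ A := ⨆ g ∈ X, 𝒢.piece g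

theorem piece_le_span {X : Set G} {g : G} (hg : g ∈ X) : 𝒢.piece g ≤ 𝒢.span X :=
  le_iSup₂_of_le g hg le_rfl

theorem restrictTo_mem (X : Set G) (a : A) : 𝒢.restrictTo X a ∈ 𝒢.span X := by
  classical
  rw [span, Submodule.biSup_eq_range_dfinsupp_lsum]
  refine ⟨𝒢.decomp a, ?_⟩
  rw [restrictTo]
  congr!

open Classical in
theorem decomp_of_mem {g : G} {a : A} (ha : a ∈ 𝒢.piece g) :
    𝒢.decomp a = DirectSum.lof ℂ G (fun g => 𝒢.piece g) g ⟨a, ha⟩ := by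
  rw [decomp, LinearEquiv.symm_apply_eq]
  exact (DirectSum.coeLinearMap_lof 𝒢.piece g ⟨a, ha⟩).symm

theorem restrictTo_of_mem {X : Set G} {g : G} (hg : g ∈ X) {a : A} (ha : a ∈ 𝒢.piece g) :
    𝒢.restrictTo X a = a := by
  classical
  simp only [restrictTo, LinearMap.comp_apply, LinearEquiv.coe_coe, decomp_of_mem 𝒢 ha]
  erw [DFinsupp.filterLinearMap_apply, DFinsupp.filter_single_pos _ _ hg]
  exact DirectSum.coeLinearMap_lof _ _ _

theorem restrictTo_of_notMem {X : Set G} {g : G} (hg : g ∉ X) {a : A} (ha : a ∈ 𝒢.piece g) :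
    𝒢.restrictTo X a = 0 := by
  classical
  simp only [restrictTo, LinearMap.comp_apply, LinearEquiv.coe_coe, decomp_of_mem 𝒢 ha]
  erw [DFinsupp.filterLinearMap_apply, DFinsupp.filter_single_neg _ _ hg]
  exact map_zero _

theorem induction_on {P : A → Prop} (zero : P 0) (add : ∀ a b, P a → P b → P (a + b))
    (mem : ∀ g, ∀ a ∈ 𝒢.piece g, P a) (a : A) : P a := by
  classical
  have h : a ∈ ⨆ g, 𝒢.piece g := by
    rw [𝒢.isInternal.submodule_iSup_eq_top]; trivial
  exact Submodule.iSup_induction 𝒢.piece (motive := P) h mem zero add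

theorem one_mem : (1 : A) ∈ 𝒢.piece 1 := by
  have key (x : A) : 𝒢.restrictTo {1} 1 * x = x := by
    induction x using 𝒢.induction_on with
    | zero => simp
    | add a b ha hb => rw [mul_add, ha, hb]
    | mem h x hx =>
      have h2 (a : A) : 𝒢.restrictTo {h} (a * x) = 𝒢.restrictTo {1} a * x := by
        induction a using 𝒢.induction_on with
        | zero => simp
        | add a b ha hb => simp [add_mul, ha, hb]
        | mem g a ha =>
          by_cases hg : g = 1
          · subst hg
            rw [𝒢.restrictTo_of_mem (g := 1) (Set.mem_singleton _) ha,
              𝒢.restrictTo_of_mem (g := 1 * h) (by simp) (𝒢.mul_mem ha hx)]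
          · rw [𝒢.restrictTo_of_notMem (g := g) (by simpa using hg) ha, zero_mul,
              𝒢.restrictTo_of_notMem (g := g * h) (by simpa using hg) (𝒢.mul_mem ha hx)]
      rw [← h2, one_mul, 𝒢.restrictTo_of_mem (Set.mem_singleton _) hx]
  have h1 := 𝒢.restrictTo_mem {1} 1
  rw [← mul_one (𝒢.restrictTo {1} 1), key] at h1
  simpa [span] using h1

theorem span_mul_mem (K : Subgroup G) {a b : A} (ha : a ∈ 𝒢.span K) (hb : b ∈ 𝒢.span K) :
    a * b ∈ 𝒢.span K := by
  have h : 𝒢.span K * 𝒢.span K ≤ 𝒢.span K := by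
    conv_lhs => rw [span]
    simp only [Submodule.iSup_mul, Submodule.mul_iSup, iSup_le_iff]
    intro h hh g hg
    rw [Submodule.mul_le]
    intro x hx y hy
    exact 𝒢.piece_le_span (K.mul_mem hg hh) (𝒢.mul_mem hx hy)
  exact h (Submodule.mul_mem_mul ha hb)

theorem restrictTo_star (K : Subgroup G) (a : A) :
    𝒢.restrictTo K (star a) = star (𝒢.restrictTo K a) := by
  induction a using 𝒢.induction_on with
  | zero => simp
  | add a b ha hb => simp [ha, hb]
  | mem g a ha =>
    by_cases hg : g ∈ (K : Set G)
    · rw [𝒢.restrictTo_of_mem hg ha,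
        𝒢.restrictTo_of_mem (g := g⁻¹) (by simpa using hg) (𝒢.star_mem ha)]
    · rw [𝒢.restrictTo_of_notMem hg ha,
        𝒢.restrictTo_of_notMem (g := g⁻¹) (by simpa using hg) (𝒢.star_mem ha), star_zero]

theorem span_star_mem (K : Subgroup G) {a : A} (ha : a ∈ 𝒢.span K) : star a ∈ 𝒢.span K := by
  refine Submodule.iSup_induction' (fun g => ⨆ _ : g ∈ (K : Set G), 𝒢.piece g)
    (motive := fun a _ => star a ∈ 𝒢.span K) (fun g a ha => ?_) (by simp)
    (fun a b _ _ ha hb => by rw [star_add]; exact Submodule.add_mem _ ha hb) ha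
  by_cases hg : g ∈ (K : Set G)
  · simp only [hg, iSup_pos] at ha
    exact 𝒢.piece_le_span (K.inv_mem hg) (𝒢.star_mem ha)
  · simp only [hg, iSup_neg, not_false_eq_true, Submodule.mem_bot] at ha
    simp [ha]

variable [StarModule ℂ A]

/-- The `*`-subalgebra `A_K = ⨁_{g ∈ K} A_g` for a subgroup `K` of `G`. -/
def sub (K : Subgroup G) : StarSubalgebra ℂ A where
  carrier := 𝒢.span K
  mul_mem' := 𝒢.span_mul_mem K
  add_mem' := Submodule.add_mem _
  algebraMap_mem' c := by
    rw [Algebra.algebraMap_eq_smul_one]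
    exact Submodule.smul_mem _ _ (𝒢.piece_le_span K.one_mem 𝒢.one_mem)
  star_mem' := 𝒢.span_star_mem K

/-- The `*`-subalgebra `B = A_e`. -/
def base : StarSubalgebra ℂ A where
  carrier := 𝒢.piece 1
  mul_mem' ha hb := by simpa using 𝒢.mul_mem ha hb
  add_mem' := Submodule.add_mem _
  algebraMap_mem' c := by
    rw [Algebra.algebraMap_eq_smul_one]
    exact Submodule.smul_mem _ _ 𝒢.one_mem
  star_mem' ha := by simpa using 𝒢.star_mem ha

theorem base_le_sub (K : Subgroup G) : 𝒢.base ≤ 𝒢.sub K :=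
  𝒢.piece_le_span K.one_mem

/-- The conditional expectation `p_K : A → A_K`, `∑_g a_g ↦ ∑_{g ∈ K} a_g`. -/
def expect (K : Subgroup G) : A →ₗ[ℂ] 𝒢.sub K :=
  (𝒢.restrictTo K).codRestrict (𝒢.sub K).toSubalgebra.toSubmodule (𝒢.restrictTo_mem K)

end Components

end StarGrading

section Induction

variable {G : Type*} [Group G] {A : Type*} [Ring A] [StarRing A] [Algebra ℂ A] [StarModule ℂ A]
  {𝒢 : StarGrading G A} {K : Subgroup G}
  {H : Type*} [NormedAddCommGroup H] [InnerProductSpace ℂ H]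

namespace StarGrading

theorem expect_star (𝒢 : StarGrading G A) (K : Subgroup G) (a : A) :
    𝒢.expect K (star a) = star (𝒢.expect K a) :=
  Subtype.ext (𝒢.restrictTo_star K a)

end StarGrading

namespace StarRep

/-- The sesquilinear form on `A ⊗ D(ρ)` with `⟨a ⊗ φ, b ⊗ ψ⟩₀ = ⟨ρ(p_K(b^* a)) φ, ψ⟩`. As is usual in
Mathlib, it is written conjugate-linear in its first argument. -/
def indForm (ρ : StarRep (𝒢.sub K) H) :
    A ⊗[ℂ] ρ.dom →ₗ⋆[ℂ] A ⊗[ℂ] ρ.dom →ₗ[ℂ] ℂ :=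
  TensorProduct.lift <| LinearMap.mk₂'ₛₗ (starRingEnd ℂ) (starRingEnd ℂ)
    (fun y ψ => TensorProduct.lift <| LinearMap.mk₂ ℂ
      (fun x φ => inner ℂ (ψ : H) (ρ.act (𝒢.expect K (star y * x)) φ : H))
      (by intros; simp [mul_add])
      (by intros; simp)
      (by intros; simp)
      (by intros; simp))
    (by intros; ext; simp [add_mul])
    (by intros; ext; simp)
    (by intros; ext; simp)
    (by intros; ext; simp [mul_comm])

@[simp] theorem indForm_tmul (ρ : StarRep (𝒢.sub K) H) (x y : A) (φ ψ : ρ.dom) :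
    ρ.indForm (y ⊗ₜ ψ) (x ⊗ₜ φ) = inner ℂ (ψ : H) (ρ.act (𝒢.expect K (star y * x)) φ : H) := rfl

/-- `ρ` is inducible: the form `⟨·,·⟩₀` on `A ⊗ D(ρ)` is nonnegative. -/
def Inducible (ρ : StarRep (𝒢.sub K) H) : Prop := ∀ ξ : A ⊗[ℂ] ρ.dom, 0 ≤ ρ.indForm ξ ξ

theorem indForm_conj (ρ : StarRep (𝒢.sub K) H) (ξ η : A ⊗[ℂ] ρ.dom) :
    (starRingEnd ℂ) (ρ.indForm ξ η) = ρ.indForm η ξ := by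
  induction ξ with
  | zero => simp
  | add ξ ξ' h h' => simp [h, h']
  | tmul y ψ =>
    induction η with
    | zero => simp
    | add η η' h h' => simp [h, h']
    | tmul x φ =>
      rw [indForm_tmul, indForm_tmul, inner_conj_symm, ρ.inner_act, ← 𝒢.expect_star]
      simp

@[reducible] def indCore (ρ : StarRep (𝒢.sub K) H) (hρ : ρ.Inducible) :
    PreInnerProductSpace.Core ℂ (A ⊗[ℂ] ρ.dom) where
  inner ξ η := ρ.indForm ξ η
  conj_inner_symm ξ η := ρ.indForm_conj η ξ
  re_inner_nonneg ξ := (Complex.le_def.1 (hρ ξ)).1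
  add_left ξ η ζ := by simp
  smul_left ξ η c := by simp

/-- `A ⊗ D(ρ)` as a semi-inner product space with the form `⟨·,·⟩₀`. -/
def IndPre (ρ : StarRep (𝒢.sub K) H) (_hρ : ρ.Inducible) := A ⊗[ℂ] ρ.dom

variable {ρ : StarRep (𝒢.sub K) H} (hρ : ρ.Inducible)

instance : SeminormedAddCommGroup (IndPre ρ hρ) :=
  @InnerProductSpace.Core.toSeminormedAddCommGroup ℂ (A ⊗[ℂ] ρ.dom) _ _ _ (ρ.indCore hρ)

instance : InnerProductSpace ℂ (IndPre ρ hρ) :=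
  InnerProductSpace.ofCore (ρ.indCore hρ)

/-- The Hilbert space of the induced representation: the completion of the quotient of `A ⊗ D(ρ)` by
the null space of `⟨·,·⟩₀`. -/
abbrev IndSpace (ρ : StarRep (𝒢.sub K) H) (hρ : ρ.Inducible) :=
  UniformSpace.Completion (IndPre ρ hρ)

/-- The canonical map from `A ⊗ D(ρ)` to its completion. Its kernel is the null space of the form, and
its range is a copy of the quotient by the null space. -/
def indMk : IndPre ρ hρ →ₗ[ℂ] IndSpace ρ hρ :=
  (UniformSpace.Completion.toComplₗᵢ (𝕜 := ℂ) (E := IndPre ρ hρ)).toLinearMap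

theorem inner_indMk (ξ η : IndPre ρ hρ) :
    inner ℂ (indMk hρ ξ) (indMk hρ η) = ρ.indForm ξ η :=
  UniformSpace.Completion.inner_coe ξ η

/-- `x ⊗ φ ↦ a x ⊗ φ`. -/
def indMul (a : A) : IndPre ρ hρ →ₗ[ℂ] IndPre ρ hρ :=
  (LinearMap.mulLeft ℂ a).rTensor ρ.dom

theorem indMul_tmul (a x : A) (φ : ρ.dom) :
    indMul hρ a (x ⊗ₜ[ℂ] φ : A ⊗[ℂ] ρ.dom) = ((a * x) ⊗ₜ[ℂ] φ : A ⊗[ℂ] ρ.dom) := rfl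

theorem indForm_indMul (a : A) (ξ η : IndPre ρ hρ) :
    ρ.indForm (indMul hρ a ξ) η = ρ.indForm ξ (indMul hρ (star a) η) := by
  have h (ξ η : A ⊗[ℂ] ρ.dom) : ρ.indForm ((LinearMap.mulLeft ℂ a).rTensor ρ.dom ξ) η =
      ρ.indForm ξ ((LinearMap.mulLeft ℂ (star a)).rTensor ρ.dom η) := by
    induction ξ with
    | zero => simp
    | add ξ ξ' h h' => simp only [map_add, LinearMap.add_apply, h, h']
    | tmul y ψ =>
      induction η with
      | zero => simp
      | add η η' h h' => simp only [map_add, h, h']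
      | tmul x φ => simp [mul_assoc]
  exact h ξ η

theorem indMul_mul (a b : A) : indMul hρ (a * b) = indMul hρ a ∘ₗ indMul hρ b := by
  change (LinearMap.mulLeft ℂ (a * b)).rTensor ρ.dom = _ ∘ₗ _
  rw [LinearMap.mulLeft_mul, LinearMap.rTensor_comp]; rfl

theorem indMul_add (a b : A) : indMul hρ (a + b) = indMul hρ a + indMul hρ b := by
  refine TensorProduct.ext' fun x φ => ?_
  change ((a + b) * x) ⊗ₜ[ℂ] φ = (a * x) ⊗ₜ[ℂ] φ + (b * x) ⊗ₜ[ℂ] φ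
  rw [add_mul, TensorProduct.add_tmul]

theorem indMul_smul (c : ℂ) (a : A) : indMul hρ (c • a) = c • indMul hρ a := by
  refine TensorProduct.ext' fun x φ => ?_
  change ((c • a) * x) ⊗ₜ[ℂ] φ = c • ((a * x) ⊗ₜ[ℂ] φ)
  rw [smul_mul_assoc, TensorProduct.smul_tmul']

theorem ker_indMk_le (a : A) :
    LinearMap.ker (indMk hρ) ≤ (LinearMap.ker (indMk hρ)).comap (indMul hρ a) := by
  intro ξ hξ
  rw [Submodule.mem_comap, LinearMap.mem_ker, ← inner_self_eq_zero (𝕜 := ℂ), inner_indMk,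
    indForm_indMul, ← inner_indMk, LinearMap.mem_ker.1 hξ, inner_zero_left]

def indQuot : A →ₙₐ[ℂ] Module.End ℂ (IndPre ρ hρ ⧸ LinearMap.ker (indMk hρ)) where
  toFun a := (LinearMap.ker (indMk hρ)).mapQ _ (indMul hρ a) (ker_indMk_le hρ a)
  map_smul' c a := by
    refine Submodule.linearMap_qext _ (LinearMap.ext fun ξ => ?_)
    simp [indMul_smul]
  map_zero' := by
    refine Submodule.linearMap_qext _ (LinearMap.ext fun ξ => ?_)
    have : indMul hρ (0 : A) = 0 := by simpa using indMul_smul hρ 0 0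
    simp [this]
  map_add' a b := by
    refine Submodule.linearMap_qext _ (LinearMap.ext fun ξ => ?_)
    simp [indMul_add]
  map_mul' a b := by
    refine Submodule.linearMap_qext _ (LinearMap.ext fun ξ => ?_)
    simp [indMul_mul]

def indCoreAct : A →ₙₐ[ℂ] Module.End ℂ (LinearMap.range (indMk hρ)) :=
  ((indMk hρ).quotKerEquivRange.conjAlgEquiv ℂ : _ →ₙₐ[ℂ] _).comp (indQuot hρ)

theorem indCoreAct_mk (a : A) (ξ : IndPre ρ hρ) (h : indMk hρ ξ ∈ LinearMap.range (indMk hρ)) :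
    (indCoreAct hρ a ⟨indMk hρ ξ, h⟩ : IndSpace ρ hρ) = indMk hρ (indMul hρ a ξ) := by
  have h1 : (⟨indMk hρ ξ, h⟩ : LinearMap.range (indMk hρ)) =
    (indMk hρ).quotKerEquivRange (Submodule.Quotient.mk ξ) := rfl
  change (((indMk hρ).quotKerEquivRange.conjAlgEquiv ℂ (indQuot hρ a)) _ : IndSpace ρ hρ) = _
  rw [h1, LinearEquiv.conjAlgEquiv_apply]
  simp [indQuot]

/-- The representation `a [x ⊗ φ] = [a x ⊗ φ]` on the quotient of `A ⊗ D(ρ)` by the null space. -/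
def indRep₀ : StarRep A (IndSpace ρ hρ) where
  dom := LinearMap.range (indMk hρ)
  dense_dom := UniformSpace.Completion.denseRange_coe
  act := indCoreAct hρ
  inner_act a φ ψ := by
    obtain ⟨_, ξ, rfl⟩ := φ
    obtain ⟨_, η, rfl⟩ := ψ
    have h (a : A) (ξ : IndPre ρ hρ) :=
      indCoreAct_mk hρ a ξ (LinearMap.mem_range_self (indMk hρ) ξ)
    refine (congrArg (inner ℂ · (indMk hρ η)) (h a ξ)).trans ?_
    refine Eq.trans ?_ (congrArg (inner ℂ (indMk hρ ξ)) (h (star a) η)).symm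
    rw [inner_indMk, inner_indMk, indForm_indMul]

/-- The induced representation: the closure of `indRep₀`. -/
def Ind (ρ : StarRep (𝒢.sub K) H) (hρ : ρ.Inducible) : StarRep A (IndSpace ρ hρ) :=
  (indRep₀ hρ).closure

end StarRep

end Induction

namespace StarRep

variable {A : Type*} [Ring A] [StarRing A] [Algebra ℂ A]
  {A' : Type*} [Ring A'] [StarRing A'] [Algebra ℂ A']
  {H : Type*} [NormedAddCommGroup H] [InnerProductSpace ℂ H]
  {H₁ : Type*} [NormedAddCommGroup H₁] [InnerProductSpace ℂ H₁]
  {H₂ : Type*} [NormedAddCommGroup H₂] [InnerProductSpace ℂ H₂]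

/-- The restriction of `π` along a `*`-homomorphism `A' → A`, with the same domain. -/
def res (π : StarRep A H) (f : A' →⋆ₐ[ℂ] A) : StarRep A' H where
  dom := π.dom
  dense_dom := π.dense_dom
  act := π.act.comp (f : A' →ₙₐ[ℂ] A)
  inner_act a φ ψ := by
    have h := π.inner_act (f a) φ ψ
    rw [← map_star] at h
    exact h

/-- There is an isometric linear map `U` of `D(π₁)` onto `D(π₂)` with `U π₁(a) = π₂(a) U`. -/
def UnitarilyEquivalent (π₁ : StarRep A H₁) (π₂ : StarRep A H₂) : Prop :=
  ∃ U : π₁.dom ≃ₗᵢ[ℂ] π₂.dom, ∀ (a : A) (φ : π₁.dom), U (π₁.act a φ) = π₂.act a (U φ)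

/-- Every `π(a)` is a bounded operator. -/
def IsBoundedRep (π : StarRep A H) : Prop :=
  ∀ a : A, ∃ C : ℝ, ∀ φ : π.dom, ‖π.act a φ‖ ≤ C * ‖φ‖

/-- `π = π₁ ⊕ π₂` only with `D(π₁) = 0` or `D(π₂) = 0`: whenever `D(π)` is the orthogonal sum of two
invariant subspaces, one of them is zero. -/
def IsIrreducible (π : StarRep A H) : Prop :=
  ∀ D₁ D₂ : Submodule ℂ π.dom,
    (∀ a, ∀ φ ∈ D₁, π.act a φ ∈ D₁) → (∀ a, ∀ φ ∈ D₂, π.act a φ ∈ D₂) →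
    (∀ φ ∈ D₁, ∀ ψ ∈ D₂, inner ℂ φ ψ = 0) → D₁ ⊔ D₂ = ⊤ → D₁ = ⊥ ∨ D₂ = ⊥

/-- The strong commutant `π(A)'`: bounded `T` on `H` with `T D(π) ⊆ D(π)` and `π(a) T φ = T π(a) φ`. -/
def commutant (π : StarRep A H) : Set (H →L[ℂ] H) :=
  {T | ∃ h : ∀ φ : π.dom, T φ ∈ π.dom,
    ∀ (a : A) (φ : π.dom), (π.act a ⟨T φ, h φ⟩ : H) = T (π.act a φ)}

/-- A closed representation of a commutative `*`-algebra is integrable if the closure of `π(b^*)` is the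
adjoint of `π(b)` for all `b`. -/
def IsIntegrable [CompleteSpace H] (π : StarRep A H) : Prop :=
  π.IsClosedRep ∧ ∀ b : A, (π.opr (star b)).closure = (π.opr b).adjoint

end StarRep

/-- A spectral measure on `X`: a projection-valued, strongly countably additive function on the
measurable sets, with `E(X) = I`. (Values at non-measurable sets carry no information.) -/
structure SpectralMeasure (X : Type*) [MeasurableSpace X]
    (H : Type*) [NormedAddCommGroup H] [InnerProductSpace ℂ H] [CompleteSpace H] where
  proj : Set X → H →L[ℂ] H
  isStarProjection : ∀ {Δ : Set X}, MeasurableSet Δ → IsStarProjection (proj Δ)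
  proj_univ : proj Set.univ = 1
  hasSum_iUnion : ∀ {Δ : ℕ → Set X}, (∀ n, MeasurableSet (Δ n)) →
    Pairwise (Function.onFun Disjoint Δ) → ∀ x : H, HasSum (fun n => proj (Δ n) x) (proj (⋃ n, Δ n) x)

namespace SpectralMeasure

variable {X : Type*} [MeasurableSpace X]
  {H : Type*} [NormedAddCommGroup H] [InnerProductSpace ℂ H] [CompleteSpace H]

theorem proj_empty (E : SpectralMeasure X H) : E.proj ∅ = 0 := by
  ext x
  have h := (E.hasSum_iUnion (Δ := fun _ => ∅) (fun _ => MeasurableSet.empty)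
    (fun _ _ _ => disjoint_bot_left) x).summable
  simpa using (summable_const_iff _).1 h

theorem re_inner_proj (E : SpectralMeasure X H) {Δ : Set X} (hΔ : MeasurableSet Δ) (x : H) :
    (inner ℂ x (E.proj Δ x)).re = ‖E.proj Δ x‖ ^ 2 := by
  have h := E.isStarProjection hΔ
  have h1 : E.proj Δ (E.proj Δ x) = E.proj Δ x := DFunLike.congr_fun h.isIdempotentElem.eq x
  have h2 := (h.isSelfAdjoint.isSymmetric : ∀ x y : H, _) x (E.proj Δ x)
  rw [← h1]
  erw [← h2]
  rw [h1]
  exact inner_self_eq_norm_sq (𝕜 := ℂ) _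

/-- The finite measure `Δ ↦ ⟨E(Δ) x, x⟩ = ‖E(Δ) x‖²`. -/
def measure (E : SpectralMeasure X H) (x : H) : MeasureTheory.Measure X :=
  MeasureTheory.Measure.ofMeasurable (fun Δ _ => ENNReal.ofReal (‖E.proj Δ x‖ ^ 2))
    (by simp [E.proj_empty]) (by
      intro Δ hΔ hd
      have h := (Complex.reCLM.hasSum ((innerSL ℂ x).hasSum (E.hasSum_iUnion hΔ hd x)))
      simp only [innerSL_apply_apply, Complex.reCLM_apply] at h
      rw [E.re_inner_proj (MeasurableSet.iUnion hΔ)] at h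
      simp only [E.re_inner_proj (hΔ _)] at h
      rw [← h.tsum_eq, ENNReal.ofReal_tsum_of_nonneg (fun n => by positivity) h.summable])

/-- `T = ∫ f dE`: the domain of `T` consists of the `x` with `∫ |f|² d⟨E x, x⟩ < ∞`, and
`⟨T x, x⟩ = ∫ f d⟨E x, x⟩` for these `x` (by polarization this determines `T`). -/
def IsSpectralIntegral (E : SpectralMeasure X H) (f : X → ℂ) (T : H →ₗ.[ℂ] H) : Prop :=
  (∀ x : H, x ∈ T.domain ↔ ∫⁻ t, ‖f t‖ₑ ^ 2 ∂(E.measure x) < ⊤) ∧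
    ∀ x : T.domain, inner ℂ (x : H) (T x) = ∫ t, f t ∂(E.measure x)

end SpectralMeasure

/-- The cone `∑ A²` of finite sums of elements `a^* a`. -/
def sumSq (A : Type*) [Ring A] [StarRing A] : AddSubmonoid A :=
  AddSubmonoid.closure (Set.range fun a : A => star a * a)

namespace StarGrading

variable {G : Type*} [Group G] {A : Type*} [Ring A] [StarRing A] [Algebra ℂ A] [StarModule ℂ A]

/-- The set of all characters of `B` (`*`-homomorphisms to `ℂ` with `χ(1) = 1`) that are nonnegative on
`B ∩ ∑ A²`. It carries the topology of pointwise convergence on `B` and its Borel sets. -/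
def PosChar (𝒢 : StarGrading G A) :=
  {χ : 𝒢.base →⋆ₐ[ℂ] ℂ // ∀ b : 𝒢.base, (b : A) ∈ sumSq A → 0 ≤ χ b}

variable {𝒢 : StarGrading G A}

instance : FunLike 𝒢.PosChar 𝒢.base ℂ where
  coe χ := χ.1
  coe_injective _ _ h := Subtype.ext (DFunLike.coe_injective h)

instance : TopologicalSpace 𝒢.PosChar :=
  TopologicalSpace.induced (fun χ b => χ b) (Pi.topologicalSpace : TopologicalSpace (𝒢.base → ℂ))

instance : MeasurableSpace 𝒢.PosChar := borel _

instance : BorelSpace 𝒢.PosChar := ⟨rfl⟩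

/-- `c^* d ∈ B` for `c, d ∈ A_g`. -/
def starMul {g : G} (c d : 𝒢.piece g) : 𝒢.base :=
  ⟨star (c : A) * d, (by simpa using 𝒢.mul_mem (𝒢.star_mem c.2) d.2 :
    star (c : A) * d ∈ 𝒢.piece 1)⟩

/-- `c^* b c ∈ B` for `c ∈ A_g` and `b ∈ B`. -/
def sandwich {g : G} (c : 𝒢.piece g) (b : 𝒢.base) : 𝒢.base :=
  ⟨star (c : A) * b * c, (by
    simpa using 𝒢.mul_mem (𝒢.mul_mem (𝒢.star_mem c.2) b.2) c.2 :
    star (c : A) * b * c ∈ 𝒢.piece 1)⟩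

/-- `χ^g` is defined and equals `ψ`: there is `a ∈ A_g` with `χ(a^* a) ≠ 0` and
`ψ(b) = χ(a^* b a) / χ(a^* a)`. When `B` is commutative, `χ^g` exists as soon as there is such an `a`
(`exists_actsTo`), and it does not depend on `a` (`ActsTo.unique`). -/
def ActsTo (g : G) (χ ψ : 𝒢.PosChar) : Prop :=
  ∃ a : 𝒢.piece g, χ (starMul a a) ≠ 0 ∧ ∀ b, ψ b = χ (sandwich a b) / χ (starMul a a)

theorem PosChar.map_mul (χ : 𝒢.PosChar) (b c : 𝒢.base) : χ (b * c) = χ b * χ c := 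
  _root_.map_mul χ.1 b c

theorem PosChar.map_one (χ : 𝒢.PosChar) : χ 1 = 1 := _root_.map_one χ.1

theorem actsTo_one (χ : 𝒢.PosChar) : ActsTo 1 χ χ := by
  have h : starMul (𝒢 := 𝒢) ⟨1, 𝒢.one_mem⟩ ⟨1, 𝒢.one_mem⟩ = 1 := Subtype.ext (by simp [starMul])
  refine ⟨⟨1, 𝒢.one_mem⟩, ?_, fun b => ?_⟩
  · simp [h, χ.map_one]
  · have h' : sandwich (𝒢 := 𝒢) ⟨1, 𝒢.one_mem⟩ b = b := Subtype.ext (by simp [sandwich])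
    simp [h, h', χ.map_one]

theorem ActsTo.mul {g h : G} {χ ψ θ : 𝒢.PosChar} (h₁ : ActsTo g χ ψ) (h₂ : ActsTo h ψ θ) :
    ActsTo (h * g) χ θ := by
  obtain ⟨a, ha, hψ⟩ := h₁
  obtain ⟨c, hc, hθ⟩ := h₂
  have e1 : starMul (𝒢 := 𝒢) ⟨(c : A) * a, 𝒢.mul_mem c.2 a.2⟩ ⟨(c : A) * a, 𝒢.mul_mem c.2 a.2⟩ =
      sandwich a (starMul c c) := Subtype.ext (by simp [starMul, sandwich, mul_assoc])
  have e2 (b) : sandwich (𝒢 := 𝒢) ⟨(c : A) * a, 𝒢.mul_mem c.2 a.2⟩ b =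
      sandwich a (sandwich c b) := Subtype.ext (by simp [sandwich, mul_assoc])
  have e3 : χ (sandwich a (starMul c c)) ≠ 0 := by
    intro h0; exact hc (by rw [hψ, h0, zero_div])
  refine ⟨⟨(c : A) * a, 𝒢.mul_mem c.2 a.2⟩, by rwa [e1], fun b => ?_⟩
  rw [e1, e2, hθ, hψ, hψ]
  field_simp

theorem ActsTo.inv {g : G} {χ ψ : 𝒢.PosChar} (h : ActsTo g χ ψ) : ActsTo g⁻¹ ψ χ := by
  obtain ⟨a, ha, hψ⟩ := h
  have e1 : sandwich a (starMul (𝒢 := 𝒢) ⟨star (a : A), 𝒢.star_mem a.2⟩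
      ⟨star (a : A), 𝒢.star_mem a.2⟩) = starMul a a * starMul a a :=
    Subtype.ext (by simp [starMul, sandwich, mul_assoc])
  have e2 (b) : sandwich a (sandwich (𝒢 := 𝒢) ⟨star (a : A), 𝒢.star_mem a.2⟩ b) =
      starMul a a * b * starMul a a := Subtype.ext (by simp [starMul, sandwich, mul_assoc])
  refine ⟨⟨star (a : A), 𝒢.star_mem a.2⟩, ?_, fun b => ?_⟩
  · rw [hψ, e1, χ.map_mul]
    field_simp
    exact ha
  · rw [hψ, hψ, e1, e2, χ.map_mul, χ.map_mul, χ.map_mul]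
    field_simp

/-- The stabilizer `{g | χ^g is defined and equals χ}`. -/
def stabilizer (χ : 𝒢.PosChar) : Subgroup G where
  carrier := {g | ActsTo g χ χ}
  mul_mem' hg hh := ActsTo.mul hh hg
  one_mem' := actsTo_one χ
  inv_mem' hg := ActsTo.inv hg

/-- The orbit of `χ`: all `χ^g` that are defined. -/
def orbit (χ : 𝒢.PosChar) : Set 𝒢.PosChar := {ψ | ∃ g, ActsTo g χ ψ}

/-- `Δ^g = {χ^g | χ ∈ Δ, χ^g is defined}`. -/
def translate (g : G) (Δ : Set 𝒢.PosChar) : Set 𝒢.PosChar := {ψ | ∃ χ ∈ Δ, ActsTo g χ ψ}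

variable (𝒢) in
/-- `B` is commutative. -/
def IsCommutativeBase : Prop := ∀ a ∈ 𝒢.piece 1, ∀ b ∈ 𝒢.piece 1, a * b = b * a

variable (𝒢) in
/-- `χ(c^* d) χ(d^* c) = χ(c^* c) χ(d^* d)` for all `χ` and all `c, d ∈ A_g`. -/
def IsCompatible : Prop := ∀ (χ : 𝒢.PosChar) (g : G) (c d : 𝒢.piece g),
  χ (starMul c d) * χ (starMul d c) = χ (starMul c c) * χ (starMul d d)

theorem ActsTo.unique (hB : 𝒢.IsCommutativeBase) {g : G} {χ ψ θ : 𝒢.PosChar}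
    (h₁ : ActsTo g χ ψ) (h₂ : ActsTo g χ θ) : ψ = θ := by
  obtain ⟨c, hc, hψ⟩ := h₁
  obtain ⟨d, hd, hθ⟩ := h₂
  refine DFunLike.ext _ _ fun b => ?_
  have e : sandwich c b * starMul d d = starMul c c * sandwich d b := by
    refine Subtype.ext ?_
    have h := hB b b.2 (c * star (d : A)) (by simpa using 𝒢.mul_mem c.2 (𝒢.star_mem d.2))
    simp only [sandwich, starMul, MulMemClass.coe_mul]
    calc star (c : A) * b * c * (star (d : A) * d) = star (c : A) * (b * (c * star (d : A))) * d := by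
          simp only [mul_assoc]
      _ = _ := by rw [h]; simp only [mul_assoc]
  have e' := congrArg χ e
  rw [χ.map_mul, χ.map_mul] at e'
  rw [hψ, hθ, div_eq_div_iff hc hd, e', mul_comm]

theorem exists_actsTo (hB : 𝒢.IsCommutativeBase) {g : G} (χ : 𝒢.PosChar) (a : 𝒢.piece g)
    (ha : χ (starMul a a) ≠ 0) : ∃ ψ : 𝒢.PosChar, ActsTo g χ ψ := by
  let f : 𝒢.base →⋆ₐ[ℂ] ℂ :=
    { toFun := fun b => χ (sandwich a b) / χ (starMul a a)
      map_one' := by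
        have : sandwich a 1 = starMul a a := Subtype.ext (by simp [sandwich, starMul])
        rw [this, div_self ha]
      map_mul' := fun b c => by
        have e : sandwich a (b * c) * starMul a a = sandwich a b * sandwich a c := by
          refine Subtype.ext ?_
          have h := hB c c.2 (a * star (a : A)) (by simpa using 𝒢.mul_mem a.2 (𝒢.star_mem a.2))
          simp only [sandwich, starMul, MulMemClass.coe_mul]
          calc star (a : A) * (b * c) * a * (star (a : A) * a)
              = star (a : A) * b * (c * (a * star (a : A))) * a := by simp only [mul_assoc]
            _ = _ := by rw [h]; simp only [mul_assoc]
        have e' := congrArg χ e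
        rw [χ.map_mul, χ.map_mul] at e'
        field_simp
        exact e'
      map_zero' := by
        have : sandwich a 0 = 0 := Subtype.ext (by simp [sandwich])
        rw [this]; simp [show χ 0 = 0 from map_zero χ.1]
      map_add' := fun b c => by
        have : sandwich a (b + c) = sandwich a b + sandwich a c :=
          Subtype.ext (by simp [sandwich, mul_add, add_mul])
        rw [this, show ∀ x y, χ (x + y) = χ x + χ y from map_add χ.1, add_div]
      commutes' := fun r => by
        have : sandwich a (algebraMap ℂ 𝒢.base r) = r • starMul a a :=
          Subtype.ext (by simp [sandwich, starMul, Algebra.algebraMap_eq_smul_one])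
        rw [this, show ∀ x, χ (r • x) = r • χ x from map_smul χ.1 r]
        simp [ha]
      map_star' := fun b => by
        have h1 : sandwich a (star b) = star (sandwich a b) :=
          Subtype.ext (by simp [sandwich, mul_assoc])
        have h2 : star (starMul a a) = starMul a a := Subtype.ext (by simp [starMul])
        have h3 (x) : χ (star x) = star (χ x) := map_star χ.1 x
        have h4 : star (χ (starMul a a)) = χ (starMul a a) := by rw [← h3, h2]
        rw [h1, h3, star_div₀, h4] }
  have hsq : ∀ x ∈ sumSq A, star (a : A) * x * a ∈ sumSq A := by
    intro x hx
    refine AddSubmonoid.closure_induction (motive := fun x _ => star (a : A) * x * a ∈ sumSq A)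
      ?_ (by simp) (fun x y _ _ h h' => by
        rw [mul_add, add_mul]; exact AddSubmonoid.add_mem _ h h') hx
    rintro _ ⟨y, rfl⟩
    exact AddSubmonoid.subset_closure ⟨y * a, by simp [mul_assoc]⟩
  refine ⟨⟨f, fun b hb => ?_⟩, a, ha, fun b => rfl⟩
  exact div_nonneg (χ.2 _ (hsq _ hb)) (χ.2 _ (AddSubmonoid.subset_closure ⟨a, rfl⟩))

variable {H : Type*} [NormedAddCommGroup H] [InnerProductSpace ℂ H]

/-- The two conditions for `π` to be well-behaved, with `E` the spectral measure associated with `π`: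
the restriction of `π` to `B` is integrable, the closure of `π(b)` is `∫ χ(b) dE(χ)` for `b ∈ B`, and
`E(Δ^g) π(a) ⊆ π(a) E(Δ)` for `a ∈ A_g` and Borel sets `Δ`. -/
structure IsAssociated [CompleteSpace H] (E : SpectralMeasure 𝒢.PosChar H) (π : StarRep A H) : Prop where
  integrable : (π.res 𝒢.base.subtype).IsIntegrable
  integral : ∀ b : 𝒢.base, E.IsSpectralIntegral (fun χ => χ b) (π.opr b).closure
  covariant : ∀ (g : G), ∀ a ∈ 𝒢.piece g, ∀ Δ : Set 𝒢.PosChar, MeasurableSet Δ →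
    ∀ φ : π.dom, ∃ h : E.proj Δ φ ∈ π.dom,
      E.proj (translate g Δ) (π.act a φ) = π.act a ⟨E.proj Δ φ, h⟩

end StarGrading

namespace StarRep

variable {G : Type*} [Group G] {A : Type*} [Ring A] [StarRing A] [Algebra ℂ A] [StarModule ℂ A]
  {H : Type*} [NormedAddCommGroup H] [InnerProductSpace ℂ H]

def WellBehaved [CompleteSpace H] (𝒢 : StarGrading G A) (π : StarRep A H) : Prop :=
  ∃ E : SpectralMeasure 𝒢.PosChar H, 𝒢.IsAssociated E π

/-- `π` is well-behaved and its spectral measure is supported on the orbit of `χ`. -/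
def AssociatedWithOrbit [CompleteSpace H] {𝒢 : StarGrading G A} (π : StarRep A H) (χ : 𝒢.PosChar) :
    Prop :=
  ∃ E : SpectralMeasure 𝒢.PosChar H, 𝒢.IsAssociated E π ∧ E.proj (𝒢.orbit χ)ᶜ = 0

/-- Every `σ(b)` is `χ(b)` times the identity of `D(σ)`. -/
def IsMultipleOf {B : Type*} [Ring B] [StarRing B] [Algebra ℂ B]
    (σ : StarRep B H) (χ : B → ℂ) : Prop :=
  ∀ (b : B) (φ : σ.dom), σ.act b φ = χ b • φ

def RestrictsToMultiple {𝒢 : StarGrading G A} {K : Subgroup G} (ρ : StarRep (𝒢.sub K) H) (χ : 𝒢.PosChar) : Prop :=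
  (ρ.res (StarSubalgebra.inclusion (𝒢.base_le_sub K))).IsMultipleOf χ

end StarRep

/-- A `*`-representation together with its Hilbert space. -/
structure HilbertRep (A : Type u) [Ring A] [StarRing A] [Algebra ℂ A] where
  space : Type w
  [normed : NormedAddCommGroup space]
  [innerProduct : InnerProductSpace ℂ space]
  [complete : CompleteSpace space]
  rep : StarRep A space

attribute [instance] HilbertRep.normed HilbertRep.innerProduct HilbertRep.complete

namespace HilbertRep

/-- Unitary equivalence. -/
def equivalence (A : Type u) [Ring A] [StarRing A] [Algebra ℂ A] :
    Setoid (HilbertRep.{u, w} A) where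
  r π₁ π₂ := π₁.rep.UnitarilyEquivalent π₂.rep
  iseqv :=
    { refl := fun π => ⟨LinearIsometryEquiv.refl ℂ _, fun _ _ => rfl⟩
      symm := fun ⟨U, hU⟩ => ⟨U.symm, fun a φ => U.injective (by rw [hU]; simp)⟩
      trans := fun ⟨U, hU⟩ ⟨V, hV⟩ => ⟨U.trans V, fun a φ => by simp [hU, hV]⟩ }

/-- Unitary equivalence classes of `*`-representations. -/
def Class (A : Type u) [Ring A] [StarRing A] [Algebra ℂ A] :=
  Quotient (equivalence.{u, w} A)

def mkClass {A : Type u} [Ring A] [StarRing A] [Algebra ℂ A] (π : HilbertRep.{u, w} A) :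
    Class.{u, w} A := Quotient.mk _ π

variable {G : Type v} [Group G] {A : Type u} [Ring A] [StarRing A] [Algebra ℂ A] [StarModule ℂ A]

/-- The induced representation, with its Hilbert space. -/
def ind {𝒢 : StarGrading G A} {K : Subgroup G} (ρ : HilbertRep.{u, max u w} (𝒢.sub K))
    (hρ : ρ.rep.Inducible) : HilbertRep.{u, max u w} A :=
  ⟨StarRep.IndSpace ρ.rep hρ, ρ.rep.Ind hρ⟩

end HilbertRep

end GradedStar
end

/-!
The theorem is proved by comparing a representation of `A_H` with the weight spaces of the
representation that it induces. Throughout, `H` is the stabilizer of `χ`, and the weight space of a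
character `θ` in a representation `π` of `A` consists of the vectors `v` of `D(π)` with
`π(b) v = θ(b) v` for all `b ∈ B`.

For `a ∈ A_g` and a vector `v` of weight `θ` one has `‖π(a) v‖² = θ(a^* a) ‖v‖²`. This makes every
`ρ` that restricts to a multiple of `χ` bounded. It also shows that `π(a)` kills the weight space
of `θ` if `θ^g` is not defined, and maps it into the weight space of `θ^g` otherwise
(`act_weight_dichotomy`). Weight spaces of distinct characters are orthogonal.

*Inducibility.* For each point `θ` of the orbit of `χ` choose `c_θ ∈ A_g` with `χ^g = θ` and
`χ(c_θ^* c_θ) = 1`. The identity `θ(c_θ c_θ^*) = 1` gives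
`ρ(p_H(b^* a)) = ρ(b^* c_θ) ρ(c_θ^* a)` when `a` and `b` move `χ` to `θ`. So the inducing form is the
sum over `θ` of the inner products of the components `ρ(p_H(c_θ^* a)) φ`, and it is positive
(`RestrictsToMultiple.indForm_eq_sum`).

*The bijection.* The vectors `[1 ⊗ φ]` of the induced representation have weight `χ`. Hence the
weight spaces along the orbit span a core of the induced representation, that is, a subspace that is
dense in the graph topology. For any closed representation with such a core the projections onto the
sums of weight spaces form a spectral measure on the orbit, which is countable, and the
representation is well-behaved (`associatedWithOrbit_of_isCore`). Conversely, if `π` is associated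
with the orbit, then by covariance the series `∑ E({θ}) x` converges to `x` in the graph topology,
so that the weight spaces along the orbit span a core (`isCore_orbitSpan_of_isAssociated`), and `π`
is induced from the representation of `A_H` on its weight space for `χ`
(`unitarilyEquivalent_ind_weightRep`). The weight space for `χ` in an induced representation
consists of the vectors `[1 ⊗ φ]` alone (`exists_indUnit_eq`), so `ρ` is determined by the
representation that it induces.

*Commutants.* An operator in the commutant of the induced representation preserves the weight space
for `χ` and so has the form `[a ⊗ φ] ↦ [a ⊗ S φ]` with `S` in the commutant of `ρ`; every such `S`
occurs, because in components the operator acts by `S`. The commutant of the unbounded induced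
representation therefore is the commutant of the self-adjoint set of bounded operators `L_a L_b^*`,
where `L_a φ = [a ⊗ φ]`, and `T ↦ L_1^* T L_1` is a `*`-isomorphism onto the commutant of `ρ`
(`exists_commutant_starAlgEquiv`). Orthogonal decompositions are transferred in the same way
(`IsIrreducible.ind`, `IsIrreducible.of_ind`).
-/

noncomputable section

open scoped ComplexOrder TensorProduct InnerProductSpace ENNReal
open Filter Topology

namespace GradedStar

namespace StarRep

variable {A : Type*} [Ring A] [StarRing A] [Algebra ℂ A]
  {H : Type*} [NormedAddCommGroup H] [InnerProductSpace ℂ H]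
  {H' : Type*} [NormedAddCommGroup H'] [InnerProductSpace ℂ H']

/-! ### Graph topology, closures and cores -/

theorem act_mul (π : StarRep A H) (a b : A) (φ : π.dom) :
    π.act (a * b) φ = π.act a (π.act b φ) := by
  rw [map_mul]; rfl

theorem act_add (π : StarRep A H) (a b : A) (φ : π.dom) :
    π.act (a + b) φ = π.act a φ + π.act b φ := by
  rw [map_add]; rfl

theorem act_sub (π : StarRep A H) (a b : A) (φ : π.dom) :
    π.act (a - b) φ = π.act a φ - π.act b φ := by
  rw [map_sub]; rfl

theorem act_smul (π : StarRep A H) (c : ℂ) (a : A) (φ : π.dom) :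
    π.act (c • a) φ = c • π.act a φ := by
  rw [map_smul]; rfl

theorem inner_act_right (π : StarRep A H) (a : A) (φ ψ : π.dom) :
    ⟪(φ : H), (π.act a ψ : H)⟫_ℂ = ⟪(π.act (star a) φ : H), (ψ : H)⟫_ℂ := by
  rw [π.inner_act, star_star]

/-- `⟨π(a) φ, π(b) ψ⟩ = ⟨φ, π(a^* b) ψ⟩`. -/
theorem inner_act_act (π : StarRep A H) (a b : A) (φ ψ : π.dom) :
    ⟪(π.act a φ : H), (π.act b ψ : H)⟫_ℂ = ⟪(φ : H), (π.act (star a * b) ψ : H)⟫_ℂ := by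
  rw [π.inner_act, act_mul]

/-- A closed representation contains every limit of a net along which all operators converge, and
the operators are continuous along that net. -/
theorem IsClosedRep.exists_of_tendsto {π : StarRep A H} (hπ : π.IsClosedRep) {ι : Type*}
    {l : Filter ι} [l.NeBot] {f : ι → π.dom} {x : H} (hf : Tendsto (fun i => (f i : H)) l (𝓝 x))
    (h : ∀ a, ∃ z, Tendsto (fun i => (π.act a (f i) : H)) l (𝓝 z)) :
    ∃ hx : x ∈ π.dom, ∀ a, Tendsto (fun i => (π.act a (f i) : H)) l (𝓝 (π.act a ⟨x, hx⟩)) := by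
  choose z hz using h
  have h1 : Tendsto (fun i => π.graphMap (f i)) l (𝓝 (x, z)) :=
    hf.prodMk_nhds (tendsto_pi_nhds.2 hz)
  have h2 : (x, z) ∈ Set.range π.graphMap :=
    IsClosed.mem_of_tendsto hπ h1 (Eventually.of_forall fun i => ⟨_, rfl⟩)
  obtain ⟨y, hy⟩ := h2
  have hx : (y : H) = x := congrArg Prod.fst hy
  subst hx
  refine ⟨y.2, fun a => ?_⟩
  have : z a = π.act a y := (congrFun (congrArg Prod.snd hy) a).symm
  exact this ▸ hz a

/-- `D₀` is a core of `π`: it is dense in `D(π)` in the graph topology. -/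
def IsCore (π : StarRep A H) (D₀ : Set π.dom) : Prop :=
  ∀ x : π.dom, π.graphMap x ∈ _root_.closure (π.graphMap '' D₀)

theorem IsCore.exists_filter {π : StarRep A H} {D₀ : Set π.dom} (h : π.IsCore D₀) (x : π.dom) :
    ∃ l : Filter π.dom, l.NeBot ∧ D₀ ∈ l ∧ Tendsto (fun φ : π.dom => (φ : H)) l (𝓝 x) ∧
      ∀ a, Tendsto (fun φ : π.dom => (π.act a φ : H)) l (𝓝 (π.act a x)) := by
  have h1 := mem_closure_iff_clusterPt.1 (h x)
  refine ⟨comap π.graphMap (𝓝 (π.graphMap x)) ⊓ 𝓟 D₀, ?_, mem_inf_of_right (mem_principal_self _),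
    ?_, fun a => ?_⟩
  · rw [ClusterPt, ← map_principal] at h1
    rwa [← map_neBot_iff π.graphMap, Filter.push_pull']
  · have := (continuous_fst.tendsto (π.graphMap x)).comp
      (tendsto_comap (f := π.graphMap) (x := 𝓝 (π.graphMap x)))
    exact this.mono_left inf_le_left
  · have := ((continuous_eval a).tendsto (π.graphMap x)).comp
      (tendsto_comap (f := π.graphMap) (x := 𝓝 (π.graphMap x)))
    exact this.mono_left inf_le_left

/-- A set is a core if every vector of the domain is the limit of a sequence from the set, in the
graph topology. -/
theorem IsCore.of_tendsto {π : StarRep A H} {D₀ : Set π.dom}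
    (h : ∀ x : π.dom, ∃ f : ℕ → π.dom, (∀ n, f n ∈ D₀) ∧
      Tendsto (fun n => (f n : H)) atTop (𝓝 x) ∧
      ∀ a, Tendsto (fun n => (π.act a (f n) : H)) atTop (𝓝 (π.act a x))) : π.IsCore D₀ := by
  intro x
  obtain ⟨f, hf, h1, h2⟩ := h x
  refine mem_closure_of_tendsto (f := fun n => π.graphMap (f n)) (b := atTop)
    (h1.prodMk_nhds (tendsto_pi_nhds.2 h2)) (Eventually.of_forall fun n => ⟨_, hf n, rfl⟩)

theorem IsCore.mono {π : StarRep A H} {D₀ D₁ : Set π.dom} (h : π.IsCore D₀) (h' : D₀ ⊆ D₁) :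
    π.IsCore D₁ :=
  fun x => closure_mono (Set.image_mono h') (h x)

/-- A core is dense in the Hilbert space. -/
theorem IsCore.dense {π : StarRep A H} {D₀ : Set π.dom} (h : π.IsCore D₀) :
    Dense ((fun φ : π.dom => (φ : H)) '' D₀) := by
  refine dense_iff_closure_eq.2 ?_
  refine Set.eq_univ_of_univ_subset ?_
  rw [← π.dense_dom.closure_eq]
  refine closure_minimal (fun x hx => ?_) isClosed_closure
  obtain ⟨l, _, hD, hx', -⟩ := h.exists_filter ⟨x, hx⟩
  exact mem_closure_of_tendsto hx' (mem_of_superset hD fun φ hφ => ⟨φ, hφ, rfl⟩)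

/-- Vectors of a core separate the points of the Hilbert space. -/
theorem IsCore.eq_zero {π : StarRep A H} {D₀ : Set π.dom} (h : π.IsCore D₀) {x : H}
    (hx : ∀ φ ∈ D₀, ⟪(φ : H), x⟫_ℂ = 0) : x = 0 := by
  have h2 : x ∈ _root_.closure ((fun φ : π.dom => (φ : H)) '' D₀) := h.dense x
  have h3 : ∀ y ∈ _root_.closure ((fun φ : π.dom => (φ : H)) '' D₀), ⟪y, x⟫_ℂ = 0 := by
    intro y hy
    have : _root_.closure ((fun φ : π.dom => (φ : H)) '' D₀) ⊆ {y | ⟪y, x⟫_ℂ = 0} :=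
      closure_minimal (by rintro _ ⟨φ, hφ, rfl⟩; exact hx φ hφ)
        (isClosed_eq (continuous_id.inner continuous_const) continuous_const)
    exact this hy
  exact inner_self_eq_zero.1 (h3 x h2)

theorem mem_closure_dom {π : StarRep A H} {x : H} :
    x ∈ π.closure.dom ↔ ∃ p ∈ π.graphClosure, p.1 = x := by
  constructor
  · rintro ⟨p, rfl⟩; exact ⟨p, p.2, rfl⟩
  · rintro ⟨p, hp, rfl⟩; exact ⟨⟨p, hp⟩, rfl⟩

theorem closure_act (π : StarRep A H) {p : H × (A → H)} (hp : p ∈ π.graphClosure)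
    (h : p.1 ∈ π.closure.dom) (a : A) : (π.closure.act a ⟨p.1, h⟩ : H) = p.2 a := by
  have h0 : (⟨p.1, h⟩ : π.closure.dom) = π.closureEquiv ⟨p, hp⟩ := rfl
  rw [h0]
  change ((π.closureEquiv.conjAlgEquiv ℂ (π.shiftHom a)) (π.closureEquiv ⟨p, hp⟩) : H) = _
  rw [LinearEquiv.conjAlgEquiv_apply]
  simp only [LinearMap.comp_apply, LinearEquiv.coe_coe, LinearEquiv.symm_apply_apply]
  rfl

/-- The inclusion of `D(π)` into the domain of the closure. -/
def toClosure (π : StarRep A H) : π.dom →ₗ[ℂ] π.closure.dom :=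
  Submodule.inclusion fun φ hφ => mem_closure_dom.2 ⟨_, π.graphMap_mem ⟨φ, hφ⟩, rfl⟩

theorem act_toClosure (π : StarRep A H) (a : A) (φ : π.dom) :
    π.closure.act a (π.toClosure φ) = π.toClosure (π.act a φ) :=
  Subtype.ext (π.closure_act (π.graphMap_mem φ) (π.toClosure φ).2 a)

theorem graphMap_closure (π : StarRep A H) {p : H × (A → H)} (hp : p ∈ π.graphClosure)
    (h : p.1 ∈ π.closure.dom) : π.closure.graphMap ⟨p.1, h⟩ = p :=
  Prod.ext rfl (funext fun a => π.closure_act hp h a)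

theorem isClosedRep_closure (π : StarRep A H) : π.closure.IsClosedRep := by
  have : Set.range π.closure.graphMap = π.graphClosure := by
    ext p
    constructor
    · rintro ⟨⟨x, hx⟩, rfl⟩
      obtain ⟨p, hp, rfl⟩ := mem_closure_dom.1 hx
      rw [graphMap_closure π hp]; exact hp
    · intro hp
      exact ⟨⟨p.1, mem_closure_dom.2 ⟨p, hp, rfl⟩⟩, graphMap_closure π hp _⟩
  rw [IsClosedRep, this]
  exact Submodule.isClosed_topologicalClosure _

theorem isCore_closure (π : StarRep A H) : π.closure.IsCore (Set.range π.toClosure) := by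
  rintro ⟨x, hx⟩
  obtain ⟨p, hp, rfl⟩ := mem_closure_dom.1 hx
  rw [graphMap_closure π hp]
  have h1 : π.closure.graphMap '' Set.range π.toClosure = Set.range π.graphMap := by
    rw [← Set.range_comp]
    congr 1
    funext φ
    exact Prod.ext rfl (funext fun a => congrArg Subtype.val (π.act_toClosure a φ))
  rw [h1]
  have := hp
  rwa [graphClosure, ← SetLike.mem_coe, Submodule.topologicalClosure_coe,
    LinearMap.coe_range] at this

/-- A bounded intertwiner on a core extends to the whole domain if the target is closed. -/
theorem IsCore.extend_intertwiner {π₁ : StarRep A H} {π₂ : StarRep A H'} (h₂ : π₂.IsClosedRep)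
    (V : H →L[ℂ] H') {D₀ : Set π₁.dom} (hD₀ : π₁.IsCore D₀)
    (hV : ∀ φ ∈ D₀, ∃ h : V φ ∈ π₂.dom, ∀ a, (π₂.act a ⟨V φ, h⟩ : H') = V (π₁.act a φ))
    (x : π₁.dom) : ∃ h : V x ∈ π₂.dom, ∀ a, (π₂.act a ⟨V x, h⟩ : H') = V (π₁.act a x) := by
  obtain ⟨l, _, hD, hx, hax⟩ := hD₀.exists_filter x
  choose hm hact using hV
  let f : π₁.dom → π₂.dom := fun φ => by
    classical exact if h : V φ ∈ π₂.dom then ⟨V φ, h⟩ else 0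
  have hf : ∀ᶠ φ in l, (f φ : H') = V φ ∧ ∀ a, (π₂.act a (f φ) : H') = V (π₁.act a φ) := by
    refine mem_of_superset hD fun φ hφ => ?_
    have : f φ = ⟨V φ, hm φ hφ⟩ := dif_pos _
    exact ⟨congrArg Subtype.val this, fun a => by rw [this]; exact hact φ hφ a⟩
  have t1 : Tendsto (fun φ => (f φ : H')) l (𝓝 (V x)) :=
    ((V.continuous.tendsto _).comp hx).congr' (hf.mono fun φ h => h.1.symm)
  have t2 (a) : Tendsto (fun φ => (π₂.act a (f φ) : H')) l (𝓝 (V (π₁.act a x))) :=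
    ((V.continuous.tendsto _).comp (hax a)).congr' (hf.mono fun φ h => (h.2 a).symm)
  obtain ⟨h, h'⟩ := h₂.exists_of_tendsto t1 fun a => ⟨_, t2 a⟩
  exact ⟨h, fun a => tendsto_nhds_unique (h' a) (t2 a)⟩

/-- An isometric intertwiner between cores of two closed representations extends to a unitary
equivalence. -/
theorem UnitarilyEquivalent.of_core {π₁ : StarRep A H} {π₂ : StarRep A H'}
    [CompleteSpace H] [CompleteSpace H']
    (h₁ : π₁.IsClosedRep) (h₂ : π₂.IsClosedRep) (V : H →ₗᵢ[ℂ] H') {D₀ : Set π₁.dom}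
    {D₁ : Set π₂.dom} (hD₀ : π₁.IsCore D₀) (hD₁ : π₂.IsCore D₁)
    (hV : ∀ φ ∈ D₀, ∃ h : V φ ∈ π₂.dom, ∀ a, (π₂.act a ⟨V φ, h⟩ : H') = V (π₁.act a φ))
    (hV' : ∀ y ∈ D₁, ∃ φ ∈ D₀, V φ = y) : π₁.UnitarilyEquivalent π₂ := by
  have key : ∀ φ : π₁.dom, ∃ h : V φ ∈ π₂.dom, ∀ a,
      (π₂.act a ⟨V φ, h⟩ : H') = V (π₁.act a φ) :=
    hD₀.extend_intertwiner h₂ V.toContinuousLinearMap hV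
  choose hm hact using key
  let U : π₁.dom →ₗᵢ[ℂ] π₂.dom :=
    { toLinearMap := (V.toLinearMap ∘ₗ π₁.dom.subtype).codRestrict π₂.dom hm
      norm_map' := fun φ => V.norm_map φ }
  have hU : Function.Surjective U := by
    intro y
    obtain ⟨l, _, hD, hy, hay⟩ := hD₁.exists_filter y
    choose! g hg hgV using hV'
    have hg1 : ∀ᶠ φ in l, V (g φ) = φ ∧ ∀ a, V (π₁.act a (g φ)) = π₂.act a φ := by
      refine mem_of_superset hD fun φ hφ => ⟨hgV φ hφ, fun a => ?_⟩
      rw [← hact]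
      congr 2
      exact Subtype.ext (hgV φ hφ)
    -- an isometry reflects Cauchy filters
    have lift {k : π₂.dom → H} {z : H'} (h : Tendsto (fun φ => V (k φ)) l (𝓝 z)) :
        ∃ z', Tendsto k l (𝓝 z') := by
      have h1 : Cauchy (map k l) := by
        have := h.cauchy_map
        rw [show (fun φ => V (k φ)) = V ∘ k from rfl, ← Filter.map_map] at this
        exact (V.isometry.isUniformInducing.cauchy_map_iff).1 this
      exact CompleteSpace.complete h1
    obtain ⟨x, hx⟩ := lift (hy.congr' (hg1.mono fun φ h => h.1.symm))
    obtain ⟨hxd, hxa⟩ := h₁.exists_of_tendsto hx fun a =>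
      lift ((hay a).congr' (hg1.mono fun φ h => (h.2 a).symm))
    refine ⟨⟨x, hxd⟩, Subtype.ext ?_⟩
    exact tendsto_nhds_unique ((V.continuous.tendsto _).comp hx)
      (hy.congr' (hg1.mono fun φ h => h.1.symm))
  exact ⟨LinearIsometryEquiv.ofSurjective U hU, fun a φ => Subtype.ext (hact φ a).symm⟩

end StarRep

/-! ### The partial action of the group on characters -/

namespace StarGrading

variable {G : Type*} [Group G] {A : Type*} [Ring A] [StarRing A] [Algebra ℂ A] [StarModule ℂ A]
  {𝒢 : StarGrading G A}

namespace PosChar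

variable (χ : 𝒢.PosChar)

theorem map_star (b : 𝒢.base) : χ (star b) = star (χ b) := StarHomClass.map_star χ.1 b

theorem map_sub (b c : 𝒢.base) : χ (b - c) = χ b - χ c := _root_.map_sub χ.1 b c

theorem map_smul (r : ℂ) (b : 𝒢.base) : χ (r • b) = r * χ b := _root_.map_smul χ.1 r b

theorem starMul_self_nonneg {g : G} (a : 𝒢.piece g) : 0 ≤ χ (starMul a a) :=
  χ.2 _ (AddSubmonoid.subset_closure ⟨a, rfl⟩)

theorem ne_iff {χ ψ : 𝒢.PosChar} : χ ≠ ψ ↔ ∃ b, χ b ≠ ψ b := DFunLike.ne_iff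

/-- Cauchy–Schwarz for `b ↦ χ(a^* b a)`, which for commutative `B` follows from
`(a^* b a)² = a^* a · a^* b² a`. -/
theorem sandwich_eq_zero (hB : 𝒢.IsCommutativeBase) {g : G} {a : 𝒢.piece g}
    (ha : χ (starMul a a) = 0) (b : 𝒢.base) : χ (sandwich a b) = 0 := by
  have e : sandwich a b * sandwich a b = starMul a a * sandwich a (b * b) := by
    refine Subtype.ext ?_
    have h := hB b b.2 (a * star (a : A)) (by simpa using 𝒢.mul_mem a.2 (𝒢.star_mem a.2))
    simp only [sandwich, starMul, MulMemClass.coe_mul]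
    calc star (a : A) * b * a * (star (a : A) * b * a)
        = star (a : A) * (b * (a * star (a : A))) * b * a := by simp only [mul_assoc]
      _ = _ := by rw [h]; simp only [mul_assoc]
  have e' := congrArg χ e
  rw [χ.map_mul, χ.map_mul, ha, zero_mul] at e'
  exact mul_self_eq_zero.1 e'

end PosChar

/-- `χ(a^* b a) = χ(a^* a) χ^g(b)` for every `a ∈ A_g`. -/
theorem ActsTo.apply_sandwich (hB : 𝒢.IsCommutativeBase) {g : G} {χ ψ : 𝒢.PosChar}
    (h : ActsTo g χ ψ) (a : 𝒢.piece g) (b : 𝒢.base) :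
    χ (sandwich a b) = χ (starMul a a) * ψ b := by
  obtain ⟨c, hc, hψ⟩ := h
  have e : sandwich c b * starMul a a = starMul c c * sandwich a b := by
    refine Subtype.ext ?_
    have h := hB b b.2 (c * star (a : A)) (by simpa using 𝒢.mul_mem c.2 (𝒢.star_mem a.2))
    simp only [sandwich, starMul, MulMemClass.coe_mul]
    calc star (c : A) * b * c * (star (a : A) * a)
        = star (c : A) * (b * (c * star (a : A))) * a := by simp only [mul_assoc]
      _ = _ := by rw [h]; simp only [mul_assoc]
  have e' := congrArg χ e
  rw [χ.map_mul, χ.map_mul] at e'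
  rw [hψ, mul_div_assoc', eq_div_iff hc, mul_comm, ← e', mul_comm]

/-- The element `c ∈ A_g` that defines `χ^g` can be normalized to `χ(c^* c) = 1`. -/
theorem ActsTo.exists_normalized {g : G} {χ ψ : 𝒢.PosChar} (h : ActsTo g χ ψ) :
    ∃ c : 𝒢.piece g, χ (starMul c c) = 1 := by
  obtain ⟨a, ha, -⟩ := h
  have h0 := χ.starMul_self_nonneg a
  obtain ⟨h1, h2⟩ := Complex.le_def.1 h0
  set t : ℝ := (χ (starMul a a)).re with ht
  have h3 : χ (starMul a a) = t := Complex.ext rfl (by simpa using h2.symm)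
  have h4 : t ≠ 0 := by rintro h; rw [h3, h] at ha; simp at ha
  have h5 : 0 < t := lt_of_le_of_ne h1 (Ne.symm h4)
  refine ⟨((Real.sqrt t)⁻¹ : ℂ) • a, ?_⟩
  have e : starMul (((Real.sqrt t)⁻¹ : ℂ) • a) (((Real.sqrt t)⁻¹ : ℂ) • a) =
      ((t : ℂ)⁻¹) • starMul a a := by
    refine Subtype.ext ?_
    have h6 : ((Real.sqrt t : ℂ))⁻¹ * ((Real.sqrt t : ℂ))⁻¹ = (t : ℂ)⁻¹ := by
      rw [← mul_inv, ← Complex.ofReal_mul, Real.mul_self_sqrt h5.le]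
    simp [starMul, smul_smul, h6]
  rw [e, χ.map_smul, h3]
  exact inv_mul_cancel₀ (by exact_mod_cast h4)

/-- If `χ^g = ψ` and `χ^k = ψ`, then `g⁻¹ k` stabilizes `χ`. -/
theorem ActsTo.inv_mul_mem_stabilizer {g k : G} {χ ψ : 𝒢.PosChar} (hg : ActsTo g χ ψ)
    (hk : ActsTo k χ ψ) : g⁻¹ * k ∈ stabilizer χ :=
  ActsTo.mul hk hg.inv

theorem ActsTo.of_inv_mul_mem_stabilizer {g k : G} {χ ψ : 𝒢.PosChar} (hg : ActsTo g χ ψ)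
    (hk : g⁻¹ * k ∈ stabilizer χ) : ActsTo k χ ψ := by
  have := ActsTo.mul (show ActsTo (g⁻¹ * k) χ χ from hk) hg
  rwa [mul_inv_cancel_left] at this

/-- The partially defined map `χ ↦ χ^g` is injective. -/
theorem ActsTo.injective (hB : 𝒢.IsCommutativeBase) {g : G} {χ χ' ψ : 𝒢.PosChar}
    (h : ActsTo g χ ψ) (h' : ActsTo g χ' ψ) : χ = χ' :=
  ActsTo.unique hB h.inv h'.inv

theorem mem_orbit_of_actsTo {g : G} {χ ψ θ : 𝒢.PosChar} (hψ : ψ ∈ orbit χ) (h : ActsTo g ψ θ) :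
    θ ∈ orbit χ := by
  obtain ⟨k, hk⟩ := hψ
  exact ⟨g * k, hk.mul h⟩

theorem self_mem_orbit (χ : 𝒢.PosChar) : χ ∈ orbit χ := ⟨1, actsTo_one χ⟩

theorem countable_orbit [Countable G] (hB : 𝒢.IsCommutativeBase) (χ : 𝒢.PosChar) :
    (orbit χ).Countable := by
  have : orbit χ = ⋃ g, {ψ | ActsTo g χ ψ} := by
    ext ψ; simp [orbit]
  rw [this]
  refine Set.countable_iUnion fun g => Set.Subsingleton.countable ?_
  intro ψ hψ θ hθ
  exact ActsTo.unique hB hψ hθ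

instance : T2Space 𝒢.PosChar :=
  T2Space.of_injective_continuous (f := fun (χ : 𝒢.PosChar) b => χ b) DFunLike.coe_injective
    continuous_induced_dom

end StarGrading

/-! ### Weight spaces of representations -/

namespace StarRep

open StarGrading

/-- It suffices to control the homogeneous elements in `IsClosedRep.exists_of_tendsto`. -/
theorem exists_tendsto_of_homogeneous {G : Type*} [Group G] {A : Type*} [Ring A] [StarRing A]
    [Algebra ℂ A] (𝒢 : StarGrading G A) {H : Type*} [NormedAddCommGroup H] [InnerProductSpace ℂ H]
    (π : StarRep A H) {ι : Type*}
    {l : Filter ι} {f : ι → π.dom}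
    (h : ∀ g, ∀ a ∈ 𝒢.piece g, ∃ z, Tendsto (fun i => (π.act a (f i) : H)) l (𝓝 z)) (a : A) :
    ∃ z, Tendsto (fun i => (π.act a (f i) : H)) l (𝓝 z) := by
  induction a using 𝒢.induction_on with
  | zero => exact ⟨0, by simpa using tendsto_const_nhds⟩
  | add a b ha hb =>
    obtain ⟨z, hz⟩ := ha
    obtain ⟨z', hz'⟩ := hb
    exact ⟨z + z', by simpa [act_add] using hz.add hz'⟩
  | mem g a ha => exact h g a ha

variable {G : Type*} [Group G] {A : Type*} [Ring A] [StarRing A] [Algebra ℂ A] [StarModule ℂ A]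
  {𝒢 : StarGrading G A} {H : Type*} [NormedAddCommGroup H] [InnerProductSpace ℂ H]

/-- The weight space `{v ∈ D(π) | π(b) v = ψ(b) v for all b ∈ B}`. -/
def weightSpace (π : StarRep A H) (ψ : 𝒢.PosChar) : Submodule ℂ π.dom where
  carrier := {v | ∀ b : 𝒢.base, π.act b v = ψ b • v}
  add_mem' hv hw b := by rw [map_add, hv b, hw b, smul_add]
  zero_mem' b := by simp
  smul_mem' c v hv b := by rw [_root_.map_smul, hv b, smul_comm]

variable {π : StarRep A H} {ψ θ : 𝒢.PosChar} {v : π.dom}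

theorem inner_act_act_weight (hv : v ∈ π.weightSpace ψ) (w : π.dom) {g : G} (c a : 𝒢.piece g) :
    ⟪(π.act c w : H), (π.act a v : H)⟫_ℂ = ψ (starMul c a) * ⟪(w : H), (v : H)⟫_ℂ := by
  have := hv (starMul c a)
  rw [inner_act_act, show star (c : A) * a = (starMul c a : A) from rfl, this, Submodule.coe_smul,
    inner_smul_right]

theorem norm_sq_act_weight (hv : v ∈ π.weightSpace ψ) {g : G} (a : 𝒢.piece g) :
    (‖π.act a v‖ ^ 2 : ℂ) = ψ (starMul a a) * ‖v‖ ^ 2 := by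
  have := inner_act_act_weight hv v a a
  rwa [inner_self_eq_norm_sq_to_K, inner_self_eq_norm_sq_to_K] at this

theorem act_weight_eq_zero (hv : v ∈ π.weightSpace ψ) {g : G} {a : 𝒢.piece g}
    (ha : ψ (starMul a a) = 0) : π.act a v = 0 := by
  have := norm_sq_act_weight hv a
  rw [ha, zero_mul] at this
  simpa using this

/-- An element of degree `g` maps the weight space of `ψ` into that of `ψ^g`. -/
theorem act_mem_weightSpace (hB : 𝒢.IsCommutativeBase) (hv : v ∈ π.weightSpace ψ) {g : G}
    (h : ActsTo g ψ θ) (a : 𝒢.piece g) : π.act a v ∈ π.weightSpace θ := by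
  intro b
  let d : 𝒢.piece g := ⟨b * a - θ b • a, Submodule.sub_mem _
    (by simpa using 𝒢.mul_mem b.2 a.2) (Submodule.smul_mem _ _ a.2)⟩
  have e : starMul d d = sandwich a (star (b - θ b • 1) * (b - θ b • 1)) := by
    refine Subtype.ext ?_
    simp [d, starMul, sandwich, sub_mul, mul_sub, mul_assoc]
  have h1 : ψ (starMul d d) = 0 := by
    rw [e, h.apply_sandwich hB, θ.map_mul, θ.map_sub, θ.map_smul, θ.map_one]
    simp
  have h2 := act_weight_eq_zero hv h1
  rw [show (d : A) = b * a - θ b • (a : A) from rfl, act_sub, act_mul, act_smul, sub_eq_zero] at h2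
  exact h2

theorem act_weight_dichotomy (hB : 𝒢.IsCommutativeBase) (hv : v ∈ π.weightSpace ψ) {g : G}
    (a : 𝒢.piece g) : π.act a v = 0 ∨ ∃ θ, ActsTo g ψ θ ∧ π.act a v ∈ π.weightSpace θ := by
  by_cases ha : ψ (starMul a a) = 0
  · exact Or.inl (act_weight_eq_zero hv ha)
  · obtain ⟨θ, hθ⟩ := exists_actsTo hB ψ a ha
    exact Or.inr ⟨θ, hθ, act_mem_weightSpace hB hv hθ a⟩

theorem inner_weight_eq_zero {w : π.dom} (hv : v ∈ π.weightSpace ψ) (hw : w ∈ π.weightSpace θ)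
    (h : ψ ≠ θ) : ⟪(v : H), (w : H)⟫_ℂ = 0 := by
  obtain ⟨b, hb⟩ := PosChar.ne_iff.1 h
  have h1 := π.inner_act_right b v w
  have h2 := hv (star b)
  rw [StarMemClass.coe_star] at h2
  rw [hw b, h2, Submodule.coe_smul, Submodule.coe_smul, inner_smul_left, inner_smul_right,
    ψ.map_star] at h1
  have h3 : (θ b - ψ b) * ⟪(v : H), (w : H)⟫_ℂ = 0 := by
    rw [sub_mul, h1]; simp
  rcases mul_eq_zero.1 h3 with h4 | h4
  · exact absurd (sub_eq_zero.1 h4).symm hb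
  · exact h4

/-- Convergence of a net in the graph topology of `B` implies convergence in the graph topology of
`A`, because `‖π(a) φ‖² ≤ ‖π(a^* a) φ‖ ‖φ‖` and `a^* a ∈ B` for homogeneous `a`. -/
theorem exists_tendsto_of_base [CompleteSpace H] {ι : Type*} {l : Filter ι} [l.NeBot]
    {f : ι → π.dom} {x : H} (hf : Tendsto (fun i => (f i : H)) l (𝓝 x))
    (h : ∀ b : 𝒢.base, ∃ z, Tendsto (fun i => (π.act b (f i) : H)) l (𝓝 z)) (a : A) :
    ∃ z, Tendsto (fun i => (π.act a (f i) : H)) l (𝓝 z) := by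
  refine exists_tendsto_of_homogeneous 𝒢 π (fun g a ha => ?_) a
  have hdist {k : ι → H} {z : H} (hk : Tendsto k l (𝓝 z)) :
      Tendsto (fun p : ι × ι => ‖k p.1 - k p.2‖) (l ×ˢ l) (𝓝 0) := by
    have := ((hk.comp tendsto_fst).sub (hk.comp tendsto_snd)).norm
    simpa using this
  obtain ⟨z, hz⟩ := h (starMul (⟨a, ha⟩ : 𝒢.piece g) ⟨a, ha⟩)
  refine CompleteSpace.complete (cauchy_map_iff.2 ⟨inferInstance, ?_⟩)
  rw [Metric.uniformity_eq_comap_nhds_zero, tendsto_comap_iff]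
  have h1 := ((hdist hz).mul (hdist hf)).sqrt
  rw [mul_zero, Real.sqrt_zero] at h1
  refine squeeze_zero (fun p => dist_nonneg) (fun p => ?_) h1
  have h2 := π.inner_act_act a a (f p.1 - f p.2) (f p.1 - f p.2)
  rw [inner_self_eq_norm_sq_to_K] at h2
  have h3 := norm_inner_le_norm (𝕜 := ℂ) ((f p.1 - f p.2 : π.dom) : H)
    (π.act (star a * a) (f p.1 - f p.2) : H)
  rw [← h2, norm_pow, RCLike.norm_ofReal, abs_norm, _root_.map_sub, _root_.map_sub, mul_comm] at h3
  exact (dist_eq_norm _ _).trans_le (Real.le_sqrt_of_sq_le h3)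

/-- A weight space of a closed representation is closed in the Hilbert space. -/
theorem isClosed_weightSpace [CompleteSpace H] (hπ : π.IsClosedRep) (ψ : 𝒢.PosChar) :
    IsClosed ((π.weightSpace ψ).map π.dom.subtype : Set H) := by
  refine isClosed_of_closure_subset fun x hx => ?_
  obtain ⟨f, hf, hfx⟩ := mem_closure_iff_seq_limit.1 hx
  choose k hk hkf using hf
  have hkx : Tendsto (fun n => (k n : H)) atTop (𝓝 x) := hfx.congr fun n => (hkf n).symm
  have h1 (b : 𝒢.base) : Tendsto (fun n => (π.act b (k n) : H)) atTop (𝓝 (ψ b • x)) :=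
    (hkx.const_smul (ψ b)).congr fun n => by rw [hk n b]; rfl
  obtain ⟨hxd, hxa⟩ := hπ.exists_of_tendsto hkx (exists_tendsto_of_base hkx fun b => ⟨_, h1 b⟩)
  exact ⟨⟨x, hxd⟩, fun b => Subtype.ext (tendsto_nhds_unique (hxa b) (h1 b)), rfl⟩

end StarRep

/-! ### Representations of the stabilizer algebra that restrict to a multiple of a character -/

namespace StarGrading

theorem star_mul_mem {G : Type*} [Group G] {A : Type*} [Ring A] [StarRing A] [Algebra ℂ A]
    (𝒢 : StarGrading G A) {g k : G} {a b : A} (ha : a ∈ 𝒢.piece g) (hb : b ∈ 𝒢.piece k) :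
    star a * b ∈ 𝒢.piece (g⁻¹ * k) :=
  𝒢.mul_mem (𝒢.star_mem ha) hb

variable {G : Type*} [Group G] {A : Type*} [Ring A] [StarRing A] [Algebra ℂ A] [StarModule ℂ A]
  (𝒢 : StarGrading G A) (K : Subgroup G)

variable {𝒢} in
/-- `c c^* ∈ B` for `c ∈ A_g`. -/
def mulStar {g : G} (c : 𝒢.piece g) : 𝒢.base :=
  ⟨c * star (c : A), (by simpa using 𝒢.mul_mem c.2 (𝒢.star_mem c.2) :
    c * star (c : A) ∈ 𝒢.piece 1)⟩

variable {𝒢} in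
/-- If `χ^g = θ` and `χ(c^* c) = 1` with `c ∈ A_g`, then `θ(c c^*) = 1`. -/
theorem ActsTo.apply_mulStar (hB : 𝒢.IsCommutativeBase) {g : G} {χ θ : 𝒢.PosChar}
    (h : ActsTo g χ θ) (c : 𝒢.piece g) (hc : χ (starMul c c) = 1) : θ (mulStar c) = 1 := by
  have h1 := h.apply_sandwich hB c (mulStar c)
  rw [hc, one_mul] at h1
  have e : sandwich c (mulStar c) = starMul c c * starMul c c :=
    Subtype.ext (by simp [sandwich, starMul, mulStar, mul_assoc])
  rw [← h1, e, χ.map_mul, hc, one_mul]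

theorem coe_expect_of_mem {g : G} (hg : g ∈ K) {a : A} (ha : a ∈ 𝒢.piece g) :
    (𝒢.expect K a : A) = a :=
  𝒢.restrictTo_of_mem (X := K) hg ha

theorem expect_of_notMem {g : G} (hg : g ∉ K) {a : A} (ha : a ∈ 𝒢.piece g) :
    𝒢.expect K a = 0 :=
  Subtype.ext (𝒢.restrictTo_of_notMem (X := K) hg ha)

theorem expect_coe (x : 𝒢.sub K) : 𝒢.expect K (x : A) = x := by
  have h : ∀ a ∈ 𝒢.span K, 𝒢.restrictTo K a = a := by
    intro a ha
    refine Submodule.iSup_induction' (fun g => ⨆ _ : g ∈ (K : Set G), 𝒢.piece g)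
      (motive := fun a _ => 𝒢.restrictTo K a = a) (fun g a ha => ?_) (by simp)
      (fun a b _ _ ha hb => by rw [map_add, ha, hb]) ha
    by_cases hg : g ∈ (K : Set G)
    · simp only [hg, iSup_pos] at ha
      exact 𝒢.restrictTo_of_mem hg ha
    · simp only [hg, iSup_neg, not_false_eq_true, Submodule.mem_bot] at ha
      simp [ha]
  exact Subtype.ext (h _ x.2)

theorem sub_induction {P : 𝒢.sub K → Prop} (zero : P 0) (add : ∀ x y, P x → P y → P (x + y))
    (mem : ∀ g ∈ K, ∀ x : 𝒢.sub K, (x : A) ∈ 𝒢.piece g → P x) (x : 𝒢.sub K) : P x := by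
  rw [← 𝒢.expect_coe K x]
  generalize (x : A) = a
  induction a using 𝒢.induction_on with
  | zero => simpa using zero
  | add a b ha hb => rw [map_add]; exact add _ _ ha hb
  | mem g a ha =>
    by_cases hg : g ∈ K
    · exact mem g hg _ (by rwa [𝒢.coe_expect_of_mem K hg ha])
    · rw [𝒢.expect_of_notMem K hg ha]; exact zero

/-- The conditional expectation is a right module map over `A_K`. -/
theorem expect_mul_coe (a : A) (x : 𝒢.sub K) : 𝒢.expect K (a * x) = 𝒢.expect K a * x := by
  induction x using 𝒢.sub_induction K with
  | zero => simp
  | add x y hx hy => simp [mul_add, hx, hy]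
  | mem h hh x hx =>
    induction a using 𝒢.induction_on with
    | zero => simp
    | add a b ha hb => simp [add_mul, ha, hb]
    | mem g a ha =>
      by_cases hg : g ∈ K
      · refine Subtype.ext ?_
        rw [𝒢.coe_expect_of_mem K (K.mul_mem hg hh) (𝒢.mul_mem ha hx), MulMemClass.coe_mul,
          𝒢.coe_expect_of_mem K hg ha]
      · rw [𝒢.expect_of_notMem K hg ha, zero_mul, 𝒢.expect_of_notMem K _ (𝒢.mul_mem ha hx)]
        exact fun h => hg ((K.mul_mem_cancel_right hh).1 h)

end StarGrading

namespace StarRep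

open StarGrading

variable {G : Type*} [Group G] {A : Type*} [Ring A] [StarRing A] [Algebra ℂ A] [StarModule ℂ A]
  {𝒢 : StarGrading G A} {H : Type*} [NormedAddCommGroup H] [InnerProductSpace ℂ H]

section

variable {K : Subgroup G} {ρ : StarRep (𝒢.sub K) H} {χ : 𝒢.PosChar}

theorem RestrictsToMultiple.act_eq (hρ : ρ.RestrictsToMultiple χ) {x : 𝒢.sub K} {b : 𝒢.base}
    (h : (x : A) = b) (φ : ρ.dom) : ρ.act x φ = χ b • φ := by
  have : x = StarSubalgebra.inclusion (𝒢.base_le_sub K) b := Subtype.ext h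
  rw [this]; exact hρ b φ

theorem RestrictsToMultiple.act_one (hρ : ρ.RestrictsToMultiple χ) (φ : ρ.dom) :
    ρ.act 1 φ = φ := by
  rw [hρ.act_eq (b := 1) rfl, χ.map_one, one_smul]

/-- `‖ρ(x) φ‖² = χ(x^* x) ‖φ‖²` for homogeneous `x`. -/
theorem RestrictsToMultiple.norm_sq_act (hρ : ρ.RestrictsToMultiple χ) {x : 𝒢.sub K} {g : G}
    {a : 𝒢.piece g} (hx : (x : A) = a) (φ : ρ.dom) :
    (‖ρ.act x φ‖ ^ 2 : ℂ) = χ (starMul a a) * ‖φ‖ ^ 2 := by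
  have h1 := ρ.inner_act_act x x φ φ
  rw [hρ.act_eq (x := star x * x) (b := starMul a a) (by simp [starMul, hx])] at h1
  rw [Submodule.coe_smul, inner_smul_right, inner_self_eq_norm_sq_to_K,
    inner_self_eq_norm_sq_to_K] at h1
  exact h1

theorem RestrictsToMultiple.act_eq_zero (hρ : ρ.RestrictsToMultiple χ) {x : 𝒢.sub K} {g : G}
    {a : 𝒢.piece g} (hx : (x : A) = a) (ha : χ (starMul a a) = 0) (φ : ρ.dom) :
    ρ.act x φ = 0 := by
  have := hρ.norm_sq_act hx φ
  rw [ha, zero_mul] at this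
  simpa using this

theorem RestrictsToMultiple.isBoundedRep (hρ : ρ.RestrictsToMultiple χ) : ρ.IsBoundedRep := by
  intro x
  induction x using 𝒢.sub_induction K with
  | zero => exact ⟨0, fun φ => by simp⟩
  | add x y hx hy =>
    obtain ⟨C, hC⟩ := hx
    obtain ⟨C', hC'⟩ := hy
    refine ⟨C + C', fun φ => ?_⟩
    rw [act_add, add_mul]
    exact (norm_add_le _ _).trans (add_le_add (hC φ) (hC' φ))
  | mem g hg x hx =>
    refine ⟨Real.sqrt ‖χ (starMul (⟨x, hx⟩ : 𝒢.piece g) ⟨x, hx⟩)‖, fun φ => le_of_eq ?_⟩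
    have h4 := congrArg norm (hρ.norm_sq_act (a := (⟨x, hx⟩ : 𝒢.piece g)) rfl φ)
    rw [norm_mul, norm_pow, norm_pow, Complex.norm_real, Complex.norm_real, norm_norm,
      norm_norm] at h4
    rw [← Real.sqrt_sq (norm_nonneg (ρ.act x φ)), h4, Real.sqrt_mul (norm_nonneg _),
      Real.sqrt_sq (norm_nonneg _)]

end

section

/-- A closed bounded representation is defined on the whole Hilbert space. -/
theorem IsBoundedRep.dom_eq_top {A : Type*} [Ring A] [StarRing A] [Algebra ℂ A]
    [CompleteSpace H] {π : StarRep A H} (hb : π.IsBoundedRep) (hc : π.IsClosedRep) :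
    π.dom = ⊤ := by
  rw [eq_top_iff]
  rintro x -
  obtain ⟨f, hf, hfx⟩ := mem_closure_iff_seq_limit.1 (π.dense_dom x)
  refine (hc.exists_of_tendsto (f := fun n => (⟨f n, hf n⟩ : π.dom)) hfx fun a => ?_).1
  obtain ⟨C, hC⟩ := hb a
  let T : π.dom →L[ℂ] π.dom := (π.act a).mkContinuous C hC
  have h1 : CauchySeq (fun n => (⟨f n, hf n⟩ : π.dom)) := by
    have := hfx.cauchySeq
    rw [CauchySeq, ← isUniformEmbedding_subtype_val.isUniformInducing.cauchy_map_iff,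
      Filter.map_map]
    exact this
  have h2 := (T.uniformContinuous.comp_cauchySeq h1)
  have h3 := (π.dom.subtypeL.uniformContinuous.comp_cauchySeq h2)
  exact cauchySeq_tendsto_of_complete h3

/-- A bounded representation on the whole Hilbert space is closed. -/
theorem IsBoundedRep.isClosedRep {A : Type*} [Ring A] [StarRing A] [Algebra ℂ A]
    {π : StarRep A H} (hb : π.IsBoundedRep) (hd : π.dom = ⊤) :
    π.IsClosedRep := by
  have hcont (a : A) : Continuous fun x : H => (π.act a ⟨x, hd ▸ Submodule.mem_top⟩ : H) := by
    obtain ⟨C, hC⟩ := hb a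
    have h1 := ((π.act a).mkContinuous C hC).continuous
    exact (continuous_subtype_val.comp h1).comp (continuous_id.subtype_mk _)
  have : Set.range π.graphMap =
      {p | ∀ a, p.2 a = (π.act a ⟨p.1, hd ▸ Submodule.mem_top⟩ : H)} := by
    ext p
    constructor
    · rintro ⟨φ, rfl⟩ a; rfl
    · intro hp
      exact ⟨⟨p.1, hd ▸ Submodule.mem_top⟩, Prod.ext rfl (funext fun a => (hp a).symm)⟩
  rw [IsClosedRep, this, Set.ofPred_forall]
  exact isClosed_iInter fun a => isClosed_eq (continuous_eval a) ((hcont a).comp continuous_fst)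

end

/-! ### Decomposition of the inducing form along the orbit -/

/-- A degree `g` with `χ^g = θ`, for a point `θ` of the orbit. -/
def orbitDeg {χ : 𝒢.PosChar} (θ : orbit χ) : G := θ.2.choose

theorem actsTo_orbitDeg {χ : 𝒢.PosChar} (θ : orbit χ) : ActsTo (orbitDeg θ) χ (θ : 𝒢.PosChar) :=
  θ.2.choose_spec

/-- An element `c` of degree `orbitDeg θ` with `χ(c^* c) = 1`. -/
def orbitElt {χ : 𝒢.PosChar} (θ : orbit χ) : 𝒢.piece (orbitDeg θ) :=
  (actsTo_orbitDeg θ).exists_normalized.choose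

theorem orbitElt_normalized {χ : 𝒢.PosChar} (θ : orbit χ) :
    χ (starMul (orbitElt θ) (orbitElt θ)) = 1 :=
  (actsTo_orbitDeg θ).exists_normalized.choose_spec

variable {χ : 𝒢.PosChar} (ρ : StarRep (𝒢.sub (stabilizer χ)) H)

/-- The component `a ⊗ φ ↦ ρ(p_H(c^* a)) φ` at the point `θ` of the orbit, where `c` is
`orbitElt θ`. The components realize the inducing form as that of an orthogonal sum of copies
of `D(ρ)`, see `indForm_eq_sum`. -/
def component (θ : orbit χ) : A ⊗[ℂ] ρ.dom →ₗ[ℂ] ρ.dom :=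
  TensorProduct.lift <| LinearMap.mk₂ ℂ
    (fun a φ => ρ.act (𝒢.expect (stabilizer χ) (star (orbitElt θ : A) * a)) φ)
    (by intros; simp [mul_add]) (by intros; simp) (by intros; simp) (by intros; simp)

@[simp] theorem component_tmul (θ : orbit χ) (a : A) (φ : ρ.dom) :
    ρ.component θ (a ⊗ₜ φ) =
      ρ.act (𝒢.expect (stabilizer χ) (star (orbitElt θ : A) * a)) φ := rfl

variable {ρ}

theorem component_eq_zero {θ : orbit χ} {g : G} (h : ¬ ActsTo g χ (θ : 𝒢.PosChar)) {a : A}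
    (ha : a ∈ 𝒢.piece g) (φ : ρ.dom) : ρ.component θ (a ⊗ₜ φ) = 0 := by
  rw [component_tmul, 𝒢.expect_of_notMem _ (fun h' => h
    ((actsTo_orbitDeg θ).of_inv_mul_mem_stabilizer h')) (𝒢.star_mul_mem (orbitElt θ).2 ha)]
  simp

/-- If `χ(a^* a) = 0` then `ρ(p_H(b^* a)) = 0`. -/
theorem RestrictsToMultiple.act_expect_eq_zero (hB : 𝒢.IsCommutativeBase)
    (hρ : ρ.RestrictsToMultiple χ) {g k : G} (a : 𝒢.piece g) (b : 𝒢.piece k)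
    (ha : χ (starMul a a) = 0) (φ : ρ.dom) :
    ρ.act (𝒢.expect (stabilizer χ) (star (b : A) * a)) φ = 0 := by
  by_cases h : k⁻¹ * g ∈ stabilizer χ
  · have hm := 𝒢.star_mul_mem b.2 a.2
    refine hρ.act_eq_zero (a := (⟨_, hm⟩ : 𝒢.piece (k⁻¹ * g))) (𝒢.coe_expect_of_mem _ h hm) ?_ φ
    have e : starMul (⟨_, hm⟩ : 𝒢.piece (k⁻¹ * g)) ⟨_, hm⟩ =
        sandwich a (mulStar b) :=
      Subtype.ext (by simp [starMul, sandwich, mulStar, mul_assoc])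
    rw [e, χ.sandwich_eq_zero hB ha]
  · rw [𝒢.expect_of_notMem _ h (𝒢.star_mul_mem b.2 a.2)]; simp

/-- If `χ^g = χ^l = θ` and `χ(c^* c) = 1` with `c ∈ A_l`, then `ρ(p_H(b^* a))` agrees with
`ρ(b^* c) ρ(c^* a)` for `a ∈ A_g`, because `θ(c c^*) = 1`. -/
theorem RestrictsToMultiple.act_expect_insert (hB : 𝒢.IsCommutativeBase)
    (hρ : ρ.RestrictsToMultiple χ) {g k l : G} {θ : 𝒢.PosChar} (hg : ActsTo g χ θ)
    (hl : ActsTo l χ θ) (a : 𝒢.piece g) (b : 𝒢.piece k) (c : 𝒢.piece l)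
    (hc : χ (starMul c c) = 1) (φ : ρ.dom) :
    ρ.act (𝒢.expect (stabilizer χ) (star (b : A) * a)) φ =
      ρ.act (𝒢.expect (stabilizer χ) (star (b : A) * (c * star (c : A)) * a)) φ := by
  let cc : 𝒢.base := mulStar c
  let bb : 𝒢.base := mulStar b
  have hcc : θ cc = 1 := hl.apply_mulStar hB c hc
  have hm1 := 𝒢.star_mul_mem b.2 a.2
  have hm2 : star (b : A) * (c * star (c : A)) * a ∈ 𝒢.piece (k⁻¹ * g) := by
    have := 𝒢.mul_mem (𝒢.star_mem b.2) (𝒢.mul_mem cc.2 a.2)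
    simpa [mul_assoc, cc, mulStar] using this
  rw [← sub_eq_zero, ← act_sub, ← _root_.map_sub]
  by_cases h : k⁻¹ * g ∈ stabilizer χ
  · have hm := Submodule.sub_mem _ hm1 hm2
    refine hρ.act_eq_zero (a := (⟨_, hm⟩ : 𝒢.piece (k⁻¹ * g))) (𝒢.coe_expect_of_mem _ h hm) ?_ φ
    have e : starMul (⟨_, hm⟩ : 𝒢.piece (k⁻¹ * g)) ⟨_, hm⟩ =
        sandwich a ((1 - cc) * bb * (1 - cc)) :=
      Subtype.ext (by simp [starMul, sandwich, cc, bb, mulStar, mul_assoc, mul_sub, sub_mul])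
    rw [e, hg.apply_sandwich hB, θ.map_mul, θ.map_sub, θ.map_one, hcc]
    simp
  · rw [𝒢.expect_of_notMem _ h (Submodule.sub_mem _ hm1 hm2)]; simp

/-- The inducing form is the sum of the inner products of the components; all but finitely many of
them vanish. -/
theorem RestrictsToMultiple.indForm_eq_sum (hB : 𝒢.IsCommutativeBase)
    (hρ : ρ.RestrictsToMultiple χ) (ξ η : A ⊗[ℂ] ρ.dom) :
    ∀ᶠ S : Finset (orbit χ) in atTop,
      ρ.indForm ξ η = ∑ θ ∈ S, ⟪(ρ.component θ ξ : H), (ρ.component θ η : H)⟫_ℂ := by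
  classical
  induction ξ with
  | zero => simp
  | add ξ ξ' h h' =>
    filter_upwards [h, h'] with S h h'
    simp [h, h', Finset.sum_add_distrib]
  | tmul b ψ =>
    induction η with
    | zero => simp
    | add η η' h h' =>
      filter_upwards [h, h'] with S h h'
      simp [h, h', Finset.sum_add_distrib]
    | tmul a φ =>
      induction b using 𝒢.induction_on with
      | zero => simp
      | add b b' h h' =>
        filter_upwards [h, h'] with S h h'
        simp only [TensorProduct.add_tmul, map_add, LinearMap.add_apply, h, h', Submodule.coe_add,
          inner_add_left, Finset.sum_add_distrib]
      | mem k b hb =>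
      induction a using 𝒢.induction_on with
      | zero => simp
      | add a a' h h' =>
        filter_upwards [h, h'] with S h h'
        simp only [TensorProduct.add_tmul, map_add, h, h', Submodule.coe_add,
          inner_add_right, Finset.sum_add_distrib]
      | mem g a ha =>
      rw [indForm_tmul]
      by_cases h0 : χ (starMul (⟨a, ha⟩ : 𝒢.piece g) ⟨a, ha⟩) = 0
      · refine Eventually.of_forall fun S => ?_
        rw [hρ.act_expect_eq_zero hB (⟨a, ha⟩ : 𝒢.piece g) ⟨b, hb⟩ h0, Finset.sum_eq_zero]
        · simp
        · intro θ _
          rw [component_tmul ρ θ a, hρ.act_expect_eq_zero hB (⟨a, ha⟩ : 𝒢.piece g) (orbitElt θ) h0]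
          simp
      · obtain ⟨θ, hθ⟩ := exists_actsTo hB χ _ h0
        let θ' : orbit χ := ⟨θ, g, hθ⟩
        refine (eventually_ge_atTop ({θ'} : Finset (orbit χ))).mono fun S hS => ?_
        rw [Finset.sum_eq_single θ']
        · by_cases hk : ActsTo k χ θ
          · have hl := actsTo_orbitDeg θ'
            have hkl := hl.inv_mul_mem_stabilizer hk
            have hgl := hl.inv_mul_mem_stabilizer hθ
            rw [component_tmul, component_tmul, inner_act_act,
              hρ.act_expect_insert hB hθ hl ⟨a, ha⟩ ⟨b, hb⟩ (orbitElt θ') (orbitElt_normalized θ')]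
            congr 4
            refine Subtype.ext ?_
            rw [MulMemClass.coe_mul, StarMemClass.coe_star,
              𝒢.coe_expect_of_mem _ hkl (𝒢.star_mul_mem (orbitElt θ').2 hb),
              𝒢.coe_expect_of_mem _ hgl (𝒢.star_mul_mem (orbitElt θ').2 ha),
              𝒢.coe_expect_of_mem _ (hk.inv_mul_mem_stabilizer hθ)]
            · simp [mul_assoc]
            · have := 𝒢.mul_mem (𝒢.star_mem hb) (𝒢.mul_mem (𝒢.mul_mem (orbitElt θ').2
                (𝒢.star_mem (orbitElt θ').2)) ha)
              simpa [mul_assoc] using this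
          · rw [component_eq_zero hk hb, 𝒢.expect_of_notMem _ _ (𝒢.star_mul_mem hb ha)]
            · simp
            · intro h
              refine hk ?_
              have := (stabilizer χ).inv_mem h
              rw [mul_inv_rev, inv_inv] at this
              exact hθ.of_inv_mul_mem_stabilizer this
        · intro θ'' _ hne
          rw [component_eq_zero (a := a) _ ha]
          · simp
          · exact fun h => hne (Subtype.ext (h.unique hB hθ))
        · exact fun h => absurd (hS (Finset.mem_singleton_self θ')) h

theorem RestrictsToMultiple.inducible (hB : 𝒢.IsCommutativeBase)
    (hρ : ρ.RestrictsToMultiple χ) : ρ.Inducible := by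
  intro ξ
  obtain ⟨S, hS⟩ := (hρ.indForm_eq_sum hB ξ ξ).exists
  rw [hS]
  refine Finset.sum_nonneg fun θ _ => ?_
  rw [inner_self_eq_norm_sq_to_K]
  exact pow_nonneg (Complex.zero_le_real.2 (norm_nonneg (ρ.component θ ξ))) 2

end StarRep

namespace StarRep

open StarGrading

/-! ### The induced representation and its universal property -/

section Universal

variable {G : Type*} [Group G] {A : Type*} [Ring A] [StarRing A] [Algebra ℂ A] [StarModule ℂ A]
  {𝒢 : StarGrading G A} {K : Subgroup G} {H : Type*} [NormedAddCommGroup H] [InnerProductSpace ℂ H]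
  {ρ : StarRep (𝒢.sub K) H} (hρ : ρ.Inducible)

theorem denseRange_indMk : DenseRange (indMk hρ) :=
  UniformSpace.Completion.denseRange_coe

/-- `[a ⊗ φ]` as a vector of the domain of the induced representation, bilinear in `a` and `φ`. -/
def indVec : A ⊗[ℂ] ρ.dom →ₗ[ℂ] (ρ.Ind hρ).dom :=
  (indRep₀ hρ).toClosure ∘ₗ (indMk hρ).rangeRestrict

theorem act_indVec_tmul (a x : A) (φ : ρ.dom) :
    (ρ.Ind hρ).act a (indVec hρ (x ⊗ₜ φ)) = indVec hρ ((a * x) ⊗ₜ φ) := by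
  refine ((indRep₀ hρ).act_toClosure a _).trans (congrArg _ (Subtype.ext ?_))
  exact indCoreAct_mk hρ a _ _

theorem inner_indVec (ξ η : A ⊗[ℂ] ρ.dom) :
    ⟪(indVec hρ ξ : IndSpace ρ hρ), (indVec hρ η : IndSpace ρ hρ)⟫_ℂ = ρ.indForm ξ η :=
  inner_indMk hρ ξ η

theorem isClosedRep_ind : (ρ.Ind hρ).IsClosedRep := isClosedRep_closure _

theorem isCore_ind : (ρ.Ind hρ).IsCore (Set.range (indVec hρ)) := by
  refine (isCore_closure (indRep₀ hρ)).mono ?_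
  rintro _ ⟨⟨_, ξ, rfl⟩, rfl⟩
  exact ⟨ξ, rfl⟩

theorem indVec_eq_of_inner {ξ η : A ⊗[ℂ] ρ.dom}
    (h : ∀ (c : A) (ψ : ρ.dom), ρ.indForm (c ⊗ₜ ψ) ξ = ρ.indForm (c ⊗ₜ ψ) η) :
    indVec hρ ξ = indVec hρ η := by
  refine Subtype.ext (sub_eq_zero.1 ((isCore_ind hρ).eq_zero ?_))
  rintro _ ⟨ζ, rfl⟩
  rw [inner_sub_right, inner_indVec, inner_indVec, sub_eq_zero]
  induction ζ with
  | zero => simp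
  | add ζ ζ' h h' => simp [h, h']
  | tmul c ψ => exact h c ψ

/-- In the induced representation, `[a x ⊗ φ] = [a ⊗ ρ(x) φ]` for `x ∈ A_K`. -/
theorem indVec_mul_tmul (a : A) (x : 𝒢.sub K) (φ : ρ.dom) :
    indVec hρ ((a * x) ⊗ₜ φ) = indVec hρ (a ⊗ₜ ρ.act x φ) := by
  refine indVec_eq_of_inner hρ fun c ψ => ?_
  rw [indForm_tmul, indForm_tmul, ← mul_assoc, 𝒢.expect_mul_coe, act_mul]

variable {H' : Type*} [NormedAddCommGroup H'] [InnerProductSpace ℂ H']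

/-- The map `a ⊗ φ ↦ π(a) j(φ)`. -/
def tensorMap (π : StarRep A H') (j : ρ.dom →ₗ[ℂ] π.dom) : A ⊗[ℂ] ρ.dom →ₗ[ℂ] π.dom :=
  TensorProduct.lift <| LinearMap.mk₂ ℂ (fun a φ => π.act a (j φ))
    (by intros; simp) (by intros; simp) (by intros; simp) (by intros; simp)

@[simp] theorem tensorMap_tmul (π : StarRep A H') (j : ρ.dom →ₗ[ℂ] π.dom) (a : A) (φ : ρ.dom) :
    tensorMap π j (a ⊗ₜ φ) = π.act a (j φ) := rfl

/-- The universal property of induction: a closed representation `π` with a map `j` of `D(ρ)` into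
`D(π)` such that the vectors `π(a) j(φ)` have the inner products of the inducing form and span a
core is unitarily equivalent to the induced representation. -/
theorem unitarilyEquivalent_ind [CompleteSpace H'] {π : StarRep A H'} (hπ : π.IsClosedRep)
    (j : ρ.dom →ₗ[ℂ] π.dom)
    (hj : ∀ a φ ψ, ⟪(j ψ : H'), (π.act a (j φ) : H')⟫_ℂ = ⟪(ψ : H), (ρ.act (𝒢.expect K a) φ : H)⟫_ℂ)
    (hcore : π.IsCore (Set.range (tensorMap π j))) :
    (ρ.Ind hρ).UnitarilyEquivalent π := by
  let J : A ⊗[ℂ] ρ.dom →ₗ[ℂ] H' := π.dom.subtype ∘ₗ tensorMap π j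
  have hinner (ξ η) : ⟪J ξ, J η⟫_ℂ = ρ.indForm ξ η := by
    induction ξ with
    | zero => simp
    | add ξ ξ' h h' => simp [h, h']
    | tmul b ψ =>
      induction η with
      | zero => simp
      | add η η' h h' => simp [h, h']
      | tmul a φ => exact (π.inner_act_act b a (j ψ) (j φ)).trans (hj _ _ _)
  have hnorm (ξ : A ⊗[ℂ] ρ.dom) : ‖J ξ‖ = ‖indMk hρ ξ‖ := by
    rw [norm_eq_sqrt_re_inner (𝕜 := ℂ), norm_eq_sqrt_re_inner (𝕜 := ℂ), hinner]
    exact congrArg (fun z => √(RCLike.re z)) (inner_indMk hρ ξ ξ).symm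
  have hd : DenseRange (indMk hρ) := denseRange_indMk hρ
  have hb : ∃ C, ∀ ξ, ‖J ξ‖ ≤ C * ‖indMk hρ ξ‖ := ⟨1, fun ξ => by rw [hnorm, one_mul]⟩
  let T : IndSpace ρ hρ →L[ℂ] H' := LinearMap.extendOfNorm (E := IndPre ρ hρ) J (indMk hρ)
  have hT (ξ : A ⊗[ℂ] ρ.dom) : T (indMk hρ ξ) = J ξ :=
    LinearMap.extendOfNorm_eq (E := IndPre ρ hρ) hd hb ξ
  let V : IndSpace ρ hρ →ₗᵢ[ℂ] H' :=
    { toLinearMap := T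
      norm_map' := fun x => by
        refine hd.induction_on (p := fun x => ‖T x‖ = ‖x‖) x
          (isClosed_eq T.continuous.norm continuous_norm) fun ξ => ?_
        exact (congrArg norm (hT ξ)).trans (hnorm ξ) }
  refine UnitarilyEquivalent.of_core (isClosedRep_ind hρ) hπ V (isCore_ind hρ) hcore ?_ ?_
  · rintro _ ⟨ξ, rfl⟩
    have h1 (ξ : A ⊗[ℂ] ρ.dom) : V (indVec hρ ξ) = tensorMap π j ξ := hT ξ
    refine ⟨h1 ξ ▸ (tensorMap π j ξ).2, fun a => ?_⟩
    have h2 : (⟨V (indVec hρ ξ), h1 ξ ▸ (tensorMap π j ξ).2⟩ : π.dom) = tensorMap π j ξ :=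
      Subtype.ext (h1 ξ)
    rw [h2]
    clear h2
    induction ξ with
    | zero => simp
    | add ξ ξ' h h' => simp only [map_add, Submodule.coe_add, h, h']
    | tmul x φ => rw [act_indVec_tmul, h1, tensorMap_tmul, tensorMap_tmul, act_mul]
  · rintro _ ⟨ξ, rfl⟩
    exact ⟨indVec hρ ξ, ⟨ξ, rfl⟩, hT ξ⟩

/-- The canonical map `φ ↦ [1 ⊗ φ]`. -/
def indUnit : ρ.dom →ₗ[ℂ] (ρ.Ind hρ).dom :=
  indVec hρ ∘ₗ TensorProduct.mk ℂ A ρ.dom 1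

theorem act_indUnit (a : A) (φ : ρ.dom) :
    (ρ.Ind hρ).act a (indUnit hρ φ) = indVec hρ (a ⊗ₜ φ) := by
  have := act_indVec_tmul hρ a 1 φ
  rwa [mul_one] at this

theorem act_coe_indUnit (x : 𝒢.sub K) (φ : ρ.dom) :
    (ρ.Ind hρ).act x (indUnit hρ φ) = indUnit hρ (ρ.act x φ) := by
  rw [act_indUnit, ← one_mul (x : A), indVec_mul_tmul]; rfl

theorem inner_indUnit_act (a : A) (φ ψ : ρ.dom) :
    ⟪(indUnit hρ ψ : IndSpace ρ hρ), ((ρ.Ind hρ).act a (indUnit hρ φ) : IndSpace ρ hρ)⟫_ℂ =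
      ⟪(ψ : H), (ρ.act (𝒢.expect K a) φ : H)⟫_ℂ := by
  rw [act_indUnit]
  refine (inner_indVec hρ _ _).trans ?_
  refine (indForm_tmul ρ a 1 φ ψ).trans ?_
  rw [star_one, one_mul]

/-- Unitarily equivalent representations induce unitarily equivalent representations. -/
theorem UnitarilyEquivalent.ind {ρ' : StarRep (𝒢.sub K) H'} (hρ' : ρ'.Inducible)
    (h : ρ.UnitarilyEquivalent ρ') : (ρ.Ind hρ).UnitarilyEquivalent (ρ'.Ind hρ') := by
  obtain ⟨U, hU⟩ := h
  refine unitarilyEquivalent_ind hρ (isClosedRep_ind hρ')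
    (indUnit hρ' ∘ₗ (U.toLinearEquiv : ρ.dom →ₗ[ℂ] ρ'.dom)) (fun a φ ψ => ?_) ?_
  · refine (inner_indUnit_act hρ' a (U φ) (U ψ)).trans ?_
    rw [← hU]
    exact U.inner_map_map ψ (ρ.act (𝒢.expect K a) φ)
  · refine (isCore_ind hρ').mono ?_
    rintro _ ⟨ξ, rfl⟩
    induction ξ with
    | zero => exact ⟨0, by simp⟩
    | add ξ ξ' h h' =>
      obtain ⟨η, hη⟩ := h
      obtain ⟨η', hη'⟩ := h'
      exact ⟨η + η', by rw [_root_.map_add, hη, hη', _root_.map_add]⟩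
    | tmul a φ =>
      refine ⟨a ⊗ₜ U.symm φ, ?_⟩
      rw [tensorMap_tmul, ← act_indUnit]
      simp

end Universal

/-! ### The weight spaces of the induced representation -/

section Weights

variable {G : Type*} [Group G] {A : Type*} [Ring A] [StarRing A] [Algebra ℂ A] [StarModule ℂ A]
  {𝒢 : StarGrading G A} {H : Type*} [NormedAddCommGroup H] [InnerProductSpace ℂ H]
  {χ : 𝒢.PosChar}

/-- The span of the weight spaces along the orbit of `χ`. -/
def orbitSpan (π : StarRep A H) (χ : 𝒢.PosChar) : Submodule ℂ π.dom :=
  ⨆ θ : orbit χ, π.weightSpace (θ : 𝒢.PosChar)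

theorem act_mem_orbitSpan (hB : 𝒢.IsCommutativeBase) {π : StarRep A H} {v : π.dom}
    (hv : v ∈ π.weightSpace χ) (a : A) : π.act a v ∈ π.orbitSpan χ := by
  induction a using 𝒢.induction_on with
  | zero => simp
  | add a b ha hb => rw [act_add]; exact Submodule.add_mem _ ha hb
  | mem g a ha =>
    rcases act_weight_dichotomy hB hv (⟨a, ha⟩ : 𝒢.piece g) with h | ⟨θ, hθ, h⟩
    · rw [show π.act a v = 0 from h]; exact Submodule.zero_mem _
    · exact Submodule.mem_iSup_of_mem (p := fun θ : orbit χ => π.weightSpace (θ : 𝒢.PosChar))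
        ⟨θ, g, hθ⟩ h

variable {ρ : StarRep (𝒢.sub (stabilizer χ)) H} (hρ : ρ.Inducible)

theorem indUnit_mem_weightSpace (hχ : ρ.RestrictsToMultiple χ) (φ : ρ.dom) :
    indUnit hρ φ ∈ (ρ.Ind hρ).weightSpace χ := by
  intro b
  have := act_coe_indUnit hρ (StarSubalgebra.inclusion (𝒢.base_le_sub _) b) φ
  rw [hχ.act_eq (b := b) rfl, _root_.map_smul] at this
  exact this

theorem norm_indUnit (hχ : ρ.RestrictsToMultiple χ) (φ : ρ.dom) : ‖indUnit hρ φ‖ = ‖φ‖ := by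
  have h := inner_indUnit_act hρ 1 φ φ
  have h1 : 𝒢.expect (stabilizer χ) 1 = 1 := 𝒢.expect_coe _ 1
  rw [h1, hχ.act_one] at h
  have h2 : (ρ.Ind hρ).act 1 (indUnit hρ φ) = indUnit hρ φ := by
    rw [act_indUnit]; rfl
  rw [h2] at h
  rw [Submodule.coe_norm, Submodule.coe_norm, norm_eq_sqrt_re_inner (𝕜 := ℂ), h,
    ← norm_eq_sqrt_re_inner]

theorem isCore_orbitSpan_ind (hB : 𝒢.IsCommutativeBase) (hχ : ρ.RestrictsToMultiple χ) :
    (ρ.Ind hρ).IsCore ((ρ.Ind hρ).orbitSpan χ) := by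
  refine (isCore_ind hρ).mono ?_
  rintro _ ⟨ξ, rfl⟩
  induction ξ with
  | zero => simp
  | add ξ ξ' h h' => rw [_root_.map_add]; exact Submodule.add_mem _ h h'
  | tmul a φ =>
    rw [← act_indUnit]
    exact act_mem_orbitSpan hB (indUnit_mem_weightSpace hρ hχ φ) a

/-- The weight space of `χ` in the induced representation is the copy `[1 ⊗ D(ρ)]` of `D(ρ)`: it is
orthogonal to `[a ⊗ D(ρ)]` for homogeneous `a` whose degree does not stabilize `χ`. -/
theorem exists_indUnit_eq [CompleteSpace H] (hB : 𝒢.IsCommutativeBase)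
    (hχ : ρ.RestrictsToMultiple χ) (hd : ρ.dom = ⊤) {v : (ρ.Ind hρ).dom}
    (hv : v ∈ (ρ.Ind hρ).weightSpace χ) : ∃ φ, indUnit hρ φ = v := by
  have : CompleteSpace ρ.dom :=
    (hd ▸ isClosed_univ : IsClosed (ρ.dom : Set H)).completeSpace_coe
  let V : ρ.dom →ₗᵢ[ℂ] IndSpace ρ hρ :=
    { toLinearMap := (ρ.Ind hρ).dom.subtype ∘ₗ indUnit hρ
      norm_map' := norm_indUnit hρ hχ }
  let R : Submodule ℂ (IndSpace ρ hρ) := LinearMap.range V.toLinearMap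
  have : CompleteSpace R := by
    have h1 : IsClosed (Set.range V) := V.isometry.isClosedEmbedding.isClosed_range
    exact (show IsClosed (R : Set (IndSpace ρ hρ)) from h1).completeSpace_coe
  obtain ⟨φ, hφ⟩ := R.starProjection_apply_mem (v : IndSpace ρ hρ)
  refine ⟨φ, ?_⟩
  have hw : v - indUnit hρ φ ∈ (ρ.Ind hρ).weightSpace χ :=
    Submodule.sub_mem _ hv (indUnit_mem_weightSpace hρ hχ φ)
  have horth (ψ : ρ.dom) :
      ⟪(indUnit hρ ψ : IndSpace ρ hρ), ((v - indUnit hρ φ : (ρ.Ind hρ).dom) : IndSpace ρ hρ)⟫_ℂ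
        = 0 := by
    have h2 := R.sub_starProjection_mem_orthogonal (v : IndSpace ρ hρ)
    rw [← hφ] at h2
    exact (Submodule.mem_orthogonal _ _).1 h2 _ ⟨ψ, rfl⟩
  refine (sub_eq_zero.1 (Subtype.ext ((isCore_ind hρ).eq_zero ?_))).symm
  rintro _ ⟨ξ, rfl⟩
  induction ξ with
  | zero => simp
  | add ξ ξ' h h' => rw [_root_.map_add, Submodule.coe_add, inner_add_left, h, h', add_zero]
  | tmul a ψ =>
    induction a using 𝒢.induction_on with
    | zero => simp
    | add a b ha hb =>
      rw [TensorProduct.add_tmul, _root_.map_add, Submodule.coe_add, inner_add_left, ha, hb,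
        add_zero]
    | mem g a ha =>
      by_cases hg : g ∈ stabilizer χ
      · have h3 := act_coe_indUnit hρ ⟨a, 𝒢.piece_le_span hg ha⟩ ψ
        rw [act_indUnit] at h3
        rw [h3]
        exact horth _
      · rw [← act_indUnit]
        rcases act_weight_dichotomy hB (indUnit_mem_weightSpace hρ hχ ψ) (⟨a, ha⟩ : 𝒢.piece g)
          with h | ⟨θ, hθ, h⟩
        · rw [show (ρ.Ind hρ).act a (indUnit hρ ψ) = 0 from h]; simp
        · refine inner_weight_eq_zero h hw ?_
          rintro rfl
          exact hg hθ

/-- A closed representation of `A_H` that restricts to a multiple of `χ` can be recovered from the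
induced representation, as its weight space for `χ`. -/
theorem UnitarilyEquivalent.of_ind [CompleteSpace H] {H' : Type*} [NormedAddCommGroup H']
    [InnerProductSpace ℂ H'] [CompleteSpace H'] {ρ' : StarRep (𝒢.sub (stabilizer χ)) H'}
    (hρ' : ρ'.Inducible) (hB : 𝒢.IsCommutativeBase) (hχ : ρ.RestrictsToMultiple χ)
    (hχ' : ρ'.RestrictsToMultiple χ) (hd : ρ.dom = ⊤) (hd' : ρ'.dom = ⊤)
    (h : (ρ.Ind hρ).UnitarilyEquivalent (ρ'.Ind hρ')) : ρ.UnitarilyEquivalent ρ' := by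
  obtain ⟨U, hU⟩ := h
  have hw {v : (ρ.Ind hρ).dom} (hv : v ∈ (ρ.Ind hρ).weightSpace χ) :
      U v ∈ (ρ'.Ind hρ').weightSpace χ := fun b => by rw [← hU, hv b, _root_.map_smul]
  have hw' {v : (ρ'.Ind hρ').dom} (hv : v ∈ (ρ'.Ind hρ').weightSpace χ) :
      U.symm v ∈ (ρ.Ind hρ).weightSpace χ := fun b =>
    U.injective (by rw [hU, _root_.map_smul, U.apply_symm_apply, hv b])
  let j : ρ.dom →ₗᵢ[ℂ] (ρ.Ind hρ).dom := ⟨indUnit hρ, norm_indUnit hρ hχ⟩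
  let j' : ρ'.dom →ₗᵢ[ℂ] (ρ'.Ind hρ').dom := ⟨indUnit hρ', norm_indUnit hρ' hχ'⟩
  have ex (φ : ρ.dom) : ∃ ψ, j' ψ = U (j φ) :=
    exists_indUnit_eq hρ' hB hχ' hd' (hw (indUnit_mem_weightSpace hρ hχ φ))
  choose k hk using ex
  let W : ρ.dom →ₗᵢ[ℂ] ρ'.dom :=
    { toFun := k
      map_add' := fun φ ψ => j'.injective (by simp [hk])
      map_smul' := fun c φ => j'.injective (by simp [hk])
      norm_map' := fun φ => by
        have := congrArg norm (hk φ)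
        rw [j'.norm_map, U.norm_map, j.norm_map] at this
        exact this }
  have hW : Function.Surjective W := by
    intro ψ
    obtain ⟨φ, hφ⟩ := exists_indUnit_eq hρ hB hχ hd (hw' (indUnit_mem_weightSpace hρ' hχ' ψ))
    refine ⟨φ, j'.injective ((hk φ).trans ?_)⟩
    exact (congrArg U hφ).trans (U.apply_symm_apply _)
  refine ⟨LinearIsometryEquiv.ofSurjective W hW, fun x φ => j'.injective ((hk _).trans ?_)⟩
  have h1 : j (ρ.act x φ) = (ρ.Ind hρ).act x (j φ) := (act_coe_indUnit hρ x φ).symm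
  have h2 : j' (ρ'.act x (k φ)) = (ρ'.Ind hρ').act x (j' (k φ)) :=
    (act_coe_indUnit hρ' x (k φ)).symm
  rw [h1, hU]
  refine Eq.trans ?_ h2.symm
  rw [hk]

end Weights

end StarRep

namespace StarRep

open StarGrading

variable {G : Type*} [Group G] {A : Type*} [Ring A] [StarRing A] [Algebra ℂ A] [StarModule ℂ A]
  {𝒢 : StarGrading G A} {H : Type*} [NormedAddCommGroup H] [InnerProductSpace ℂ H]

/-! ### Projections onto sums of weight spaces -/

/-- The weight space of `ψ` as a subspace of the Hilbert space. -/
def weightSub (π : StarRep A H) (ψ : 𝒢.PosChar) : Submodule ℂ H :=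
  (π.weightSpace ψ).map π.dom.subtype

theorem coe_mem_weightSub {π : StarRep A H} {ψ : 𝒢.PosChar} {v : π.dom} :
    (v : H) ∈ π.weightSub ψ ↔ v ∈ π.weightSpace ψ := by
  constructor
  · rintro ⟨w, hw, h⟩
    rwa [← Subtype.ext h]
  · intro h; exact ⟨v, h, rfl⟩

/-- The closed span of the weight spaces for the points of the orbit of `χ` in `Δ`. -/
def orbitSub (π : StarRep A H) (χ : 𝒢.PosChar) (Δ : Set 𝒢.PosChar) : Submodule ℂ H :=
  (⨆ θ ∈ Δ ∩ orbit χ, π.weightSub θ).topologicalClosure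

variable {π : StarRep A H} {χ θ : 𝒢.PosChar} {Δ : Set 𝒢.PosChar}

theorem orbitSpan_induction {P : π.dom → Prop}
    (weight : ∀ θ ∈ orbit χ, ∀ v ∈ π.weightSpace θ, P v) (add : ∀ v w, P v → P w → P (v + w))
    {v : π.dom} (hv : v ∈ π.orbitSpan χ) : P v := by
  refine Submodule.iSup_induction _ (motive := P) hv (fun θ v hv => weight θ θ.2 v hv) ?_ add
  exact weight χ (self_mem_orbit χ) 0 (Submodule.zero_mem _)

/-- If the weight spaces along the orbit span a core, continuous operators are
determined by their values on the weight spaces. -/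
theorem ext_of_weight (hcore : π.IsCore (π.orbitSpan χ)) {F : Type*}
    [NormedAddCommGroup F] [NormedSpace ℂ F] {S T : H →L[ℂ] F}
    (h : ∀ θ ∈ orbit χ, ∀ v ∈ π.weightSub θ, S v = T v) : S = T := by
  refine ContinuousLinearMap.ext fun x => ?_
  have h1 : Set.EqOn S T ((fun φ : π.dom => (φ : H)) '' (π.orbitSpan χ)) := by
    rintro _ ⟨φ, hφ, rfl⟩
    refine orbitSpan_induction (P := fun φ => S φ = T φ)
      (fun θ hθ v hv => h θ hθ v ⟨v, hv, rfl⟩) (fun v w hv hw => ?_) hφ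
    rw [Submodule.coe_add, map_add, map_add, hv, hw]
  exact congrFun (Continuous.ext_on hcore.dense S.continuous T.continuous h1) x

variable [CompleteSpace H]

instance (π : StarRep A H) (χ : 𝒢.PosChar) (Δ : Set 𝒢.PosChar) :
    (π.orbitSub χ Δ).HasOrthogonalProjection :=
  inferInstanceAs (⨆ θ ∈ Δ ∩ orbit χ, π.weightSub θ).topologicalClosure.HasOrthogonalProjection

/-- The orthogonal projection onto `orbitSub π χ Δ`. -/
def orbitProj (π : StarRep A H) (χ : 𝒢.PosChar) (Δ : Set 𝒢.PosChar) : H →L[ℂ] H :=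
  (π.orbitSub χ Δ).starProjection

theorem isStarProjection_orbitProj : IsStarProjection (π.orbitProj χ Δ) :=
  isStarProjection_starProjection

theorem norm_orbitProj_le (x : H) : ‖π.orbitProj χ Δ x‖ ≤ ‖x‖ :=
  Submodule.norm_starProjection_apply_le _ _

theorem inner_orbitProj (x y : H) : ⟪π.orbitProj χ Δ x, y⟫_ℂ = ⟪x, π.orbitProj χ Δ y⟫_ℂ :=
  Submodule.inner_starProjection_left_eq_right _ _ _

theorem orbitProj_of_mem (hθ : θ ∈ orbit χ) (hΔ : θ ∈ Δ) {v : H} (hv : v ∈ π.weightSub θ) :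
    π.orbitProj χ Δ v = v :=
  Submodule.starProjection_eq_self_iff.2 (Submodule.le_topologicalClosure _
    (Submodule.mem_iSup_of_mem θ (Submodule.mem_iSup_of_mem ⟨hΔ, hθ⟩ hv)))

theorem orbitProj_of_notMem (hΔ : θ ∉ Δ) {v : H} (hv : v ∈ π.weightSub θ) :
    π.orbitProj χ Δ v = 0 := by
  refine (Submodule.starProjection_apply_eq_zero_iff _).2 ?_
  have h1 : π.orbitSub χ Δ ≤ (ℂ ∙ v)ᗮ := by
    refine Submodule.topologicalClosure_minimal _ (iSup₂_le fun θ' hθ' w hw => ?_)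
      (Submodule.isClosed_orthogonal _)
    rw [Submodule.mem_orthogonal_singleton_iff_inner_right]
    obtain ⟨v, hv, rfl⟩ := hv
    obtain ⟨w, hw, rfl⟩ := hw
    refine inner_weight_eq_zero hv hw ?_
    rintro rfl
    exact hΔ hθ'.1
  exact (Submodule.mem_orthogonal _ _).2 fun u hu =>
    Submodule.mem_orthogonal_singleton_iff_inner_left.1 (h1 hu)

theorem orbitProj_orbit_eq_one (hcore : π.IsCore (π.orbitSpan χ))
    (h : orbit χ ⊆ Δ) : π.orbitProj χ Δ = 1 :=
  ext_of_weight hcore fun _ hθ _ hv => orbitProj_of_mem hθ (h hθ) hv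

/-- Strong additivity of the projections. The partial sums are contractions that are eventually
constant on each vector of the span of the weight spaces. -/
theorem hasSum_orbitProj (hcore : π.IsCore (π.orbitSpan χ))
    {ι : Type*} {Δ : ι → Set 𝒢.PosChar}
    (hΔ : Pairwise (Function.onFun Disjoint Δ)) (x : H) :
    HasSum (fun i => π.orbitProj χ (Δ i) x) (π.orbitProj χ (⋃ i, Δ i) x) := by
  classical
  have hfin (s : Finset ι) :
      ∑ i ∈ s, π.orbitProj χ (Δ i) = π.orbitProj χ (⋃ i ∈ s, Δ i) := by
    refine ext_of_weight hcore fun θ hθ v hv => ?_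
    rw [sum_apply]
    by_cases h : ∃ i ∈ s, θ ∈ Δ i
    · obtain ⟨i, hi, hθi⟩ := h
      rw [Finset.sum_eq_single_of_mem i hi, orbitProj_of_mem hθ hθi hv,
        orbitProj_of_mem hθ (Set.mem_iUnion₂_of_mem hi hθi) hv]
      intro k _ hk
      exact orbitProj_of_notMem (fun hθk => (Set.disjoint_left.1 (hΔ hk)) hθk hθi) hv
    · rw [Finset.sum_eq_zero, orbitProj_of_notMem (by simpa using h) hv]
      exact fun i hi => orbitProj_of_notMem (fun hθi => h ⟨i, hi, hθi⟩) hv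
  have hD (y : π.dom) (hy : y ∈ π.orbitSpan χ) : ∀ᶠ s : Finset ι in atTop,
      π.orbitProj χ (⋃ i ∈ s, Δ i) y = π.orbitProj χ (⋃ i, Δ i) y := by
    refine orbitSpan_induction (P := fun y => ∀ᶠ s : Finset ι in atTop,
      π.orbitProj χ (⋃ i ∈ s, Δ i) y = π.orbitProj χ (⋃ i, Δ i) y)
      (fun θ hθ v hv => ?_) (fun v w hv hw => ?_) hy
    · have hv' : (v : H) ∈ π.weightSub θ := ⟨v, hv, rfl⟩
      by_cases h : ∃ i, θ ∈ Δ i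
      · obtain ⟨i, hi⟩ := h
        filter_upwards [eventually_ge_atTop ({i} : Finset ι)] with s hs
        rw [orbitProj_of_mem hθ (Set.mem_iUnion₂_of_mem (hs (Finset.mem_singleton_self i)) hi) hv',
          orbitProj_of_mem hθ (Set.mem_iUnion_of_mem i hi) hv']
      · refine Eventually.of_forall fun s => ?_
        have h' : ∀ i, θ ∉ Δ i := fun i hi => h ⟨i, hi⟩
        rw [orbitProj_of_notMem (by simp [h']) hv', orbitProj_of_notMem (by simp [h']) hv']
    · filter_upwards [hv, hw] with s h1 h2
      rw [Submodule.coe_add, map_add, map_add, h1, h2]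
  rw [HasSum, Metric.tendsto_nhds]
  intro ε hε
  obtain ⟨_, hxy, ⟨y, hy, rfl⟩⟩ := Metric.dense_iff.1 hcore.dense x (ε / 2) (by positivity)
  rw [Metric.mem_ball, dist_comm, dist_eq_norm] at hxy
  filter_upwards [hD y hy] with s hs
  have h1 : ∑ i ∈ s, π.orbitProj χ (Δ i) x = π.orbitProj χ (⋃ i ∈ s, Δ i) x := by
    rw [← hfin, sum_apply]
  have h2 : π.orbitProj χ (⋃ i ∈ s, Δ i) x - π.orbitProj χ (⋃ i, Δ i) x =
      π.orbitProj χ (⋃ i ∈ s, Δ i) (x - y) - π.orbitProj χ (⋃ i, Δ i) (x - y) := by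
    rw [map_sub, map_sub, hs]; abel
  change dist (∑ i ∈ s, π.orbitProj χ (Δ i) x) _ < ε
  rw [h1, dist_eq_norm, h2]
  calc _ ≤ ‖x - y‖ + ‖x - y‖ :=
        (norm_sub_le _ _).trans (add_le_add (norm_orbitProj_le _) (norm_orbitProj_le _))
    _ < ε := by linarith

theorem hasSum_orbitProj_singleton (hcore : π.IsCore (π.orbitSpan χ))
    (x : H) :
    HasSum (fun θ : orbit χ => π.orbitProj χ {(θ : 𝒢.PosChar)} x) x := by
  have h := hasSum_orbitProj hcore (Δ := fun θ : orbit χ => {(θ : 𝒢.PosChar)})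
    (fun θ θ' h => Set.disjoint_singleton.2 fun h' => h (Subtype.ext h')) x
  rw [orbitProj_orbit_eq_one hcore (by intro θ hθ; simpa using hθ)] at h
  exact h

theorem orbitProj_singleton_mem (hπ : π.IsClosedRep) (x : H) :
    π.orbitProj χ {θ} x ∈ π.weightSub θ := by
  have h : π.orbitSub χ {θ} ≤ π.weightSub θ :=
    Submodule.topologicalClosure_minimal _
      (iSup₂_le fun θ' hθ' => by rw [hθ'.1])
      (isClosed_weightSpace hπ θ)
  exact h (Submodule.starProjection_apply_mem _ _)

/-- The component at `θ` of a vector is determined by its inner products with weight vectors. -/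
theorem orbitProj_singleton_eq_smul (hπ : π.IsClosedRep) (hθ : θ ∈ orbit χ) {x y : H} {c : ℂ}
    (h : ∀ v ∈ π.weightSpace θ, ⟪(v : H), y⟫_ℂ = c * ⟪(v : H), x⟫_ℂ) :
    π.orbitProj χ {θ} y = c • π.orbitProj χ {θ} x := by
  obtain ⟨v, hv, hvx⟩ : π.orbitProj χ {θ} (y - c • x) ∈ π.weightSub θ :=
    orbitProj_singleton_mem hπ _
  have h0 : ⟪(v : H), y - c • x⟫_ℂ = 0 := by
    rw [inner_sub_right, inner_smul_right, h v hv, sub_self]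
  rw [← sub_eq_zero, ← map_smul, ← map_sub, ← inner_self_eq_zero (𝕜 := ℂ), ← inner_orbitProj,
    orbitProj_of_mem hθ (Set.mem_singleton θ) (orbitProj_singleton_mem hπ _), ← hvx]
  exact h0

end StarRep

/-! ### Spectral measures with countable support -/

namespace SpectralMeasure

open MeasureTheory

variable {X : Type*} [MeasurableSpace X]
  {H : Type*} [NormedAddCommGroup H] [InnerProductSpace ℂ H] [CompleteSpace H]
  (E : SpectralMeasure X H)

theorem measure_apply {Δ : Set X} (hΔ : MeasurableSet Δ) (x : H) :
    E.measure x Δ = ENNReal.ofReal (‖E.proj Δ x‖ ^ 2) :=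
  Measure.ofMeasurable_apply Δ hΔ

instance (x : H) : IsFiniteMeasure (E.measure x) :=
  ⟨by rw [E.measure_apply MeasurableSet.univ]; exact ENNReal.ofReal_lt_top⟩

theorem measure_real_apply {Δ : Set X} (hΔ : MeasurableSet Δ) (x : H) :
    (E.measure x).real Δ = ‖E.proj Δ x‖ ^ 2 := by
  rw [measureReal_def, E.measure_apply hΔ, ENNReal.toReal_ofReal (sq_nonneg _)]

theorem proj_proj_self {Δ : Set X} (hΔ : MeasurableSet Δ) (x : H) :
    E.proj Δ (E.proj Δ x) = E.proj Δ x :=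
  DFunLike.congr_fun (E.isStarProjection hΔ).isIdempotentElem.eq x

/-- On the range of `E(Δ)` the scalar spectral measure lives on `Δ`. -/
theorem measure_compl_eq_zero {Δ : Set X} (hΔ : MeasurableSet Δ) {x : H} (hx : E.proj Δ x = x) :
    E.measure x Δᶜ = 0 := by
  rw [measure_compl hΔ (measure_ne_top _ _), E.measure_apply MeasurableSet.univ, E.measure_apply hΔ,
    hx, E.proj_univ]
  simp

theorem proj_eq_self {Δ : Set X} (hΔ : MeasurableSet Δ) (h : E.proj Δᶜ = 0) (x : H) :
    E.proj Δ x = x := by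
  have h1 := measure_add_measure_compl (μ := E.measure (E.proj Δ x - x)) hΔ
  rw [E.measure_apply hΔ, E.measure_apply hΔ.compl, E.measure_apply MeasurableSet.univ, h,
    E.proj_univ, map_sub, E.proj_proj_self hΔ] at h1
  simpa [sub_eq_zero] using h1.symm

variable {E}

theorem integrable_of_lintegral_sq {x : H} {f : X → ℂ}
    (hm : AEStronglyMeasurable f (E.measure x))
    (hf : ∫⁻ t, ‖f t‖ₑ ^ 2 ∂(E.measure x) < ⊤) : Integrable f (E.measure x) := by
  refine MemLp.integrable (q := 2) (by norm_num) ⟨hm, ?_⟩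
  rw [eLpNorm_lt_top_iff_lintegral_rpow_enorm_lt_top (by norm_num) (by norm_num)]
  simpa using hf

variable [MeasurableSingletonClass X] {S : Set X}

theorem lintegral_eq_tsum (hS : S.Countable) (hE : E.proj Sᶜ = 0) (x : H) (f : X → ℝ≥0∞) :
    ∫⁻ t, f t ∂(E.measure x) = ∑' t : S, f t * ENNReal.ofReal (‖E.proj {(t : X)} x‖ ^ 2) := by
  have h0 : E.measure x Sᶜ = 0 := by rw [E.measure_apply hS.measurableSet.compl, hE]; simp
  rw [← Measure.restrict_eq_self_of_ae_mem (s := S) (μ := E.measure x)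
    (mem_ae_iff.2 h0 : _), lintegral_countable _ hS]
  simp_rw [E.measure_apply (measurableSet_singleton _)]

theorem integral_eq_tsum (hS : S.Countable) (hE : E.proj Sᶜ = 0) (x : H) {f : X → ℂ}
    (hf : Integrable f (E.measure x)) :
    ∫ t, f t ∂(E.measure x) = ∑' t : S, f t * (‖E.proj {(t : X)} x‖ ^ 2 : ℂ) := by
  have h0 : E.measure x Sᶜ = 0 := by rw [E.measure_apply hS.measurableSet.compl, hE]; simp
  have h1 := Measure.restrict_eq_self_of_ae_mem (s := S) (μ := E.measure x)
    (mem_ae_iff.2 h0 : _)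
  calc ∫ t, f t ∂(E.measure x) = ∫ t in S, f t ∂(E.measure x) := by rw [h1]
    _ = _ := by
      rw [setIntegral_countable f hS hf.integrableOn]
      refine tsum_congr fun t => ?_
      rw [E.measure_real_apply (measurableSet_singleton _), Complex.real_smul, mul_comm]
      push_cast; rfl

end SpectralMeasure

/-! ### Representations spanned by weight spaces are well-behaved -/

namespace StarRep

open StarGrading

section Graph

variable {A : Type*} [Ring A] [StarRing A] [Algebra ℂ A]
  {H : Type*} [NormedAddCommGroup H] [InnerProductSpace ℂ H]

theorem mem_graph_opr {π : StarRep A H} {a : A} {p : H × H} :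
    p ∈ (π.opr a).graph ↔ ∃ φ : π.dom, ((φ : H), (π.act a φ : H)) = p := by
  rw [LinearPMap.mem_graph_iff]
  constructor
  · rintro ⟨φ, h1, h2⟩; exact ⟨φ, Prod.ext h1 h2⟩
  · rintro ⟨φ, rfl⟩; exact ⟨φ, rfl, rfl⟩

variable [CompleteSpace H]

theorem isClosable_opr (π : StarRep A H) (a : A) : (π.opr a).IsClosable := by
  have h : (π.opr a).IsFormalAdjoint (π.opr (star a)) := fun x y => by
    exact π.inner_act a x y
  have h1 : π.opr a ≤ (π.opr (star a)).adjoint :=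
    LinearPMap.IsFormalAdjoint.le_adjoint π.dense_dom h.symm
  exact (LinearPMap.adjoint_isClosed π.dense_dom).isClosable.leIsClosable h1

theorem mem_graph_closure_opr {π : StarRep A H} {a : A} {p : H × H} :
    p ∈ (π.opr a).closure.graph ↔ p ∈ _root_.closure ((π.opr a).graph : Set (H × H)) := by
  rw [← (π.isClosable_opr a).graph_closure_eq_closure_graph]
  rfl

theorem mem_graph_adjoint_opr {π : StarRep A H} {a : A} {p : H × H} :
    p ∈ (π.opr a).adjoint.graph ↔ ∀ φ : π.dom, ⟪p.2, (φ : H)⟫_ℂ = ⟪p.1, (π.act a φ : H)⟫_ℂ := by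
  rw [LinearPMap.mem_graph_iff]
  constructor
  · rintro ⟨y, h1, h2⟩ φ
    rw [← h1, ← h2]
    exact LinearPMap.adjoint_isFormalAdjoint (T := π.opr a) π.dense_dom y φ
  · intro h
    have hd := LinearPMap.mem_adjoint_domain_of_exists (T := π.opr a) p.1 ⟨p.2, h⟩
    exact ⟨⟨p.1, hd⟩, rfl, LinearPMap.adjoint_apply_eq π.dense_dom _ h⟩

end Graph

variable {G : Type*} [Group G] {A : Type*} [Ring A] [StarRing A] [Algebra ℂ A] [StarModule ℂ A]
  {𝒢 : StarGrading G A} {H : Type*} [NormedAddCommGroup H] [InnerProductSpace ℂ H]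
  {π : StarRep A H} {χ : 𝒢.PosChar}

theorem act_mem_weightSub_or (hB : 𝒢.IsCommutativeBase) {θ : 𝒢.PosChar} {v : π.dom}
    (hv : v ∈ π.weightSpace θ) {g : G} {a : A} (ha : a ∈ 𝒢.piece g) :
    π.act a v = 0 ∨ ∃ θ', ActsTo g θ θ' ∧ (π.act a v : H) ∈ π.weightSub θ' := by
  rcases act_weight_dichotomy hB hv (⟨a, ha⟩ : 𝒢.piece g) with h | ⟨θ', hθ', h⟩
  · exact Or.inl h
  · exact Or.inr ⟨θ', hθ', coe_mem_weightSub.2 h⟩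

variable [CompleteSpace H]

/-- The graph of the closure of `π(b)` consists of the pairs whose components at each point `θ` of
the orbit are related by the factor `θ(b)`. -/
theorem mem_graph_closure_opr_iff (hπ : π.IsClosedRep) (hcore : π.IsCore (π.orbitSpan χ))
    (b : 𝒢.base) {p : H × H} : p ∈ (π.opr b).closure.graph ↔
      ∀ θ ∈ orbit χ, π.orbitProj χ {θ} p.2 = θ b • π.orbitProj χ {θ} p.1 := by
  rw [mem_graph_closure_opr]
  constructor
  · intro hp θ hθ
    have hc : IsClosed {p : H × H | π.orbitProj χ {θ} p.2 = θ b • π.orbitProj χ {θ} p.1} :=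
      isClosed_eq ((π.orbitProj χ {θ}).continuous.comp continuous_snd)
        (((π.orbitProj χ {θ}).continuous.comp continuous_fst).const_smul _)
    refine closure_minimal ?_ hc hp
    intro q hq
    obtain ⟨φ, rfl⟩ := mem_graph_opr.1 hq
    refine orbitProj_singleton_eq_smul hπ hθ fun v hv => ?_
    have h2 := hv (star b)
    rw [StarMemClass.coe_star] at h2
    rw [inner_act_right, h2, Submodule.coe_smul, inner_smul_left, θ.map_star]
    simp
  · intro hp
    choose k hk hk' using fun θ : orbit χ =>
      (orbitProj_singleton_mem hπ p.1 : π.orbitProj χ {(θ : 𝒢.PosChar)} p.1 ∈ π.weightSub _)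
    have h1 := hasSum_orbitProj_singleton hcore p.1
    have h2 := hasSum_orbitProj_singleton hcore p.2
    refine mem_closure_of_tendsto (Tendsto.prodMk_nhds h1 h2) (Eventually.of_forall fun s => ?_)
    refine mem_graph_opr.2 ⟨∑ θ ∈ s, k θ, Prod.ext ?_ ?_⟩
    · exact (Submodule.coe_sum _ _ _).trans (Finset.sum_congr rfl fun θ _ => hk' θ)
    · rw [_root_.map_sum]
      refine (Submodule.coe_sum _ _ _).trans (Finset.sum_congr rfl fun θ _ => ?_)
      rw [hk θ b]
      exact (congrArg ((θ : 𝒢.PosChar) b • ·) (hk' θ)).trans (hp θ θ.2).symm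

/-- The adjoint of `π(b)` is the closure of `π(b^*)`. -/
theorem closure_opr_star_eq_adjoint (hπ : π.IsClosedRep) (hcore : π.IsCore (π.orbitSpan χ))
    (b : 𝒢.base) : (π.opr (star b : 𝒢.base)).closure = (π.opr b).adjoint := by
  refine LinearPMap.eq_of_eq_graph (SetLike.ext fun p => ?_)
  rw [mem_graph_adjoint_opr]
  constructor
  · intro hp φ
    rw [mem_graph_closure_opr] at hp
    have hc : IsClosed {p : H × H | ⟪p.2, (φ : H)⟫_ℂ = ⟪p.1, (π.act b φ : H)⟫_ℂ} :=
      isClosed_eq (continuous_snd.inner continuous_const) (continuous_fst.inner continuous_const)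
    refine closure_minimal ?_ hc hp
    intro q hq
    obtain ⟨ψ, rfl⟩ := mem_graph_opr.1 hq
    exact (π.inner_act_right b ψ φ).symm
  · intro hp
    refine (mem_graph_closure_opr_iff hπ hcore (star b)).2 fun θ hθ => ?_
    refine orbitProj_singleton_eq_smul hπ hθ fun v hv => ?_
    have h := hp v
    rw [hv b, Submodule.coe_smul, inner_smul_right] at h
    rw [← inner_conj_symm, h, map_mul, inner_conj_symm, θ.map_star]
    rfl

/-- The restriction of a closed representation of `A` to `B` is closed. -/
theorem IsClosedRep.res_base (hπ : π.IsClosedRep) : (π.res 𝒢.base.subtype).IsClosedRep := by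
  refine isClosed_of_closure_subset fun p hp => ?_
  have hcl := mem_closure_iff_clusterPt.1 hp
  let g : π.dom → H × (𝒢.base → H) := (π.res 𝒢.base.subtype).graphMap
  let l : Filter π.dom := comap g (𝓝 p)
  have hne : l.NeBot := by
    refine comap_neBot fun t ht => ?_
    obtain ⟨_, hx, ⟨φ, rfl⟩⟩ := (clusterPt_principal_iff.1 hcl) t ht
    exact ⟨φ, hx⟩
  have t0 : Tendsto g l (𝓝 p) := tendsto_comap
  have t1 : Tendsto (fun φ : π.dom => (φ : H)) l (𝓝 p.1) := (continuous_fst.tendsto p).comp t0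
  have t2 (b : 𝒢.base) : Tendsto (fun φ : π.dom => (π.act b φ : H)) l (𝓝 (p.2 b)) :=
    ((continuous_eval b).tendsto p).comp t0
  obtain ⟨hx, hxa⟩ := hπ.exists_of_tendsto (f := id) t1
    (exists_tendsto_of_base t1 fun b => ⟨_, t2 b⟩)
  exact ⟨⟨p.1, hx⟩, Prod.ext rfl (funext fun b => tendsto_nhds_unique (hxa b) (t2 b))⟩

/-- The spectral measure `Δ ↦` projection onto the closed span of the weight spaces for the points
of `Δ` in the orbit. -/
def orbitSpectralMeasure (hcore : π.IsCore (π.orbitSpan χ)) : SpectralMeasure 𝒢.PosChar H where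
  proj Δ := π.orbitProj χ Δ
  isStarProjection _ := isStarProjection_orbitProj
  proj_univ := orbitProj_orbit_eq_one hcore (Set.subset_univ _)
  hasSum_iUnion _ hd x := hasSum_orbitProj hcore hd x

theorem orbitProj_compl_orbit (hcore : π.IsCore (π.orbitSpan χ)) :
    π.orbitProj χ (orbit χ)ᶜ = 0 :=
  ext_of_weight hcore fun _ hθ _ hv => orbitProj_of_notMem (Set.notMem_compl_iff.2 hθ) hv

/-- Covariance of the projections: `E(Δ^g) π(a) ⊆ π(a) E(Δ)` for `a ∈ A_g`. It is checked on weight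
vectors and extends along the graph topology. -/
theorem orbitProj_covariant (hB : 𝒢.IsCommutativeBase) (hπ : π.IsClosedRep)
    (hcore : π.IsCore (π.orbitSpan χ)) (Δ : Set 𝒢.PosChar) (x : π.dom) :
    ∃ h : π.orbitProj χ Δ x ∈ π.dom, ∀ g, ∀ a ∈ 𝒢.piece g,
      π.orbitProj χ (translate g Δ) (π.act a x) = π.act a ⟨π.orbitProj χ Δ x, h⟩ := by
  have hD (y : π.dom) (hy : y ∈ (π.orbitSpan χ : Set π.dom)) : ∃ y' : π.dom,
      (y' : H) = π.orbitProj χ Δ y ∧ ∀ g, ∀ a ∈ 𝒢.piece g,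
        π.orbitProj χ (translate g Δ) (π.act a y) = π.act a y' := by
    refine orbitSpan_induction (P := fun y => ∃ y' : π.dom,
      (y' : H) = π.orbitProj χ Δ y ∧ ∀ g, ∀ a ∈ 𝒢.piece g,
        π.orbitProj χ (translate g Δ) (π.act a y) = π.act a y')
      (fun θ hθ v hv => ?_) ?_ hy
    · by_cases h : θ ∈ Δ
      · refine ⟨v, (orbitProj_of_mem hθ h (coe_mem_weightSub.2 hv)).symm, fun g a ha => ?_⟩
        rcases act_mem_weightSub_or hB hv ha with h0 | ⟨θ', hθ', h'⟩
        · rw [h0]; simp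
        · have hm : θ' ∈ translate g Δ := ⟨θ, h, hθ'⟩
          exact orbitProj_of_mem (mem_orbit_of_actsTo hθ hθ') hm h'
      · refine ⟨0, (orbitProj_of_notMem h (coe_mem_weightSub.2 hv)).symm, fun g a ha => ?_⟩
        rw [map_zero]
        rcases act_mem_weightSub_or hB hv ha with h0 | ⟨θ', hθ', h'⟩
        · rw [h0]; simp
        · refine orbitProj_of_notMem ?_ h'
          rintro ⟨θ'', hm, hact⟩
          exact h (hact.injective hB hθ' ▸ hm)
    · rintro y z ⟨y', h1, h2⟩ ⟨z', h3, h4⟩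
      refine ⟨y' + z', by rw [Submodule.coe_add, Submodule.coe_add, map_add, h1, h3],
        fun g a ha => ?_⟩
      rw [map_add, map_add, Submodule.coe_add, Submodule.coe_add, map_add, h2 g a ha, h4 g a ha]
  choose! k hk hka using hD
  obtain ⟨l, _, hl, hlx, hla⟩ := hcore.exists_filter x
  have t1 : Tendsto (fun y => (k y : H)) l (𝓝 (π.orbitProj χ Δ x)) :=
    (((π.orbitProj χ Δ).continuous.tendsto _).comp hlx).congr'
      (mem_of_superset hl fun y hy => (hk y hy).symm)
  have t2 (g) (a) (ha : a ∈ 𝒢.piece g) : Tendsto (fun y => (π.act a (k y) : H)) l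
      (𝓝 (π.orbitProj χ (translate g Δ) (π.act a x))) :=
    (((π.orbitProj χ (translate g Δ)).continuous.tendsto _).comp (hla a)).congr'
      (mem_of_superset hl fun y hy => hka y hy g a ha)
  obtain ⟨h, ha⟩ := hπ.exists_of_tendsto t1
    (exists_tendsto_of_homogeneous 𝒢 π fun g a ha => ⟨_, t2 g a ha⟩)
  exact ⟨h, fun g a hga => tendsto_nhds_unique (t2 g a hga) (ha a)⟩

theorem continuous_eval_posChar (b : 𝒢.base) : Continuous fun θ : 𝒢.PosChar => θ b :=
  (continuous_apply b).comp continuous_induced_dom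

/-- The closure of `π(b)` is `∫ θ(b) dE(θ)`. As `E` lives on the countable orbit, the integrals are
sums, and a vector lies in the domain if and only if the orthogonal series `∑ θ(b) E({θ}) x`
converges. -/
theorem isSpectralIntegral_orbitSpectralMeasure [Countable G] (hB : 𝒢.IsCommutativeBase)
    (hπ : π.IsClosedRep) (hcore : π.IsCore (π.orbitSpan χ)) (b : 𝒢.base) :
    (orbitSpectralMeasure hcore).IsSpectralIntegral (fun θ => θ b) (π.opr b).closure := by
  have hS := countable_orbit hB χ
  have hE : (orbitSpectralMeasure hcore).proj (orbit χ)ᶜ = 0 := orbitProj_compl_orbit hcore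
  have hproj (θ : 𝒢.PosChar) (x : H) :
    (orbitSpectralMeasure hcore).proj {θ} x = π.orbitProj χ {θ} x := rfl
  have horth : OrthogonalFamily ℂ (fun θ : orbit χ => π.weightSub (θ : 𝒢.PosChar))
      fun θ => (π.weightSub (θ : 𝒢.PosChar)).subtypeₗᵢ := by
    rintro θ θ' hne ⟨_, v, hv, rfl⟩ ⟨_, w, hw, rfl⟩
    exact inner_weight_eq_zero hv hw fun h => hne (Subtype.ext h)
  have hlin (x : H) : ∫⁻ t, ‖t b‖ₑ ^ 2 ∂((orbitSpectralMeasure hcore).measure x) =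
      ∑' θ : orbit χ, ENNReal.ofReal
        (‖(θ : 𝒢.PosChar) b • π.orbitProj χ {(θ : 𝒢.PosChar)} x‖ ^ 2) := by
    rw [SpectralMeasure.lintegral_eq_tsum hS hE]
    refine tsum_congr fun θ => ?_
    rw [hproj, norm_smul, mul_pow, ENNReal.ofReal_mul (by positivity),
      ENNReal.ofReal_pow (norm_nonneg _),
      ENNReal.ofReal_pow (norm_nonneg _), ofReal_norm, ofReal_norm]
  have hsummable (x : H) : ∫⁻ t, ‖t b‖ₑ ^ 2 ∂((orbitSpectralMeasure hcore).measure x) < ⊤ ↔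
      Summable fun θ : orbit χ => (θ : 𝒢.PosChar) b • π.orbitProj χ {(θ : 𝒢.PosChar)} x := by
    have h1 := horth.summable_iff_norm_sq_summable fun θ =>
      ⟨(θ : 𝒢.PosChar) b • π.orbitProj χ {(θ : 𝒢.PosChar)} x,
        Submodule.smul_mem _ _ (orbitProj_singleton_mem hπ x)⟩
    refine Iff.trans ?_ h1.symm
    rw [hlin, lt_top_iff_ne_top]
    constructor
    · intro h
      have := ENNReal.summable_toReal h
      refine this.congr fun θ => ?_
      rw [ENNReal.toReal_ofReal (sq_nonneg _)]; rfl
    · intro h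
      exact h.tsum_ofReal_ne_top
  refine ⟨fun x => ?_, fun x => ?_⟩
  · rw [hsummable, LinearPMap.mem_domain_iff]
    constructor
    · rintro ⟨y, hy⟩
      have h2 := (mem_graph_closure_opr_iff hπ hcore b).1 hy
      dsimp only at h2
      exact (hasSum_orbitProj_singleton hcore y).summable.congr fun θ => h2 θ θ.2
    · intro h
      refine ⟨∑' θ : orbit χ, (θ : 𝒢.PosChar) b • π.orbitProj χ {(θ : 𝒢.PosChar)} x, ?_⟩
      refine (mem_graph_closure_opr_iff hπ hcore b).2 fun θ hθ => ?_
      have h3 := (π.orbitProj χ {θ}).hasSum h.hasSum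
      refine h3.unique ?_
      convert hasSum_single (⟨θ, hθ⟩ : orbit χ) ?_ using 1
      · dsimp only
        rw [map_smul, orbitProj_of_mem hθ (Set.mem_singleton θ)
          (orbitProj_singleton_mem hπ x)]
      · intro θ' hne
        rw [map_smul, orbitProj_of_notMem (θ := (θ' : 𝒢.PosChar)) _
          (orbitProj_singleton_mem hπ x), smul_zero]
        exact fun h => hne (Subtype.ext h)
  · have hg := (mem_graph_closure_opr_iff hπ hcore b).1 ((π.opr b).closure.mem_graph x)
    dsimp only at hg
    have hsum : Summable fun θ : orbit χ =>
        (θ : 𝒢.PosChar) b • π.orbitProj χ {(θ : 𝒢.PosChar)} (x : H) :=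
      (hasSum_orbitProj_singleton hcore ((π.opr b).closure x)).summable.congr
        fun θ => hg θ θ.2
    have hint := SpectralMeasure.integrable_of_lintegral_sq
      (E := orbitSpectralMeasure hcore) (x := (x : H))
      (continuous_eval_posChar b).aestronglyMeasurable ((hsummable x).2 hsum)
    rw [SpectralMeasure.integral_eq_tsum hS hE _ hint]
    have h4 := (innerSL ℂ (x : H)).hasSum
      (hasSum_orbitProj_singleton hcore ((π.opr b).closure x))
    refine h4.tsum_eq.symm.trans (tsum_congr fun θ => ?_)
    rw [innerSL_apply_apply, hg θ θ.2, inner_smul_right, hproj]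
    congr 1
    rw [← orbitProj_of_mem θ.2 (Set.mem_singleton _) (orbitProj_singleton_mem hπ (x : H)),
      ← inner_orbitProj, inner_self_eq_norm_sq_to_K,
      orbitProj_of_mem θ.2 (Set.mem_singleton _) (orbitProj_singleton_mem hπ (x : H))]
    rfl

/-- A closed representation with a core spanned by the weight spaces along the orbit of `χ` is
well-behaved and associated with that orbit. -/
theorem associatedWithOrbit_of_isCore [Countable G] (hB : 𝒢.IsCommutativeBase)
    (hπ : π.IsClosedRep) (hcore : π.IsCore (π.orbitSpan χ)) : π.AssociatedWithOrbit χ := by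
  refine ⟨orbitSpectralMeasure hcore, ⟨⟨hπ.res_base, fun b => ?_⟩, fun b => ?_, ?_⟩,
    orbitProj_compl_orbit hcore⟩
  · exact closure_opr_star_eq_adjoint hπ hcore b
  · exact isSpectralIntegral_orbitSpectralMeasure hB hπ hcore b
  · intro g a ha Δ _ φ
    obtain ⟨h, h'⟩ := orbitProj_covariant hB hπ hcore Δ φ
    exact ⟨h, h' g a ha⟩

end StarRep

/-! ### Recovering the inducing representation from a well-behaved representation -/

namespace StarRep

open StarGrading

variable {G : Type*} [Group G] {A : Type*} [Ring A] [StarRing A] [Algebra ℂ A] [StarModule ℂ A]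
  {𝒢 : StarGrading G A} {H : Type*} [NormedAddCommGroup H] [InnerProductSpace ℂ H]
  {π : StarRep A H} {χ : 𝒢.PosChar}

/-- A representation of `A` whose restriction to `B` is closed is itself closed. -/
theorem IsClosedRep.of_res_base (h : (π.res 𝒢.base.subtype).IsClosedRep) : π.IsClosedRep := by
  refine isClosed_of_closure_subset fun p hp => ?_
  have h1 : ((p.1, fun b : 𝒢.base => p.2 b) : H × (𝒢.base → H)) ∈
      _root_.closure (Set.range (π.res 𝒢.base.subtype).graphMap) := by
    refine map_mem_closure (f := fun p : H × (A → H) => (p.1, fun b : 𝒢.base => p.2 b)) ?_ hp ?_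
    · exact continuous_fst.prodMk (continuous_pi fun b => continuous_eval (b : A))
    · rintro _ ⟨φ, rfl⟩; exact ⟨φ, rfl⟩
  rw [IsClosed.closure_eq h] at h1
  obtain ⟨φ, hφ⟩ := h1
  have hp' : p ∈ π.graphClosure := by
    rw [graphClosure, ← SetLike.mem_coe, Submodule.topologicalClosure_coe, LinearMap.coe_range]
    exact hp
  have h1 := congrArg Prod.fst hφ
  have h2 : (⟨π.graphMap φ, π.graphMap_mem φ⟩ : π.graphClosure) = ⟨p, hp'⟩ :=
    π.graphClosure_fst_injective h1
  exact ⟨φ, congrArg Subtype.val h2⟩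

theorem act_mem_weightSpace_of_sub (hB : 𝒢.IsCommutativeBase) (x : 𝒢.sub (stabilizer χ))
    {v : π.dom} (hv : v ∈ π.weightSpace χ) : π.act x v ∈ π.weightSpace χ := by
  induction x using 𝒢.sub_induction (stabilizer χ) with
  | zero => simp
  | add x y hx hy =>
    rw [AddMemClass.coe_add, act_add]
    exact Submodule.add_mem _ hx hy
  | mem g hg x hx => exact act_mem_weightSpace hB hv hg (⟨x, hx⟩ : 𝒢.piece g)

/-- The representation of `A_H` on the weight space of `χ`, where `H` is the stabilizer of `χ`. -/
def weightRep (π : StarRep A H) (hB : 𝒢.IsCommutativeBase) (χ : 𝒢.PosChar) :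
    StarRep (𝒢.sub (stabilizer χ)) (π.weightSpace χ) where
  dom := ⊤
  dense_dom := by simp
  act :=
    { toFun := fun x =>
        { toFun := fun v => ⟨⟨π.act x v.1.1, act_mem_weightSpace_of_sub hB x v.1.2⟩, trivial⟩
          map_add' := fun v w => Subtype.ext (Subtype.ext (map_add (π.act x) v.1.1 w.1.1))
          map_smul' := fun c v => Subtype.ext (Subtype.ext (map_smul (π.act x) c v.1.1)) }
      map_smul' := fun c x => LinearMap.ext fun v =>
        Subtype.ext (Subtype.ext (π.act_smul c x v.1.1))
      map_zero' := LinearMap.ext fun v => Subtype.ext (Subtype.ext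
        (by change π.act (0 : A) v.1.1 = 0; simp))
      map_add' := fun x y => LinearMap.ext fun v =>
        Subtype.ext (Subtype.ext (π.act_add x y v.1.1))
      map_mul' := fun x y => LinearMap.ext fun v =>
        Subtype.ext (Subtype.ext (π.act_mul x y v.1.1)) }
  inner_act x v w := π.inner_act x v.1.1 w.1.1

theorem restrictsToMultiple_weightRep (hB : 𝒢.IsCommutativeBase) :
    (π.weightRep hB χ).RestrictsToMultiple χ :=
  fun b v => Subtype.ext (Subtype.ext (v.1.2 b))

theorem completeSpace_weightSpace [CompleteSpace H] (hπ : π.IsClosedRep) (χ : 𝒢.PosChar) :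
    CompleteSpace (π.weightSpace χ) := by
  have h1 : Isometry fun v : π.weightSpace χ => (v.1.1 : H) :=
    isometry_subtype_coe.comp isometry_subtype_coe
  refine (completeSpace_iff_isComplete_range h1.isUniformInducing).2 (IsClosed.isComplete ?_)
  convert isClosed_weightSpace hπ χ using 1
  ext x
  constructor
  · rintro ⟨v, rfl⟩; exact ⟨v.1, v.2, rfl⟩
  · rintro ⟨v, hv, rfl⟩; exact ⟨⟨v, hv⟩, rfl⟩

/-- Between vectors of weight `χ`, only the part of `a` with degrees in the stabilizer matters. -/
theorem inner_act_expect (hB : 𝒢.IsCommutativeBase) {v w : π.dom} (hv : v ∈ π.weightSpace χ)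
    (hw : w ∈ π.weightSpace χ) (a : A) : ⟪(w : H), (π.act a v : H)⟫_ℂ =
      ⟪(w : H), (π.act (𝒢.expect (stabilizer χ) a : A) v : H)⟫_ℂ := by
  induction a using 𝒢.induction_on with
  | zero => simp
  | add a b ha hb =>
    rw [act_add, Submodule.coe_add, inner_add_right, ha, hb, map_add, AddMemClass.coe_add, act_add,
      Submodule.coe_add, inner_add_right]
  | mem g a ha =>
    by_cases hg : g ∈ stabilizer χ
    · rw [𝒢.coe_expect_of_mem _ hg ha]
    · rw [𝒢.expect_of_notMem _ hg ha]
      rcases act_weight_dichotomy hB hv (⟨a, ha⟩ : 𝒢.piece g) with h | ⟨θ, hθ, h⟩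
      · rw [show π.act a v = 0 from h]; simp
      · rw [show ⟪(w : H), (π.act a v : H)⟫_ℂ = 0 from inner_weight_eq_zero hw h
          (by rintro rfl; exact hg hθ)]
        simp

/-- A closed representation with a core spanned by the weight spaces along the orbit of `χ` is
induced from its weight space for `χ`. -/
theorem unitarilyEquivalent_ind_weightRep [CompleteSpace H] (hB : 𝒢.IsCommutativeBase)
    (hπ : π.IsClosedRep) (hcore : π.IsCore (π.orbitSpan χ))
    (hρ : (π.weightRep hB χ).Inducible) : ((π.weightRep hB χ).Ind hρ).UnitarilyEquivalent π := by
  let j : (π.weightRep hB χ).dom →ₗ[ℂ] π.dom :=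
    (π.weightSpace χ).subtype ∘ₗ (π.weightRep hB χ).dom.subtype
  refine unitarilyEquivalent_ind hρ hπ j (fun a φ ψ => ?_) (hcore.mono fun v hv => ?_)
  · exact inner_act_expect hB φ.1.2 ψ.1.2 a
  · refine orbitSpan_induction (P := fun v => v ∈ Set.range (tensorMap π j))
      (fun θ hθ v hv => ?_) ?_ hv
    · obtain ⟨g, hg⟩ := hθ
      obtain ⟨c, hc⟩ := hg.exists_normalized
      have h1 := hg.apply_mulStar hB c hc
      have h2 : π.act (star (c : A)) v ∈ π.weightSpace χ :=
        act_mem_weightSpace hB hv hg.inv (⟨star (c : A), 𝒢.star_mem c.2⟩ : 𝒢.piece g⁻¹)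
      let w : (π.weightRep hB χ).dom := ⟨⟨_, h2⟩, trivial⟩
      have h3 := hv (mulStar c)
      rw [h1, one_smul, show ((mulStar c : 𝒢.base) : A) = c * star (c : A) from rfl, act_mul] at h3
      exact ⟨(c : A) ⊗ₜ w, (tensorMap_tmul π j c w).trans h3⟩
    · rintro _ _ ⟨ξ, rfl⟩ ⟨η, rfl⟩
      exact ⟨ξ + η, map_add _ _ _⟩

variable [CompleteSpace H] {E : SpectralMeasure 𝒢.PosChar H}

theorem proj_mem_dom (hE : 𝒢.IsAssociated E π) {Δ : Set 𝒢.PosChar} (hΔ : MeasurableSet Δ)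
    (x : π.dom) : E.proj Δ x ∈ π.dom :=
  (hE.covariant 1 1 𝒢.one_mem Δ hΔ x).1

/-- The spectral projection of a point maps the domain into the weight space of that point. -/
theorem proj_singleton_mem_weightSpace (hE : 𝒢.IsAssociated E π) (ψ : 𝒢.PosChar) (x : π.dom) :
    (⟨E.proj {ψ} x, proj_mem_dom hE (measurableSet_singleton ψ) x⟩ : π.dom) ∈ π.weightSpace ψ := by
  set y : π.dom := ⟨E.proj {ψ} x, proj_mem_dom hE (measurableSet_singleton ψ) x⟩ with hy
  have hyy : E.proj {ψ} (y : H) = y := E.proj_proj_self (measurableSet_singleton ψ) (x : H)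
  have hquad (b : 𝒢.base) : ⟪(y : H), (π.act b y : H)⟫_ℂ = ψ b * ⟪(y : H), (y : H)⟫_ℂ := by
    have hle := (π.opr b).le_closure
    have h1 := (hE.integral b).2 ⟨y, hle.1 y.2⟩
    have h2 : (π.opr b).closure ⟨y, hle.1 y.2⟩ = (π.act b y : H) :=
      (hle.2 (x := (y : (π.opr b).domain)) rfl).symm
    rw [h2] at h1
    have h3 : (fun θ : 𝒢.PosChar => θ b) =ᵐ[E.measure y] fun _ => ψ b := by
      have : ∀ᵐ θ ∂(E.measure (y : H)), θ ∈ ({ψ} : Set 𝒢.PosChar) :=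
        MeasureTheory.mem_ae_iff.2 (E.measure_compl_eq_zero (measurableSet_singleton ψ) hyy)
      filter_upwards [this] with θ hθ
      rw [hθ]
    refine h1.trans ?_
    rw [MeasureTheory.integral_congr_ae h3, MeasureTheory.integral_const,
      E.measure_real_apply MeasurableSet.univ, E.proj_univ, inner_self_eq_norm_sq_to_K,
      Complex.real_smul, mul_comm]
    simp
  intro b
  rw [← sub_eq_zero]
  refine Subtype.ext ((inner_self_eq_zero (𝕜 := ℂ)).1 ?_)
  have h4 : ⟪(π.act b y : H), (π.act b y : H)⟫_ℂ = star (ψ b) * ψ b * ⟪(y : H), (y : H)⟫_ℂ := by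
    rw [inner_act_act]
    refine (hquad (star b * b)).trans ?_
    rw [ψ.map_mul, ψ.map_star]
  have h5 : ⟪(π.act b y : H), (y : H)⟫_ℂ = star (ψ b) * ⟪(y : H), (y : H)⟫_ℂ := by
    rw [← inner_conj_symm, hquad, map_mul, inner_conj_symm]; rfl
  rw [Submodule.coe_sub, Submodule.coe_smul, inner_sub_left, inner_sub_right, inner_sub_right,
    inner_smul_left, inner_smul_right, inner_smul_left, inner_smul_right, h4, h5, hquad]
  simp only [RCLike.star_def]
  ring

/-- For a representation associated with the orbit of `χ`, the weight spaces along the orbit span a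
core: by covariance the sums `x = ∑ E({θ}) x` and `π(a) x = ∑ E({θ}^g) π(a) x = ∑ π(a) E({θ}) x`
converge simultaneously. -/
theorem isCore_orbitSpan_of_isAssociated [Countable G] (hB : 𝒢.IsCommutativeBase)
    (hE : 𝒢.IsAssociated E π) (hs : E.proj (orbit χ)ᶜ = 0) : π.IsCore (π.orbitSpan χ) := by
  have hcount := countable_orbit hB χ
  have : Countable (orbit χ) := hcount.to_subtype
  obtain ⟨e, he⟩ := exists_injective_nat (orbit χ)
  let Δ : ℕ → Set 𝒢.PosChar := fun n => {θ | ∃ h : θ ∈ orbit χ, e ⟨θ, h⟩ = n}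
  have hsub (n) : (Δ n).Subsingleton := by
    rintro θ ⟨h, h1⟩ θ' ⟨h', h2⟩
    exact congrArg Subtype.val (he (h1.trans h2.symm))
  have hm (n) : MeasurableSet (Δ n) := (hsub n).measurableSet
  have hU : ⋃ n, Δ n = orbit χ := by
    ext θ; simp [Δ]
  have hd : Pairwise (Function.onFun Disjoint Δ) := by
    intro m n hmn
    refine Set.disjoint_left.2 ?_
    rintro θ ⟨h, rfl⟩ ⟨h', rfl⟩
    exact hmn rfl
  have hm' (g : G) (n) : MeasurableSet (StarGrading.translate g (Δ n)) := by
    refine Set.Subsingleton.measurableSet ?_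
    rintro ψ ⟨θ, hθ, h1⟩ ψ' ⟨θ', hθ', h2⟩
    obtain rfl := hsub n hθ hθ'
    exact h1.unique hB h2
  have hU' (g : G) : ⋃ n, StarGrading.translate g (Δ n) = StarGrading.translate g (orbit χ) := by
    rw [← hU]
    ext ψ
    rw [Set.mem_iUnion]
    constructor
    · rintro ⟨n, θ, hθ, h⟩; exact ⟨θ, Set.mem_iUnion.2 ⟨n, hθ⟩, h⟩
    · rintro ⟨θ, hθ, h⟩
      obtain ⟨n, hn⟩ := Set.mem_iUnion.1 hθ
      exact ⟨n, θ, hn, h⟩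
  have hd' (g : G) : Pairwise (Function.onFun Disjoint fun n => StarGrading.translate g (Δ n)) := by
    intro m n hmn
    refine Set.disjoint_left.2 ?_
    rintro ψ ⟨θ, hθ, h1⟩ ⟨θ', hθ', h2⟩
    obtain rfl := h1.injective hB h2
    exact Set.disjoint_left.1 (hd hmn) hθ hθ'
  refine IsCore.of_tendsto fun x => ?_
  let y : ℕ → π.dom := fun n => ⟨E.proj (Δ n) x, proj_mem_dom hE (hm n) x⟩
  have hy (n) : y n ∈ π.orbitSpan χ := by
    rcases (hsub n).eq_empty_or_singleton with h | ⟨θ, hθ⟩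
    · have : y n = 0 := Subtype.ext (by simp [y, h, E.proj_empty])
      rw [this]; exact Submodule.zero_mem _
    · have hmem : θ ∈ orbit χ := by
        have : θ ∈ Δ n := hθ ▸ Set.mem_singleton θ
        exact this.1
      refine Submodule.mem_iSup_of_mem (p := fun θ : orbit χ => π.weightSpace (θ : 𝒢.PosChar))
        ⟨θ, hmem⟩ ?_
      have h1 := proj_singleton_mem_weightSpace hE θ x
      convert h1 using 1
      exact Subtype.ext (by simp only [y, hθ])
  have hx : E.proj (orbit χ) (x : H) = x := E.proj_eq_self hcount.measurableSet hs x
  have s1 : HasSum (fun n => (y n : H)) x := by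
    have := E.hasSum_iUnion hm hd (x : H)
    rwa [hU, hx] at this
  have s2 (a : A) : HasSum (fun n => (π.act a (y n) : H)) (π.act a x) := by
    induction a using 𝒢.induction_on with
    | zero => simp
    | add a b ha hb => simpa only [act_add, Submodule.coe_add] using ha.add hb
    | mem g a ha =>
      have h1 := E.hasSum_iUnion (hm' g) (hd' g) (π.act a x : H)
      obtain ⟨h2, h3⟩ := hE.covariant g a ha (orbit χ) hcount.measurableSet x
      rw [hU', h3] at h1
      have h4 : (⟨E.proj (orbit χ) x, h2⟩ : π.dom) = x := Subtype.ext hx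
      rw [h4] at h1
      have h5 : (fun n => (π.act a (y n) : H)) =
          fun n => E.proj (StarGrading.translate g (Δ n)) (π.act a x) :=
        funext fun n => ((hE.covariant g a ha (Δ n) (hm n) x).2).symm
      rwa [h5]
  refine ⟨fun n => ∑ i ∈ Finset.range n, y i, fun n => Submodule.sum_mem _ fun i _ => hy i, ?_,
    fun a => ?_⟩
  · simpa only [Submodule.coe_sum] using s1.tendsto_sum_nat
  · simpa only [_root_.map_sum, Submodule.coe_sum] using (s2 a).tendsto_sum_nat

end StarRep

/-! ### Commutants -/

/-- The commutant of a self-adjoint set of bounded operators is a von Neumann algebra. -/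
theorem exists_vonNeumannAlgebra_centralizer {H : Type*} [NormedAddCommGroup H]
    [InnerProductSpace ℂ H] [CompleteSpace H] {X : Set (H →L[ℂ] H)} (hX : ∀ x ∈ X, star x ∈ X) :
    ∃ M : VonNeumannAlgebra H, (M : Set (H →L[ℂ] H)) = X.centralizer := by
  have hX' : star X ⊆ X := fun x hx => star_star x ▸ hX _ hx
  have h : (StarSubalgebra.centralizer ℂ X : Set (H →L[ℂ] H)) = X.centralizer := by
    rw [StarSubalgebra.coe_centralizer, Set.union_eq_self_of_subset_right hX']
  refine ⟨⟨StarSubalgebra.centralizer ℂ X, ?_⟩, h⟩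
  change Set.centralizer (Set.centralizer (StarSubalgebra.centralizer ℂ X : Set (H →L[ℂ] H))) =
    (StarSubalgebra.centralizer ℂ X : Set (H →L[ℂ] H))
  rw [h, Set.centralizer_centralizer_centralizer]

namespace StarRep

open StarGrading ContinuousLinearMap

variable {G : Type*} [Group G] {A : Type*} [Ring A] [StarRing A] [Algebra ℂ A] [StarModule ℂ A]
  {𝒢 : StarGrading G A} {H : Type*} [NormedAddCommGroup H] [InnerProductSpace ℂ H]
  {χ : 𝒢.PosChar} {ρ : StarRep (𝒢.sub (stabilizer χ)) H} (hρ : ρ.Inducible)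
  (hχ : ρ.RestrictsToMultiple χ)

/-- The map `φ ↦ [a ⊗ φ]` is bounded; for homogeneous `a` one has `‖[a ⊗ φ]‖² = χ(a^* a) ‖φ‖²`. -/
theorem exists_norm_indVec_le (hχ : ρ.RestrictsToMultiple χ) (a : A) :
    ∃ C : ℝ, ∀ φ : ρ.dom, ‖(indVec hρ (a ⊗ₜ φ) : IndSpace ρ hρ)‖ ≤ C * ‖(φ : H)‖ := by
  induction a using 𝒢.induction_on with
  | zero => exact ⟨0, fun φ => by simp⟩
  | add a b ha hb =>
    obtain ⟨C, hC⟩ := ha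
    obtain ⟨C', hC'⟩ := hb
    refine ⟨C + C', fun φ => ?_⟩
    rw [TensorProduct.add_tmul, _root_.map_add, Submodule.coe_add, add_mul]
    exact (norm_add_le _ _).trans (add_le_add (hC φ) (hC' φ))
  | mem g a ha =>
    refine ⟨√‖χ (starMul (⟨a, ha⟩ : 𝒢.piece g) ⟨a, ha⟩)‖, fun φ => ?_⟩
    have h1 := congrArg norm
      (norm_sq_act_weight (indUnit_mem_weightSpace hρ hχ φ) (⟨a, ha⟩ : 𝒢.piece g))
    rw [norm_indUnit hρ hχ, norm_mul, act_indUnit] at h1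
    simp only [norm_pow, Complex.norm_real, norm_norm] at h1
    refine (sq_le_sq₀ (norm_nonneg _) (by positivity)).1 ?_
    rw [mul_pow, Real.sq_sqrt (norm_nonneg _)]
    exact h1.le

theorem mem_dom_of_eq_top {A : Type*} [Ring A] [StarRing A] [Algebra ℂ A] {ρ : StarRep A H}
    (hd : ρ.dom = ⊤) (x : H) : x ∈ ρ.dom :=
  hd ▸ Submodule.mem_top

theorem forall_of_dom_eq_top {A : Type*} [Ring A] [StarRing A] [Algebra ℂ A] {ρ : StarRep A H}
    {P : H → Prop} (hd : ρ.dom = ⊤) (h : ∀ φ : ρ.dom, P φ) (x : H) : P x :=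
  h ⟨x, mem_dom_of_eq_top hd x⟩

variable (hd : ρ.dom = ⊤)

/-- For a representation `ρ` defined on all of `H`, the bounded operator `φ ↦ [a ⊗ φ]`. -/
def indOp (a : A) : H →L[ℂ] IndSpace ρ hρ :=
  LinearMap.mkContinuousOfExistsBound
    (((ρ.Ind hρ).dom.subtype ∘ₗ indVec hρ ∘ₗ TensorProduct.mk ℂ A ρ.dom a) ∘ₗ
      LinearMap.id.codRestrict ρ.dom (mem_dom_of_eq_top hd))
    ((exists_norm_indVec_le hρ hχ a).imp fun _ h _ => h _)

theorem indOp_apply (a : A) (φ : ρ.dom) :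
    indOp hρ hχ hd a φ = (indVec hρ (a ⊗ₜ φ) : IndSpace ρ hρ) := rfl

theorem indOp_mul (a : A) (x : 𝒢.sub (stabilizer χ)) (φ : ρ.dom) :
    indOp hρ hχ hd (a * x) φ = indOp hρ hχ hd a (ρ.act x φ) :=
  congrArg Subtype.val (indVec_mul_tmul hρ a x φ)

theorem inner_indOp (a b : A) (φ ψ : ρ.dom) :
    ⟪indOp hρ hχ hd b ψ, indOp hρ hχ hd a φ⟫_ℂ =
      ⟪(ψ : H), (ρ.act (𝒢.expect (stabilizer χ) (star b * a)) φ : H)⟫_ℂ :=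
  (inner_indVec hρ _ _).trans (indForm_tmul ρ a b φ ψ)

theorem inner_indOp_one (x y : H) :
    ⟪indOp hρ hχ hd 1 x, indOp hρ hχ hd 1 y⟫_ℂ = ⟪x, y⟫_ℂ := by
  revert y
  refine forall_of_dom_eq_top hd fun φ => ?_
  revert x
  refine forall_of_dom_eq_top hd fun ψ => ?_
  have h1 : 𝒢.expect (stabilizer χ) 1 = 1 := 𝒢.expect_coe _ 1
  rw [inner_indOp, star_one, one_mul, h1, hχ.act_one]

theorem indOp_one_injective : Function.Injective (indOp hρ hχ hd 1) := by
  refine (injective_iff_map_eq_zero _).2 fun x hx => ?_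
  rw [← inner_self_eq_zero (𝕜 := ℂ), ← inner_indOp_one hρ hχ hd, hx, inner_zero_left]

/-- Continuous operators on the induced space are determined by their values on the vectors
`[a ⊗ φ]`. -/
theorem ext_of_indOp (hχ : ρ.RestrictsToMultiple χ) (hd : ρ.dom = ⊤)
    {F : Type*} [NormedAddCommGroup F] [NormedSpace ℂ F]
    {T T' : IndSpace ρ hρ →L[ℂ] F}
    (h : ∀ a, T ∘L indOp hρ hχ hd a = T' ∘L indOp hρ hχ hd a) : T = T' := by
  refine ContinuousLinearMap.ext_on ((isCore_ind hρ).dense.mono Submodule.subset_span) ?_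
  rintro _ ⟨_, ⟨ξ, rfl⟩, rfl⟩
  dsimp only
  induction ξ with
  | zero => simp
  | add ξ ξ' h h' => simp only [_root_.map_add, Submodule.coe_add, h, h']
  | tmul a φ => exact DFunLike.congr_fun (h a) (φ : H)

/-- An operator `S` of the commutant of `ρ` induces the operator `[a ⊗ φ] ↦ [a ⊗ S φ]`. It is
bounded because the components of the inducing form intertwine `id ⊗ S` with `S`. -/
theorem exists_comp_indOp (hB : 𝒢.IsCommutativeBase) {S : H →L[ℂ] H} (hS : S ∈ ρ.commutant) :
    ∃ T : IndSpace ρ hρ →L[ℂ] IndSpace ρ hρ,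
      ∀ a, T ∘L indOp hρ hχ hd a = indOp hρ hχ hd a ∘L S := by
  obtain ⟨hm, hact⟩ := hS
  let s : ρ.dom →ₗ[ℂ] ρ.dom := (S.toLinearMap ∘ₗ ρ.dom.subtype).codRestrict ρ.dom hm
  let J : A ⊗[ℂ] ρ.dom →ₗ[ℂ] IndSpace ρ hρ :=
    (ρ.Ind hρ).dom.subtype ∘ₗ indVec hρ ∘ₗ s.lTensor A
  have hcomp (θ : orbit χ) (ξ) : ρ.component θ (s.lTensor A ξ) = s (ρ.component θ ξ) := by
    induction ξ with
    | zero => simp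
    | add ξ ξ' h h' => simp only [_root_.map_add, h, h']
    | tmul a φ => exact Subtype.ext (hact _ φ)
  have hb (ξ) : ‖J ξ‖ ≤ ‖S‖ * ‖indMk hρ ξ‖ := by
    obtain ⟨X, h1, h2⟩ :=
      ((hχ.indForm_eq_sum hB ξ ξ).and (hχ.indForm_eq_sum hB (s.lTensor A ξ) (s.lTensor A ξ))).exists
    have e (η) : ‖(indVec hρ η : IndSpace ρ hρ)‖ ^ 2 = RCLike.re (ρ.indForm η η) := by
      rw [← inner_indVec hρ]
      exact (inner_self_eq_norm_sq (𝕜 := ℂ) _).symm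
    refine (sq_le_sq₀ (norm_nonneg _) (by positivity)).1 ?_
    refine (e _).trans_le ?_
    rw [mul_pow]
    refine le_of_le_of_eq ?_ (congrArg (‖S‖ ^ 2 * ·) (e ξ).symm)
    rw [h1, h2, map_sum, map_sum, Finset.mul_sum]
    refine Finset.sum_le_sum fun θ _ => ?_
    rw [hcomp, inner_self_eq_norm_sq, inner_self_eq_norm_sq, ← mul_pow]
    exact pow_le_pow_left₀ (norm_nonneg _) (S.le_opNorm _) 2
  refine ⟨LinearMap.extendOfNorm (E := IndPre ρ hρ) J (indMk hρ), fun a => ?_⟩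
  ext x
  revert x
  refine forall_of_dom_eq_top hd fun φ => ?_
  exact LinearMap.extendOfNorm_eq (E := IndPre ρ hρ) (denseRange_indMk hρ) ⟨_, hb⟩ (a ⊗ₜ φ)

/-- An operator `[a ⊗ φ] ↦ [a ⊗ S φ]` commutes with the induced representation on the core of the
vectors `[a ⊗ φ]`, hence on the whole domain, because the representation is closed. -/
theorem mem_commutant_ind {T : IndSpace ρ hρ →L[ℂ] IndSpace ρ hρ} {S : H →L[ℂ] H}
    (h : ∀ a, T ∘L indOp hρ hχ hd a = indOp hρ hχ hd a ∘L S) : T ∈ (ρ.Ind hρ).commutant := by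
  let s : ρ.dom →ₗ[ℂ] ρ.dom :=
    (S.toLinearMap ∘ₗ ρ.dom.subtype).codRestrict ρ.dom fun _ => mem_dom_of_eq_top hd _
  have hT (ξ) : T (indVec hρ ξ) = indVec hρ (s.lTensor A ξ) := by
    induction ξ with
    | zero => simp
    | add ξ ξ' h h' => simp only [_root_.map_add, Submodule.coe_add, h, h']
    | tmul a φ => exact DFunLike.congr_fun (h a) (φ : H)
  have key : ∀ x : (ρ.Ind hρ).dom, ∃ h : T x ∈ (ρ.Ind hρ).dom, ∀ a,
      ((ρ.Ind hρ).act a ⟨T x, h⟩ : IndSpace ρ hρ) = T ((ρ.Ind hρ).act a x) := by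
    refine (isCore_ind hρ).extend_intertwiner (isClosedRep_ind hρ) T ?_
    rintro _ ⟨ξ, rfl⟩
    refine ⟨hT ξ ▸ (indVec hρ _).2, fun a => ?_⟩
    have h2 : (⟨T (indVec hρ ξ), hT ξ ▸ (indVec hρ _).2⟩ : (ρ.Ind hρ).dom) =
        indVec hρ (s.lTensor A ξ) := Subtype.ext (hT ξ)
    rw [h2]
    clear h2
    induction ξ with
    | zero => simp
    | add ξ ξ' h h' => simp only [_root_.map_add, Submodule.coe_add, h, h']
    | tmul x φ =>
      rw [LinearMap.lTensor_tmul, act_indVec_tmul, act_indVec_tmul, hT, LinearMap.lTensor_tmul]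
  choose hm hact using key
  exact ⟨hm, fun a φ => hact φ a⟩

theorem comp_indOp_mem_commutant {T : IndSpace ρ hρ →L[ℂ] IndSpace ρ hρ} {S : H →L[ℂ] H}
    (h : ∀ a, T ∘L indOp hρ hχ hd a = indOp hρ hχ hd a ∘L S) : S ∈ ρ.commutant := by
  refine ⟨fun _ => mem_dom_of_eq_top hd _, fun x φ => indOp_one_injective hρ hχ hd ?_⟩
  have h1 := DFunLike.congr_fun (h 1) (ρ.act x φ : H)
  have h2 := DFunLike.congr_fun (h (1 * x)) (φ : H)
  rw [comp_apply, comp_apply] at h1 h2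
  rw [indOp_mul, h1] at h2
  rw [h2]
  exact (indOp_mul hρ hχ hd 1 x ⟨S φ, mem_dom_of_eq_top hd _⟩).symm

variable [CompleteSpace H]

theorem adjoint_indOp_one_comp : adjoint (indOp hρ hχ hd 1) ∘L indOp hρ hχ hd 1 = 1 := by
  ext x
  refine ext_inner_left ℂ fun y => ?_
  rw [comp_apply, adjoint_inner_right, inner_indOp_one]; rfl

theorem adjoint_indOp_one_comp_indOp (x : 𝒢.sub (stabilizer χ)) (φ : ρ.dom) :
    (adjoint (indOp hρ hχ hd 1) ∘L indOp hρ hχ hd x) φ = ρ.act x φ := by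
  have := indOp_mul hρ hχ hd 1 x φ
  rw [one_mul] at this
  rw [comp_apply, this]
  exact DFunLike.congr_fun (adjoint_indOp_one_comp hρ hχ hd) (ρ.act x φ : H)

/-- An operator of the commutant of the induced representation preserves the weight space of `χ`, so
that it has the form `[a ⊗ φ] ↦ [a ⊗ S φ]`. -/
theorem comp_indOp_of_mem_commutant (hB : 𝒢.IsCommutativeBase)
    {T : IndSpace ρ hρ →L[ℂ] IndSpace ρ hρ} (hT : T ∈ (ρ.Ind hρ).commutant) (a : A) :
    T ∘L indOp hρ hχ hd a = indOp hρ hχ hd a ∘L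
      (adjoint (indOp hρ hχ hd 1) ∘L T ∘L indOp hρ hχ hd 1) := by
  obtain ⟨hm, hact⟩ := hT
  ext x
  revert x
  refine forall_of_dom_eq_top hd fun φ => ?_
  have hw : (⟨T (indUnit hρ φ), hm _⟩ : (ρ.Ind hρ).dom) ∈ (ρ.Ind hρ).weightSpace χ := fun b => by
    refine Subtype.ext ((hact b _).trans ?_)
    rw [indUnit_mem_weightSpace hρ hχ φ b]
    exact map_smul T _ _
  obtain ⟨ψ, hψ⟩ := exists_indUnit_eq hρ hB hχ hd hw
  have h1 : T (indOp hρ hχ hd 1 φ) = indOp hρ hχ hd 1 ψ := (congrArg Subtype.val hψ).symm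
  have h2 : (adjoint (indOp hρ hχ hd 1) ∘L T ∘L indOp hρ hχ hd 1) (φ : H) = ψ := by
    rw [comp_apply, comp_apply, h1]
    exact DFunLike.congr_fun (adjoint_indOp_one_comp hρ hχ hd) (ψ : H)
  rw [comp_apply, comp_apply, h2, indOp_apply, indOp_apply, ← act_indUnit, ← act_indUnit, hψ]
  exact (hact a _).symm

/-- The adjoint of `[a ⊗ φ] ↦ [a ⊗ S φ]` is `[a ⊗ φ] ↦ [a ⊗ S^* φ]`, since `S` commutes with the
operators `ρ(p_H(b^* a))` in the inner products of these vectors. -/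
theorem adjoint_comp_indOp {T : IndSpace ρ hρ →L[ℂ] IndSpace ρ hρ} {S : H →L[ℂ] H}
    (h : ∀ a, T ∘L indOp hρ hχ hd a = indOp hρ hχ hd a ∘L S) (b : A) :
    adjoint T ∘L indOp hρ hχ hd b = indOp hρ hχ hd b ∘L adjoint S := by
  obtain ⟨hm, hact⟩ := comp_indOp_mem_commutant hρ hχ hd h
  have key : adjoint (indOp hρ hχ hd b) ∘L T = S ∘L adjoint (indOp hρ hχ hd b) := by
    refine ext_of_indOp hρ hχ hd fun a => ?_
    rw [comp_assoc, h]
    ext x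
    revert x
    refine forall_of_dom_eq_top hd fun φ => ?_
    have e (φ : ρ.dom) : adjoint (indOp hρ hχ hd b) (indOp hρ hχ hd a φ) =
        ρ.act (𝒢.expect (stabilizer χ) (star b * a)) φ := by
      refine ext_inner_left ℂ (forall_of_dom_eq_top hd fun ψ => ?_)
      rw [adjoint_inner_right, inner_indOp]
    have e1 := e ⟨S φ, hm φ⟩
    simp only [comp_apply]
    rw [e, ← hact, ← e1]
  have := congrArg adjoint key
  rwa [adjoint_comp, adjoint_comp, adjoint_adjoint] at this

/-- The commutant of the induced representation, which acts by unbounded operators, is the ordinary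
commutant of the set of bounded operators `L_a L_b^*` with `L_a φ = [a ⊗ φ]`. -/
theorem commutant_ind_eq_centralizer (hB : 𝒢.IsCommutativeBase) : (ρ.Ind hρ).commutant =
    (Set.range fun p : A × A =>
      indOp hρ hχ hd p.1 ∘L adjoint (indOp hρ hχ hd p.2)).centralizer := by
  ext T
  constructor
  · rintro hT _ ⟨⟨a, b⟩, rfl⟩
    have h := comp_indOp_of_mem_commutant hρ hχ hd hB hT
    have h' := congrArg adjoint (adjoint_comp_indOp hρ hχ hd h b)
    rw [adjoint_comp, adjoint_comp, adjoint_adjoint, adjoint_adjoint] at h'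
    change (indOp hρ hχ hd a ∘L adjoint (indOp hρ hχ hd b)) ∘L T =
      T ∘L (indOp hρ hχ hd a ∘L adjoint (indOp hρ hχ hd b))
    rw [comp_assoc, h', ← comp_assoc (indOp hρ hχ hd a), ← comp_assoc T, h a]
  · intro hT
    refine mem_commutant_ind hρ hχ hd (S := adjoint (indOp hρ hχ hd 1) ∘L T ∘L indOp hρ hχ hd 1)
      fun a => ?_
    have h : (indOp hρ hχ hd a ∘L adjoint (indOp hρ hχ hd 1)) ∘L T =
      T ∘L (indOp hρ hχ hd a ∘L adjoint (indOp hρ hχ hd 1)) := hT _ ⟨(a, 1), rfl⟩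
    rw [← comp_assoc, ← comp_assoc, h, comp_assoc, comp_assoc, adjoint_indOp_one_comp]
    rfl

/-- The commutant of `ρ` is the commutant of the set of operators `L_1^* L_x = ρ(x)`. -/
theorem commutant_eq_centralizer : ρ.commutant =
    (Set.range fun x : 𝒢.sub (stabilizer χ) =>
      adjoint (indOp hρ hχ hd 1) ∘L indOp hρ hχ hd x).centralizer := by
  ext S
  constructor
  · rintro ⟨hm, hact⟩ _ ⟨x, rfl⟩
    ext y
    revert y
    refine forall_of_dom_eq_top hd fun φ => ?_
    refine (adjoint_indOp_one_comp_indOp hρ hχ hd x ⟨S φ, hm φ⟩).trans ((hact x φ).trans ?_)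
    exact congrArg S (adjoint_indOp_one_comp_indOp hρ hχ hd x φ).symm
  · intro hS
    refine ⟨fun _ => mem_dom_of_eq_top hd _, fun x φ => ?_⟩
    have h := DFunLike.congr_fun (hS _ ⟨x, rfl⟩) (φ : H)
    refine (adjoint_indOp_one_comp_indOp hρ hχ hd x ⟨S φ, mem_dom_of_eq_top hd _⟩).symm.trans
      (h.trans ?_)
    exact congrArg S (adjoint_indOp_one_comp_indOp hρ hχ hd x φ)

/-- The commutants of `ρ` and of the induced representation are von Neumann algebras, and
`T ↦ J^* T J` with `J φ = [1 ⊗ φ]` is a `*`-isomorphism between them. -/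
theorem exists_commutant_starAlgEquiv (hB : 𝒢.IsCommutativeBase)
    (hχ : ρ.RestrictsToMultiple χ) (hd : ρ.dom = ⊤) :
    ∃ (M : VonNeumannAlgebra H) (N : VonNeumannAlgebra (IndSpace ρ hρ)),
      (M : Set (H →L[ℂ] H)) = ρ.commutant ∧
      (N : Set (IndSpace ρ hρ →L[ℂ] IndSpace ρ hρ)) = (ρ.Ind hρ).commutant ∧
      Nonempty (M.toStarSubalgebra ≃⋆ₐ[ℂ] N.toStarSubalgebra) := by
  set J := indOp hρ hχ hd 1 with hJ
  have hJJ : adjoint J ∘L J = 1 := adjoint_indOp_one_comp hρ hχ hd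
  obtain ⟨M, hM⟩ := exists_vonNeumannAlgebra_centralizer (H := H)
    (X := Set.range fun x : 𝒢.sub (stabilizer χ) => adjoint J ∘L indOp hρ hχ hd x) (by
      rintro _ ⟨x, rfl⟩
      refine ⟨star x, ?_⟩
      rw [star_eq_adjoint, eq_adjoint_iff]
      refine forall_of_dom_eq_top hd fun φ => forall_of_dom_eq_top hd fun ψ => ?_
      have e := adjoint_indOp_one_comp_indOp hρ hχ hd
      refine (congrArg (⟪·, (ψ : H)⟫_ℂ) (e (star x) φ)).trans ?_
      refine Eq.trans ?_ (congrArg (⟪(φ : H), ·⟫_ℂ) (e x ψ)).symm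
      rw [inner_act, star_star])
  obtain ⟨N, hN⟩ := exists_vonNeumannAlgebra_centralizer (H := IndSpace ρ hρ)
    (X := Set.range fun p : A × A => indOp hρ hχ hd p.1 ∘L adjoint (indOp hρ hχ hd p.2)) (by
      rintro _ ⟨⟨a, b⟩, rfl⟩
      refine ⟨(b, a), ?_⟩
      rw [star_eq_adjoint, adjoint_comp, adjoint_adjoint])
  rw [← commutant_eq_centralizer hρ hχ hd] at hM
  rw [← commutant_ind_eq_centralizer hρ hχ hd hB] at hN
  refine ⟨M, N, hM, hN, ?_⟩
  have hMmem (S) : S ∈ M.toStarSubalgebra ↔ S ∈ ρ.commutant := hM ▸ Iff.rfl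
  have hNmem (T) : T ∈ N.toStarSubalgebra ↔ T ∈ (ρ.Ind hρ).commutant := hN ▸ Iff.rfl
  have hcomp (T : N.toStarSubalgebra) (a : A) : T.1 ∘L indOp hρ hχ hd a =
      indOp hρ hχ hd a ∘L (adjoint J ∘L T.1 ∘L J) :=
    comp_indOp_of_mem_commutant hρ hχ hd hB ((hNmem _).1 T.2) a
  let f : N.toStarSubalgebra →⋆ₐ[ℂ] M.toStarSubalgebra :=
    { toFun := fun T => ⟨adjoint J ∘L T.1 ∘L J,
        (hMmem _).2 (comp_indOp_mem_commutant hρ hχ hd (hcomp T))⟩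
      map_one' := Subtype.ext hJJ
      map_mul' := fun T T' => Subtype.ext <| by
        change adjoint J ∘L (T.1 ∘L T'.1) ∘L J = (adjoint J ∘L T.1 ∘L J) ∘L (adjoint J ∘L T'.1 ∘L J)
        rw [comp_assoc T.1]
        refine (congrArg (fun X => adjoint J ∘L T.1 ∘L X) (hcomp T' 1)).trans ?_
        simp only [← hJ, comp_assoc]
      map_zero' := Subtype.ext <| by simp
      map_add' := fun T T' => Subtype.ext <| by simp
      commutes' := fun c => Subtype.ext <| by
        ext x
        have := congrArg (c • ·) (DFunLike.congr_fun hJJ x)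
        simpa [Algebra.algebraMap_eq_smul_one] using this
      map_star' := fun T => Subtype.ext <| by
        change adjoint J ∘L adjoint T.1 ∘L J = adjoint (adjoint J ∘L T.1 ∘L J)
        rw [adjoint_comp, adjoint_comp, adjoint_adjoint, comp_assoc] }
  refine ⟨(StarAlgEquiv.ofBijective f ⟨fun T T' h => Subtype.ext ?_, fun S => ?_⟩).symm⟩
  · have h' : adjoint J ∘L T.1 ∘L J = adjoint J ∘L T'.1 ∘L J := congrArg Subtype.val h
    exact ext_of_indOp hρ hχ hd fun a => by rw [hcomp T, h', ← hcomp T']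
  · obtain ⟨T, hT⟩ := exists_comp_indOp hρ hχ hd hB ((hMmem _).1 S.2)
    refine ⟨⟨T, (hNmem _).2 (mem_commutant_ind hρ hχ hd hT)⟩, Subtype.ext ?_⟩
    change adjoint J ∘L T ∘L J = S.1
    rw [hT, ← comp_assoc, hJJ]; rfl

/-! ### Irreducibility -/

/-- An orthogonal decomposition of the induced representation restricts to one of its weight space
for `χ`, which is a copy of `ρ` and generates the induced representation. -/
theorem IsIrreducible.ind (hB : 𝒢.IsCommutativeBase) (hχ : ρ.RestrictsToMultiple χ)
    (hd : ρ.dom = ⊤) (h : ρ.IsIrreducible) :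
    (ρ.Ind hρ).IsIrreducible := by
  have main (D₁ D₂ : Submodule ℂ (ρ.Ind hρ).dom) (h₂ : ∀ a, ∀ φ ∈ D₂, (ρ.Ind hρ).act a φ ∈ D₂)
      (ho : ∀ φ ∈ D₁, ∀ ψ ∈ D₂, inner ℂ φ ψ = 0) (hD : ∀ φ, indUnit hρ φ ∈ D₂) : D₁ = ⊥ := by
    refine (Submodule.eq_bot_iff _).2 fun v hv => Subtype.ext ((isCore_ind hρ).eq_zero ?_)
    rintro _ ⟨ξ, rfl⟩
    have hm : indVec hρ ξ ∈ D₂ := ?_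
    · exact (Submodule.coe_inner _ _ _).symm.trans (inner_eq_zero_symm.1 (ho v hv _ hm))
    induction ξ with
    | zero => simp
    | add ξ ξ' h h' => rw [_root_.map_add]; exact D₂.add_mem h h'
    | tmul a φ => rw [← act_indUnit]; exact h₂ a _ (hD φ)
  intro D₁ D₂ h₁ h₂ ho hsup
  have hinj : Function.Injective (indUnit hρ) := fun φ ψ h =>
    Subtype.ext (indOp_one_injective hρ hχ hd (congrArg Subtype.val h))
  have htop : D₁.comap (indUnit hρ) ⊔ D₂.comap (indUnit hρ) = ⊤ := by
    refine eq_top_iff.2 fun φ _ => ?_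
    obtain ⟨v₁, hv₁, v₂, hv₂, hv⟩ := Submodule.mem_sup.1
      (hsup ▸ Submodule.mem_top : indUnit hρ φ ∈ D₁ ⊔ D₂)
    -- `π(b) v₁ - χ(b) v₁ ∈ D₁` is the negative of `π(b) v₂ - χ(b) v₂ ∈ D₂`, so both vanish
    have hz (b : 𝒢.base) : (ρ.Ind hρ).act b v₁ - χ b • v₁ = 0 ∧
        (ρ.Ind hρ).act b v₂ - χ b • v₂ = 0 := by
      have hm₁ : (ρ.Ind hρ).act b v₁ - χ b • v₁ ∈ D₁ := D₁.sub_mem (h₁ _ _ hv₁) (D₁.smul_mem _ hv₁)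
      have hm₂ : (ρ.Ind hρ).act b v₂ - χ b • v₂ ∈ D₂ := D₂.sub_mem (h₂ _ _ hv₂) (D₂.smul_mem _ hv₂)
      have hs : ((ρ.Ind hρ).act b v₁ - χ b • v₁) + ((ρ.Ind hρ).act b v₂ - χ b • v₂) = 0 := by
        have := indUnit_mem_weightSpace hρ hχ φ b
        rw [← hv, _root_.map_add, smul_add] at this
        rw [sub_add_sub_comm, this, sub_self]
      have h0 : (ρ.Ind hρ).act b v₂ - χ b • v₂ = 0 := by
        have h3 := ho _ hm₁ _ hm₂
        rw [eq_neg_of_add_eq_zero_left hs, inner_neg_left, neg_eq_zero] at h3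
        exact inner_self_eq_zero.1 h3
      exact ⟨by simpa [h0] using hs, h0⟩
    obtain ⟨φ₁, rfl⟩ := exists_indUnit_eq hρ hB hχ hd fun b => sub_eq_zero.1 (hz b).1
    obtain ⟨φ₂, rfl⟩ := exists_indUnit_eq hρ hB hχ hd fun b => sub_eq_zero.1 (hz b).2
    exact Submodule.mem_sup.2 ⟨φ₁, hv₁, φ₂, hv₂, hinj ((_root_.map_add _ _ _).trans hv)⟩
  have hE := h (D₁.comap (indUnit hρ)) (D₂.comap (indUnit hρ))
    (fun x φ hφ => by rw [Submodule.mem_comap, ← act_coe_indUnit]; exact h₁ _ _ hφ)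
    (fun x φ hφ => by rw [Submodule.mem_comap, ← act_coe_indUnit]; exact h₂ _ _ hφ)
    (fun φ hφ ψ hψ => (inner_indOp_one hρ hχ hd φ ψ).symm.trans (ho _ hφ _ hψ)) htop
  rcases hE with hE | hE
  · refine Or.inl (main D₁ D₂ h₂ ho fun φ => ?_)
    rw [hE, bot_sup_eq] at htop
    exact (htop ▸ Submodule.mem_top : φ ∈ D₂.comap (indUnit hρ))
  · refine Or.inr (main D₂ D₁ h₁ (fun φ hφ ψ hψ => inner_eq_zero_symm.1 (ho ψ hψ φ hφ)) fun φ => ?_)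
    rw [hE, sup_bot_eq] at htop
    exact (htop ▸ Submodule.mem_top : φ ∈ D₁.comap (indUnit hρ))

/-- An orthogonal decomposition of `ρ` gives a projection in the commutant of `ρ`; the projection
that it induces decomposes the induced representation. -/
theorem IsIrreducible.of_ind (hB : 𝒢.IsCommutativeBase) (hχ : ρ.RestrictsToMultiple χ)
    (hd : ρ.dom = ⊤) (h : (ρ.Ind hρ).IsIrreducible) :
    ρ.IsIrreducible := by
  intro D₁ D₂ h₁ h₂ ho hsup
  have hdec (φ : ρ.dom) : ∃ φ₁ ∈ D₁, ∃ φ₂ ∈ D₂, φ₁ + φ₂ = φ :=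
    Submodule.mem_sup.1 (hsup ▸ Submodule.mem_top : φ ∈ D₁ ⊔ D₂)
  let E : Submodule ℂ H := D₁.map ρ.dom.subtype
  have horth {φ : ρ.dom} (hφ : φ ∈ D₂) : (φ : H) ∈ Eᗮ := by
    rw [Submodule.mem_orthogonal]
    rintro _ ⟨ψ, hψ, rfl⟩
    exact ho ψ hψ φ hφ
  have hproj : E.HasOrthogonalProjection := ⟨forall_of_dom_eq_top hd fun φ => by
    obtain ⟨φ₁, hφ₁, φ₂, hφ₂, rfl⟩ := hdec φ
    exact ⟨φ₁, ⟨φ₁, hφ₁, rfl⟩, by simpa using horth hφ₂⟩⟩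
  let S : H →L[ℂ] H := E.starProjection
  have hS₁ {φ : ρ.dom} (hφ : φ ∈ D₁) : S φ = φ :=
    Submodule.starProjection_eq_self_iff.2 ⟨φ, hφ, rfl⟩
  have hS₂ {φ : ρ.dom} (hφ : φ ∈ D₂) : S φ = 0 :=
    (Submodule.starProjection_apply_eq_zero_iff E).2 (horth hφ)
  have hSmem : S ∈ ρ.commutant := by
    refine ⟨fun _ => mem_dom_of_eq_top hd _, fun x φ => ?_⟩
    obtain ⟨φ₁, hφ₁, φ₂, hφ₂, rfl⟩ := hdec φ
    have e : (⟨S ((φ₁ + φ₂ : ρ.dom) : H), mem_dom_of_eq_top hd _⟩ : ρ.dom) = φ₁ :=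
      Subtype.ext (by rw [Submodule.coe_add, _root_.map_add, hS₁ hφ₁, hS₂ hφ₂, add_zero])
    rw [e, _root_.map_add, Submodule.coe_add, _root_.map_add, hS₁ (h₁ x _ hφ₁),
      hS₂ (h₂ x _ hφ₂), add_zero]
  have hSS : S ∘L S = S := (Submodule.isIdempotentElem_starProjection E).eq
  have hSa : adjoint S = S := (isSelfAdjoint_starProjection E).adjoint_eq
  obtain ⟨T, hT⟩ := exists_comp_indOp hρ hχ hd hB hSmem
  have hTT (x) : T (T x) = T x := by
    have : T ∘L T = T := ext_of_indOp hρ hχ hd fun a => by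
      rw [comp_assoc, hT, ← comp_assoc, hT, comp_assoc, hSS]
    exact DFunLike.congr_fun this x
  have hTa : adjoint T = T := ext_of_indOp hρ hχ hd fun a => by
    rw [adjoint_comp_indOp hρ hχ hd hT, hT, hSa]
  obtain ⟨hm, hact⟩ := mem_commutant_ind hρ hχ hd hT
  let t : (ρ.Ind hρ).dom →ₗ[ℂ] IndSpace ρ hρ := T.toLinearMap ∘ₗ (ρ.Ind hρ).dom.subtype
  have hunit (φ : ρ.dom) : T (indUnit hρ φ) = indOp hρ hχ hd 1 (S φ) :=
    DFunLike.congr_fun (hT 1) (φ : H)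
  have hzero {φ : ρ.dom} (h0 : indUnit hρ φ = 0) : φ = 0 :=
    Subtype.ext (indOp_one_injective hρ hχ hd ((congrArg Subtype.val h0).trans (map_zero _).symm))
  refine (h (LinearMap.ker (t - (ρ.Ind hρ).dom.subtype)) (LinearMap.ker t) ?_ ?_ ?_ ?_).imp
    (fun h => (Submodule.eq_bot_iff _).2 fun φ hφ => hzero ((Submodule.eq_bot_iff _).1 h _ ?_))
    (fun h => (Submodule.eq_bot_iff _).2 fun φ hφ => hzero ((Submodule.eq_bot_iff _).1 h _ ?_))
  · intro a φ hφ
    rw [LinearMap.mem_ker, LinearMap.sub_apply, sub_eq_zero] at hφ ⊢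
    refine (hact a φ).symm.trans (congrArg (fun x => ((ρ.Ind hρ).act a x : IndSpace ρ hρ)) ?_)
    exact Subtype.ext hφ
  · intro a φ hφ
    have h0 : (⟨T φ, hm φ⟩ : (ρ.Ind hρ).dom) = 0 := Subtype.ext hφ
    refine (hact a φ).symm.trans ?_
    rw [h0, map_zero]; rfl
  · intro φ hφ ψ hψ
    rw [LinearMap.mem_ker, LinearMap.sub_apply, sub_eq_zero] at hφ
    have h1 : T φ = φ := hφ
    have h2 : T ψ = 0 := hψ
    change ⟪(φ : IndSpace ρ hρ), (ψ : IndSpace ρ hρ)⟫_ℂ = 0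
    rw [← h1, ← adjoint_inner_right, hTa, h2, inner_zero_right]
  · refine eq_top_iff.2 fun φ _ => Submodule.mem_sup.2
      ⟨⟨T φ, hm φ⟩, ?_, φ - ⟨T φ, hm φ⟩, ?_, add_sub_cancel _ _⟩
    · rw [LinearMap.mem_ker, LinearMap.sub_apply, sub_eq_zero]
      exact hTT φ
    · change T (φ - T φ) = 0
      rw [map_sub, hTT, sub_self]
  · rw [LinearMap.mem_ker, LinearMap.sub_apply, sub_eq_zero]
    refine (hunit φ).trans ?_
    rw [hS₁ hφ]; rfl
  · refine (hunit φ).trans ?_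
    rw [hS₂ hφ, map_zero]

end StarRep

/-! ### Induction on unitary equivalence classes -/

namespace HilbertRep

variable {A : Type u} [Ring A] [StarRing A] [Algebra ℂ A]

/-- The representation of `A` on the zero space. -/
def zero (A : Type u) [Ring A] [StarRing A] [Algebra ℂ A] : HilbertRep.{u, w} A where
  space := EuclideanSpace ℂ PEmpty.{w + 1}
  rep :=
    { dom := ⊤
      dense_dom := by simp
      act := 0
      inner_act := fun a φ ψ => by simp }

theorem mkClass_eq_iff {π π' : HilbertRep.{u, w} A} :
    π.mkClass = π'.mkClass ↔ π.rep.UnitarilyEquivalent π'.rep :=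
  Quotient.eq

variable {G : Type v} [Group G] [StarModule ℂ A] {𝒢 : StarGrading G A} {K : Subgroup G}

open Classical in
/-- Induction on unitary equivalence classes. The value at a class without inducible members is the
class of the zero representation and carries no information. -/
def indClass (c : Class.{u, max u w} (𝒢.sub K)) : Class.{u, max u w} A :=
  if h : ∃ ρ : HilbertRep.{u, max u w} (𝒢.sub K), ρ.rep.Inducible ∧ ρ.mkClass = c then
    (h.choose.ind h.choose_spec.1).mkClass
  else (zero A).mkClass

theorem indClass_mkClass (ρ : HilbertRep.{u, max u w} (𝒢.sub K)) (hρ : ρ.rep.Inducible) :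
    indClass ρ.mkClass = (ρ.ind hρ).mkClass := by
  have h : ∃ ρ' : HilbertRep.{u, max u w} (𝒢.sub K), ρ'.rep.Inducible ∧ ρ'.mkClass = ρ.mkClass :=
    ⟨ρ, hρ, rfl⟩
  rw [indClass, dif_pos h]
  exact mkClass_eq_iff.2 ((mkClass_eq_iff.1 h.choose_spec.2).ind h.choose_spec.1 hρ)

end HilbertRep

namespace StarRep

open StarGrading HilbertRep

theorem AssociatedWithOrbit.wellBehaved {G : Type*} [Group G] {A : Type*} [Ring A] [StarRing A]
    [Algebra ℂ A] [StarModule ℂ A] {𝒢 : StarGrading G A} {H : Type*} [NormedAddCommGroup H]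
    [InnerProductSpace ℂ H] [CompleteSpace H] {π : StarRep A H} {χ : 𝒢.PosChar}
    (h : π.AssociatedWithOrbit χ) : π.WellBehaved 𝒢 :=
  h.imp fun _ => And.left

theorem associatedWithOrbit_ind {G : Type v} [Group G] [Countable G] {A : Type u} [Ring A]
    [StarRing A] [Algebra ℂ A] [StarModule ℂ A] {𝒢 : StarGrading G A}
    (hB : 𝒢.IsCommutativeBase) {χ : 𝒢.PosChar}
    {ρ : HilbertRep.{u, max u w} (𝒢.sub (stabilizer χ))} (hρ : ρ.rep.Inducible)
    (hχ : ρ.rep.RestrictsToMultiple χ) : (ρ.ind hρ).rep.AssociatedWithOrbit χ := by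
  have h : (ρ.rep.Ind hρ).AssociatedWithOrbit χ :=
    associatedWithOrbit_of_isCore hB (isClosedRep_ind hρ) (isCore_orbitSpan_ind hρ hB hχ)
  exact h

/-- The inverse of induction: the weight space of `χ`, as a representation of `A_H`. -/
theorem AssociatedWithOrbit.exists_ind {G : Type v} [Group G] [Countable G] {A : Type u} [Ring A]
    [StarRing A] [Algebra ℂ A] [StarModule ℂ A] {𝒢 : StarGrading G A}
    (hB : 𝒢.IsCommutativeBase) {χ : 𝒢.PosChar} {π : HilbertRep.{u, max u w} A}
    (h : π.rep.AssociatedWithOrbit χ) :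
    ∃ (ρ : HilbertRep.{u, max u w} (𝒢.sub (stabilizer χ))) (hρ : ρ.rep.Inducible),
      ρ.rep.IsClosedRep ∧ ρ.rep.RestrictsToMultiple χ ∧ (ρ.ind hρ).mkClass = π.mkClass := by
  obtain ⟨E, hE, hs⟩ := h
  have hπ : π.rep.IsClosedRep := IsClosedRep.of_res_base hE.integrable.1
  have := completeSpace_weightSpace hπ χ
  have hχ : (π.rep.weightRep hB χ).RestrictsToMultiple χ := restrictsToMultiple_weightRep hB
  exact ⟨⟨π.rep.weightSpace χ, π.rep.weightRep hB χ⟩, hχ.inducible hB,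
    hχ.isBoundedRep.isClosedRep rfl, hχ, mkClass_eq_iff.2 <|
      unitarilyEquivalent_ind_weightRep hB hπ (isCore_orbitSpan_of_isAssociated hB hE hs) _⟩

end StarRep

end GradedStar

end

theorem mainTheorem1 {G : Type v} [Group G] [Countable G]
    {A : Type u} [Ring A] [StarRing A] [Algebra ℂ A] [StarModule ℂ A]
    (𝒢 : GradedStar.StarGrading G A)
    (hB : 𝒢.IsCommutativeBase)
    (hcompat : 𝒢.IsCompatible)
    [LocallyCompactSpace 𝒢.PosChar]
    (hgen : ∃ S : Set 𝒢.base, S.Countable ∧ StarAlgebra.adjoin ℂ S = ⊤)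
    (χ : 𝒢.PosChar) :
    (∀ ρ : GradedStar.HilbertRep.{u, max u w} (𝒢.sub (𝒢.stabilizer χ)),
      ρ.rep.RestrictsToMultiple χ →
        ρ.rep.IsBoundedRep ∧ ρ.rep.Inducible ∧ (ρ.rep.IsClosedRep → ρ.rep.dom = ⊤)) ∧
    (∃ F : GradedStar.HilbertRep.Class.{u, max u w} (𝒢.sub (𝒢.stabilizer χ)) → GradedStar.HilbertRep.Class.{u, max u w} A,
      (∀ (ρ : GradedStar.HilbertRep.{u, max u w} (𝒢.sub (𝒢.stabilizer χ))) (hρ : ρ.rep.Inducible),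
        ρ.rep.RestrictsToMultiple χ → F ρ.mkClass = (ρ.ind hρ).mkClass) ∧
      Set.BijOn F
        {c | ∃ ρ : GradedStar.HilbertRep.{u, max u w} (𝒢.sub (𝒢.stabilizer χ)),
          ρ.rep.IsClosedRep ∧ ρ.rep.Inducible ∧ ρ.rep.RestrictsToMultiple χ ∧ ρ.mkClass = c}
        {c | ∃ π : GradedStar.HilbertRep.{u, max u w} A,
          π.rep.WellBehaved 𝒢 ∧ π.rep.AssociatedWithOrbit χ ∧ π.mkClass = c}) ∧
    (∀ (ρ : GradedStar.HilbertRep.{u, max u w} (𝒢.sub (𝒢.stabilizer χ))) (hρ : ρ.rep.Inducible),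
      ρ.rep.IsClosedRep → ρ.rep.RestrictsToMultiple χ →
      (∃ (M : VonNeumannAlgebra ρ.space) (N : VonNeumannAlgebra (ρ.ind hρ).space),
        (M : Set (ρ.space →L[ℂ] ρ.space)) = ρ.rep.commutant ∧
        (N : Set ((ρ.ind hρ).space →L[ℂ] (ρ.ind hρ).space)) = (ρ.ind hρ).rep.commutant ∧
        Nonempty (M.toStarSubalgebra ≃⋆ₐ[ℂ] N.toStarSubalgebra)) ∧
      ((ρ.ind hρ).rep.IsIrreducible ↔ ρ.rep.IsIrreducible)) := by
  refine ⟨fun ρ hχ => ⟨hχ.isBoundedRep, hχ.inducible hB, hχ.isBoundedRep.dom_eq_top⟩,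
    ⟨GradedStar.HilbertRep.indClass, fun ρ hρ _ => GradedStar.HilbertRep.indClass_mkClass ρ hρ,
      ?_, ?_, ?_⟩, fun ρ hρ hcl hχ => ?_⟩
  · rintro _ ⟨ρ, -, hρ, hχ, rfl⟩
    have h := GradedStar.StarRep.associatedWithOrbit_ind hB hρ hχ
    exact ⟨ρ.ind hρ, h.wellBehaved, h,
      (GradedStar.HilbertRep.indClass_mkClass ρ hρ).symm⟩
  · rintro _ ⟨ρ, hcl, hρ, hχ, rfl⟩ _ ⟨ρ', hcl', hρ', hχ', rfl⟩ h
    rw [GradedStar.HilbertRep.indClass_mkClass ρ hρ, GradedStar.HilbertRep.indClass_mkClass ρ' hρ',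
      GradedStar.HilbertRep.mkClass_eq_iff] at h
    exact GradedStar.HilbertRep.mkClass_eq_iff.2 <| GradedStar.StarRep.UnitarilyEquivalent.of_ind
      hρ hρ' hB hχ hχ' (hχ.isBoundedRep.dom_eq_top hcl) (hχ'.isBoundedRep.dom_eq_top hcl') h
  · rintro _ ⟨π, -, hπ, rfl⟩
    obtain ⟨ρ, hρ, hcl, hχ, h⟩ := hπ.exists_ind hB
    exact ⟨ρ.mkClass, ⟨ρ, hcl, hρ, hχ, rfl⟩,
      (GradedStar.HilbertRep.indClass_mkClass ρ hρ).trans h⟩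
  · have hd := hχ.isBoundedRep.dom_eq_top hcl
    exact ⟨GradedStar.StarRep.exists_commutant_starAlgEquiv hρ hB hχ hd,
      fun h => GradedStar.StarRep.IsIrreducible.of_ind hρ hB hχ hd h,
      fun h => GradedStar.StarRep.IsIrreducible.ind hρ hB hχ hd h⟩
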